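/- Let $q\in\mathbb{C}\setminus\{0\}$ be not a root of unity, and put $$R(u,v)=(u-v)\sum_{i\ne j}E_{ii}\otimes E_{jj}+(q^{-1}u-qv)\sum_iE_{ii}\otimes E_{ii}+(q^{-1}-q)u\sum_{i>j}E_{ij}\otimes E_{ji}+(q^{-1}-q)v\sum_{i<j}E_{ij}\otimes E_{ji}$$ in $\mathrm{End}(\mathbb{C}^N)^{\otimes2}$; let $R^t$ be its partial transpose in the first factor, and $\overline R(x)=R(x,1)/(x-1)$. The orthogonal twisted $q$-Yangian $\mathrm{Y}_q^{\mathrm{tw}}(\mathfrak{o}_N)$ is the unital associative $\mathbb{C}$-algebra with generators $s_{ij}^{(r)}$ ($1\le i,j\le N$, $r\ge0$) and relations $s_{ij}^{(0)}=0$ for $i<j$, $s_{ii}^{(0)}=1$, and $$R(u,v)\,S_1(u)\,R^t(u^{-1}v^{-1},1)\,S_2(v)=S_2(v)\,R^t(u^{-1}v^{-1},1)\,S_1(u)\,R(u,v),\qquad(*)$$ where $S(u)=(s_{ij}(u))$, $s_{ij}(u)=\sum_{r\ge0}s_{ij}^{(r)}u^{-r}$. The symplectic twisted $q$-Yangian $\mathrm{Y}_q^{\mathrm{tw}}(\mathfrak{sp}_N)$,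 $N=2n$, has generators $s_{ij}^{(r)}$ and $(s_{ii'}^{(0)})^{-1}$ for $i=1,3,\dots,2n-1$, where $(2k-1)'=2k$ and $(2k)'=2k-1$, and relations $(*)$; $s_{ij}^{(0)}=0$ for $i<j$, $j\ne i'$; $s_{ii'}^{(0)}(s_{ii'}^{(0)})^{-1}=(s_{ii'}^{(0)})^{-1}s_{ii'}^{(0)}=1$ and $s_{i'i'}^{(0)}s_{ii}^{(0)}-q^2s_{i'i}^{(0)}s_{ii'}^{(0)}=q^3$ for $i=1,3,\dots,2n-1$. Let $P^q=\sum_iE_{ii}\otimes E_{ii}+q\sum_{i>j}E_{ij}\otimes E_{ji}+q^{-1}\sum_{i<j}E_{ij}\otimes E_{ji}$, let $\sigma\mapsto P^q_\sigma$ be the representation of $S_m$ on $(\mathbb{C}^N)^{\otimes m}$ sending $(a,a+1)$ to $P^q_{a,a+1}$, and let $A_m^q=\frac1{m!}\sum_{\sigma\in S_m}\mathrm{sgn}(\sigma)P^q_\sigma$. With $u_a=q^{2-2a}u$, $S_a=S_a(u_a)$ and $\overline R^t_{ab}=\overline R^t_{ab}(u_a^{-1}u_b^{-1})$ put $$\langle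 S_1,\dots,S_m\rangle=S_1(\overline R^t_{12}\cdots\overline R^t_{1m})\,S_2(\overline R^t_{23}\cdots\overline R^t_{2m})\cdots S_m .$$ The Sklyanin minors are the series $s^{i_1\cdots i_m}_{j_1\cdots j_m}(u)$ in $$A_m^q\langle S_1,\dots,S_m\rangle=\frac1{m!}\sum s^{i_1\cdots i_m}_{j_1\cdots j_m}(u)\otimes E_{i_1j_1}\otimes\cdots\otimes E_{i_mj_m},$$ and $\mathrm{sdet}_q(S(u))=s^{1\cdots N}_{1\cdots N}(u)$. Rational functions of $u$ are expanded in powers of $u^{-1}$. Let $s^\sharp_{ii}(u)=s_{ii}(u)$ and $$s^\sharp_{ij}(u)=\frac{u^{-1}-u}{qu^{-1}-q^{-1}u}\,s_{ij}(u)+\frac{(q-q^{-1})u^{\mp1}}{qu^{-1}-q^{-1}u}\,s_{ji}(u),$$ with $u^{-1}$ in the second numerator if $i<j$ and $u$ if $i>j$. Define $p\mapsto p'$ recursively on sequences $p=(p_1,\dots,p_N)$ that list the elements of a set $\omega_1<\dots<\omega_N$. For $N\le2$, $p'=(\omega_1,\dots,\omega_N)$. For $N\ge3$, map ordered pairs of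 distinct elements by $(\omega_k,\omega_l)\mapsto(\omega_l,\omega_k)$ for $k,l<N$; $(\omega_k,\omega_N)\mapsto(\omega_{N-1},\omega_k)$ and $(\omega_N,\omega_k)\mapsto(\omega_k,\omega_{N-1})$ for $k<N-1$; $(\omega_{N-1},\omega_N)$ and $(\omega_N,\omega_{N-1})\mapsto(\omega_{N-1},\omega_{N-2})$. Then $p'=(p_1',\dots,p_{N-1}',\omega_N)$, where $(p_1',p_{N-1}')$ is the image of $(p_1,p_N)$ and $p_2',\dots,p_{N-2}'$ are all but the last entry of $(p_2,\dots,p_{N-1})'$. Let $l$ be the number of inversions. **Theorem.** Let $S(u)$ be the generator matrix of $\mathrm{Y}_q^{\mathrm{tw}}(\mathfrak{o}_N)$, or of $\mathrm{Y}_q^{\mathrm{tw}}(\mathfrak{sp}_N)$ with $N$ even, and let $n=\lfloor N/2\rfloor$. Then $$\mathrm{sdet}_q(S(u))=\sum_{p\in S_N}(-q)^{l(p')-l(p)}\,s^\sharp_{p_1p_1'}(u)\cdots s^\sharp_{p_np_n'}(q^{2-2n}u)\,s_{p_{n+1}p_{n+1}'}(q^{-2n}u)\cdots s_{p_Np_N'}(q^{2-2N}u).$$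 -/

import Mathlib

open scoped Kronecker BigOperators

noncomputable section

namespace Sklyanin

/-! ### R-matrices -/

/-- The spectral R-matrix `R(u, v)` in `End(ℂ^N) ⊗ End(ℂ^N)`, with parameters in a commutative
`ℂ`-algebra. The entry at `((i, k), (j, l))` is the coefficient of `E_ij ⊗ E_kl`. -/
def RMat (q : ℂ) (N : ℕ) {K : Type*} [CommRing K] [Algebra ℂ K] (u v : K) :
    Matrix (Fin N × Fin N) (Fin N × Fin N) K :=
  (∑ i : Fin N, ∑ j : Fin N, if i ≠ j then
      (u - v) • (Matrix.single i i (1 : K) ⊗ₖ Matrix.single j j (1 : K)) else 0)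
  + (∑ i : Fin N,
      (q⁻¹ • u - q • v) • (Matrix.single i i (1 : K) ⊗ₖ Matrix.single i i (1 : K)))
  + (∑ i : Fin N, ∑ j : Fin N, if j < i then
      ((q⁻¹ - q) • u) • (Matrix.single i j (1 : K) ⊗ₖ Matrix.single j i (1 : K)) else 0)
  + (∑ i : Fin N, ∑ j : Fin N, if i < j then
      ((q⁻¹ - q) • v) • (Matrix.single i j (1 : K) ⊗ₖ Matrix.single j i (1 : K)) else 0)

/-- Partial transpose in the first tensor factor. -/
def transpose₁ {N : ℕ} {B : Type*} (M : Matrix (Fin N × Fin N) (Fin N × Fin N) B) :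
    Matrix (Fin N × Fin N) (Fin N × Fin N) B :=
  Matrix.of fun x y => M (y.1, x.2) (x.1, y.2)

/-! ### Twisted `q`-Yangians

Formal series in `u⁻¹` are `PowerSeries` in the variable `z = u⁻¹`; series in `u⁻¹, v⁻¹` are
`MvPowerSeries (Fin 2)` in the variables `z₀ = u⁻¹`, `z₁ = v⁻¹`. -/

/-- The matrix `S(z_k) = (∑_r s_ij^{(r)} z_k^r)` over series in two variables. -/
def genMatrix {N : ℕ} {F : Type*} [Ring F] (s : Fin N → Fin N → ℕ → F) (k : Fin 2) :
    Matrix (Fin N) (Fin N) (MvPowerSeries (Fin 2) F) :=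
  Matrix.of fun i j => fun d => if d = Finsupp.single k (d k) then s i j (d k) else 0

/-- Scalar coefficients of an R-matrix viewed inside a `ℂ`-algebra. -/
def liftMv (F : Type*) [Ring F] [Algebra ℂ F] {N : ℕ}
    (M : Matrix (Fin N × Fin N) (Fin N × Fin N) (MvPowerSeries (Fin 2) ℂ)) :
    Matrix (Fin N × Fin N) (Fin N × Fin N) (MvPowerSeries (Fin 2) F) :=
  M.map (MvPowerSeries.map (algebraMap ℂ F))

/-- `R(u/v)` up to a scalar factor: `u⁻¹v⁻¹ R(u, v) = R(v⁻¹, u⁻¹)`. The scalar normalisation of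
`R(u/v)` and of `Rᵗ(1/uv)` occurs on both sides of the reflection equation and cancels. -/
def reflR (q : ℂ) (N : ℕ) (F : Type*) [Ring F] [Algebra ℂ F] :
    Matrix (Fin N × Fin N) (Fin N × Fin N) (MvPowerSeries (Fin 2) F) :=
  liftMv F (RMat q N (MvPowerSeries.X 1) (MvPowerSeries.X 0))

/-- `Rᵗ(1/uv)` up to a scalar factor: the partial transpose of `R(u⁻¹v⁻¹, 1)`. -/
def reflRt (q : ℂ) (N : ℕ) (F : Type*) [Ring F] [Algebra ℂ F] :
    Matrix (Fin N × Fin N) (Fin N × Fin N) (MvPowerSeries (Fin 2) F) :=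
  liftMv F (transpose₁ (RMat q N (MvPowerSeries.X 0 * MvPowerSeries.X 1) 1))

/-- `R(u/v) S₁(u) Rᵗ(1/uv) S₂(v)`. -/
def reflLHS (q : ℂ) {N : ℕ} {F : Type*} [Ring F] [Algebra ℂ F] (s : Fin N → Fin N → ℕ → F) :
    Matrix (Fin N × Fin N) (Fin N × Fin N) (MvPowerSeries (Fin 2) F) :=
  reflR q N F * (genMatrix s 0 ⊗ₖ 1) * reflRt q N F * (1 ⊗ₖ genMatrix s 1)

/-- `S₂(v) Rᵗ(1/uv) S₁(u) R(u/v)`. -/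
def reflRHS (q : ℂ) {N : ℕ} {F : Type*} [Ring F] [Algebra ℂ F] (s : Fin N → Fin N → ℕ → F) :
    Matrix (Fin N × Fin N) (Fin N × Fin N) (MvPowerSeries (Fin 2) F) :=
  (1 ⊗ₖ genMatrix s 1) * reflRt q N F * (genMatrix s 0 ⊗ₖ 1) * reflR q N F

/-- Generators `s_ij^{(r)}` of the orthogonal twisted `q`-Yangian. -/
abbrev OrthFree (N : ℕ) : Type := FreeAlgebra ℂ (Fin N × Fin N × ℕ)

/-- The free generator `s_ij^{(r)}`. -/
def orthGen {N : ℕ} (i j : Fin N) (r : ℕ) : OrthFree N := FreeAlgebra.ι ℂ (i, j, r)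

/-- Defining relations of the orthogonal twisted `q`-Yangian. -/
inductive OrthRel (q : ℂ) (N : ℕ) : OrthFree N → OrthFree N → Prop
  | upper (i j : Fin N) (h : i < j) : OrthRel q N (orthGen i j 0) 0
  | diag (i : Fin N) : OrthRel q N (orthGen i i 0) 1
  | reflection (x y : Fin N × Fin N) (d : Fin 2 →₀ ℕ) :
      OrthRel q N (MvPowerSeries.coeff d (reflLHS q orthGen x y))
        (MvPowerSeries.coeff d (reflRHS q orthGen x y))

/-- The orthogonal twisted `q`-Yangian `Y_q^tw(o_N)`. -/
abbrev OrthYangian (q : ℂ) (N : ℕ) : Type := RingQuot (OrthRel q N)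

/-- The matrix `S(u)` of generating series of `Y_q^tw(o_N)`. -/
def orthS (q : ℂ) (N : ℕ) : Matrix (Fin N) (Fin N) (PowerSeries (OrthYangian q N)) :=
  Matrix.of fun i j =>
    PowerSeries.mk fun r => RingQuot.mkAlgHom ℂ (OrthRel q N) (orthGen i j r)

/-- Generators of the symplectic twisted `q`-Yangian: `s_ij^{(r)}`, and one generator
`(s_{ii'}^{(0)})⁻¹` for each pair `(i, i') = (2k-1, 2k)`, `k = 1, …, n`. -/
abbrev SympFree (n : ℕ) : Type :=
  FreeAlgebra ℂ ((Fin (2 * n) × Fin (2 * n) × ℕ) ⊕ Fin n)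

/-- The free generator `s_ij^{(r)}`. -/
def sympGen {n : ℕ} (i j : Fin (2 * n)) (r : ℕ) : SympFree n :=
  FreeAlgebra.ι ℂ (Sum.inl (i, j, r))

/-- The free generator `(s_{ii'}^{(0)})⁻¹`. -/
def sympInvGen {n : ℕ} (k : Fin n) : SympFree n := FreeAlgebra.ι ℂ (Sum.inr k)

/-- The index `2k-1` of the pair `(2k-1, 2k)` (here zero-based: `2k`). -/
def oddIdx {n : ℕ} (k : Fin n) : Fin (2 * n) := ⟨2 * k, by omega⟩

/-- The index `(2k-1)' = 2k` of the pair `(2k-1, 2k)` (here zero-based: `2k+1`). -/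
def evenIdx {n : ℕ} (k : Fin n) : Fin (2 * n) := ⟨2 * k + 1, by omega⟩

/-- Defining relations of the symplectic twisted `q`-Yangian. -/
inductive SympRel (q : ℂ) (n : ℕ) : SympFree n → SympFree n → Prop
  | upper (i j : Fin (2 * n)) (h : i < j) (h' : ¬ ∃ k : Fin n, i = oddIdx k ∧ j = evenIdx k) :
      SympRel q n (sympGen i j 0) 0
  | quad (k : Fin n) :
      SympRel q n
        (sympGen (evenIdx k) (evenIdx k) 0 * sympGen (oddIdx k) (oddIdx k) 0
          - q ^ 2 • (sympGen (evenIdx k) (oddIdx k) 0 * sympGen (oddIdx k) (evenIdx k) 0))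
        (algebraMap ℂ (SympFree n) (q ^ 3))
  | mul_inv (k : Fin n) : SympRel q n (sympGen (oddIdx k) (evenIdx k) 0 * sympInvGen k) 1
  | inv_mul (k : Fin n) : SympRel q n (sympInvGen k * sympGen (oddIdx k) (evenIdx k) 0) 1
  | reflection (x y : Fin (2 * n) × Fin (2 * n)) (d : Fin 2 →₀ ℕ) :
      SympRel q n (MvPowerSeries.coeff d (reflLHS q sympGen x y))
        (MvPowerSeries.coeff d (reflRHS q sympGen x y))

/-- The symplectic twisted `q`-Yangian `Y_q^tw(sp_{2n})`. -/
abbrev SympYangian (q : ℂ) (n : ℕ) : Type := RingQuot (SympRel q n)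

/-- The matrix `S(u)` of generating series of `Y_q^tw(sp_{2n})`. -/
def sympS (q : ℂ) (n : ℕ) :
    Matrix (Fin (2 * n)) (Fin (2 * n)) (PowerSeries (SympYangian q n)) :=
  Matrix.of fun i j =>
    PowerSeries.mk fun r => RingQuot.mkAlgHom ℂ (SympRel q n) (sympGen i j r)

/-! ### Operators on `m` tensor factors

An element of `B ⊗ (End ℂ^N)^{⊗ m}` is a matrix indexed by `Fin m → Fin N`: its entry at `(x, y)`
is the coefficient of `E_{x₁y₁} ⊗ ⋯ ⊗ E_{x_m y_m}`. -/

/-- `M` acting in the tensor factor `a`. -/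
def atSite {B : Type*} [Zero B] {N m : ℕ} (a : Fin m) (M : Matrix (Fin N) (Fin N) B) :
    Matrix (Fin m → Fin N) (Fin m → Fin N) B :=
  Matrix.of fun x y => if ∀ c, c ≠ a → x c = y c then M (x a) (y a) else 0

/-- `M` acting in the (distinct) tensor factors `a` and `b`. -/
def atPair {B : Type*} [Zero B] {N m : ℕ} (a b : Fin m)
    (M : Matrix (Fin N × Fin N) (Fin N × Fin N) B) :
    Matrix (Fin m → Fin N) (Fin m → Fin N) B :=
  Matrix.of fun x y =>
    if ∀ c, c ≠ a → c ≠ b → x c = y c then M (x a, x b) (y a, y b) else 0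

/-- The number of inversions of a sequence; for a permutation `(p₁, …, p_m)` this is its
length `l(p)`. -/
def invNum {m : ℕ} {α : Type*} [LinearOrder α] (p : Fin m → α) : ℕ :=
  (Finset.univ.filter fun ab : Fin m × Fin m => ab.1 < ab.2 ∧ p ab.2 < p ab.1).card

/-- The `q`-permutation operator `P^q` in `End(ℂ^N ⊗ ℂ^N)`. -/
def qSwap (q : ℂ) (N : ℕ) : Matrix (Fin N × Fin N) (Fin N × Fin N) ℂ :=
  (∑ i : Fin N, Matrix.single i i (1 : ℂ) ⊗ₖ Matrix.single i i (1 : ℂ))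
  + (∑ i : Fin N, ∑ j : Fin N, if j < i then
      q • (Matrix.single i j (1 : ℂ) ⊗ₖ Matrix.single j i (1 : ℂ)) else 0)
  + (∑ i : Fin N, ∑ j : Fin N, if i < j then
      q⁻¹ • (Matrix.single i j (1 : ℂ) ⊗ₖ Matrix.single j i (1 : ℂ)) else 0)

/-- The operator `P_σ^q`: the image of `σ` in the representation of the symmetric group that sends
the transposition `(i, i+1)` to `P^q` acting in the factors `i`, `i+1`. The matrix is written out
here; `qPerm_one`, `qPerm_mul` and `qPerm_swap` show that it is this representation, and
`qPerm_word` that it is the product of the `P^q` along any decomposition of `σ`. -/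
def qPerm (q : ℂ) (N : ℕ) {m : ℕ} (σ : Equiv.Perm (Fin m)) :
    Matrix (Fin m → Fin N) (Fin m → Fin N) ℂ :=
  Matrix.of fun x y =>
    if x = y ∘ (σ⁻¹ : Equiv.Perm (Fin m)) then q ^ ((invNum x : ℤ) - (invNum y : ℤ)) else 0

theorem qPerm_one (q : ℂ) (N m : ℕ) : qPerm q N (1 : Equiv.Perm (Fin m)) = 1 := by
  ext x y
  by_cases h : x = y
  · subst h
    simp [qPerm]
  · have h2 : ¬ x = y ∘ (id : Fin m → Fin m) := h
    simp [qPerm, h]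

theorem qPerm_mul {q : ℂ} (hq : q ≠ 0) (N : ℕ) {m : ℕ} (σ τ : Equiv.Perm (Fin m)) :
    qPerm q N (σ * τ) = qPerm q N σ * qPerm q N τ := by
  ext x w
  rw [Matrix.mul_apply, Finset.sum_eq_single (w ∘ (τ⁻¹ : Equiv.Perm (Fin m)))]
  · have h : w ∘ ((σ * τ)⁻¹ : Equiv.Perm (Fin m))
        = (w ∘ (τ⁻¹ : Equiv.Perm (Fin m))) ∘ (σ⁻¹ : Equiv.Perm (Fin m)) := by
      ext a
      simp [mul_inv_rev]
    simp only [qPerm, Matrix.of_apply, h]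
    by_cases hx : x = (w ∘ (τ⁻¹ : Equiv.Perm (Fin m))) ∘ (σ⁻¹ : Equiv.Perm (Fin m))
    · rw [if_pos hx, if_pos hx, if_pos trivial, ← zpow_add₀ hq]
      congr 1
      ring
    · rw [if_neg hx, if_neg hx, zero_mul]
  · intro y _ hy
    simp only [qPerm, Matrix.of_apply]
    rw [if_neg hy, mul_zero]
  · intro h
    exact absurd (Finset.mem_univ _) h

theorem qSwap_apply (q : ℂ) (N : ℕ) (a b c d : Fin N) :
    qSwap q N (a, b) (c, d) =
      if a = d ∧ b = c then (if a = b then 1 else if b < a then q else q⁻¹) else 0 := by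
  have key : ∀ i j : Fin N, (Matrix.single i j (1 : ℂ) ⊗ₖ Matrix.single j i (1 : ℂ)) (a, b) (c, d)
      = if i = a then (if j = b then (if a = d ∧ b = c then 1 else 0) else 0) else 0 := by
    intro i j
    simp only [Matrix.kroneckerMap_apply, Matrix.single_apply]
    grind
  have key' : ∀ i : Fin N, (Matrix.single i i (1 : ℂ) ⊗ₖ Matrix.single i i (1 : ℂ)) (a, b) (c, d)
      = if i = a then (if a = b then (if a = d ∧ b = c then 1 else 0) else 0) else 0 := by
    intro i
    rw [key]
    grind
  have e1 : (∑ i : Fin N, (Matrix.single i i (1 : ℂ) ⊗ₖ Matrix.single i i (1 : ℂ))) (a, b) (c, d)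
      = if a = b then (if a = d ∧ b = c then 1 else 0) else 0 := by
    rw [Matrix.sum_apply]
    simp only [key', Finset.sum_ite_eq', Finset.mem_univ, if_true]
  have e2 : ∀ (P : Fin N → Fin N → Prop) [∀ i j, Decidable (P i j)] (t : ℂ),
      (∑ i : Fin N, ∑ j : Fin N, if P i j then
        t • (Matrix.single i j (1 : ℂ) ⊗ₖ Matrix.single j i (1 : ℂ)) else 0) (a, b) (c, d)
      = if P a b then (if a = d ∧ b = c then t else 0) else 0 := by
    intro P _ t
    simp only [Matrix.sum_apply]
    rw [Finset.sum_eq_single a, Finset.sum_eq_single b]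
    · by_cases hP : P a b
      · simp only [if_pos hP, Matrix.smul_apply, key, if_true, smul_eq_mul]
        split_ifs <;> simp
      · simp [hP]
    · intro j _ hj
      by_cases hP : P a j
      · rw [if_pos hP, Matrix.smul_apply, key]
        simp [hj]
      · simp [hP]
    · simp
    · intro i _ hi
      refine Finset.sum_eq_zero fun j _ => ?_
      by_cases hP : P i j
      · rw [if_pos hP, Matrix.smul_apply, key]
        simp [hi]
      · simp [hP]
    · simp
  unfold qSwap
  rw [Matrix.add_apply, Matrix.add_apply, e1, e2 (fun i j => j < i), e2 (fun i j => i < j)]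
  rcases lt_trichotomy a b with h | h | h
  · simp [h, h.ne, h.not_gt]
  · simp [h]
  · simp [h, h.ne', h.not_gt]

theorem invNum_comp_swap {m : ℕ} {α : Type*} [LinearOrder α] (y : Fin m → α) (i j : Fin m)
    (hij : (j : ℕ) = i + 1) :
    (invNum (y ∘ Equiv.swap i j) : ℤ) - invNum y =
      if y i < y j then 1 else if y j < y i then -1 else 0 := by
  classical
  have hlt : i < j := by rw [Fin.lt_def]; omega
  have cast : ∀ p : Fin m → α, (invNum p : ℤ)
      = ∑ ab : Fin m × Fin m, if ab.1 < ab.2 ∧ p ab.2 < p ab.1 then 1 else 0 := by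
    intro p
    simp [invNum]
  have reidx : (invNum (y ∘ Equiv.swap i j) : ℤ)
      = ∑ ab : Fin m × Fin m,
        if Equiv.swap i j ab.1 < Equiv.swap i j ab.2 ∧ y ab.2 < y ab.1 then 1 else 0 := by
    rw [cast, ← Equiv.sum_comp ((Equiv.swap i j).prodCongr (Equiv.swap i j))]
    simp
  have ord : ∀ a b : Fin m, (a, b) ≠ (i, j) → (a, b) ≠ (j, i) →
      (Equiv.swap i j a < Equiv.swap i j b ↔ a < b) := by
    intro a b h1 h2
    simp only [ne_eq, Prod.mk.injEq, not_and] at h1 h2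
    simp only [Equiv.swap_apply_def, Fin.lt_def, Fin.ext_iff] at h1 h2 ⊢
    split_ifs <;> omega
  rw [reidx, cast, ← Finset.sum_sub_distrib]
  have hne : ((i, j) : Fin m × Fin m) ≠ (j, i) := by
    intro h
    exact hlt.ne (Prod.mk.inj h).1
  rw [← Finset.sum_subset (Finset.subset_univ {(i, j), (j, i)}), Finset.sum_pair hne]
  · simp only [Equiv.swap_apply_left, Equiv.swap_apply_right]
    rcases lt_trichotomy (y i) (y j) with h | h | h
    · simp [h, hlt, hlt.not_gt, h.not_gt]
    · simp [h]
    · simp [h, hlt, hlt.not_gt, h.not_gt]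
  · rintro ⟨a, b⟩ _ hab
    simp only [Finset.mem_insert, Finset.mem_singleton, not_or] at hab
    rw [sub_eq_zero]
    simp only [ord a b hab.1 hab.2]

theorem qPerm_swap (q : ℂ) (N : ℕ) {m : ℕ} (i j : Fin m) (hij : (j : ℕ) = i + 1) :
    qPerm q N (Equiv.swap i j) = atPair i j (qSwap q N) := by
  have hne : i ≠ j := by
    intro h
    rw [h] at hij
    omega
  ext x y
  simp only [qPerm, atPair, Matrix.of_apply, qSwap_apply]
  have hinv : y ∘ ((Equiv.swap i j)⁻¹ : Equiv.Perm (Fin m)) = y ∘ Equiv.swap i j := by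
    rw [Equiv.swap_inv]
  by_cases hx' : x = y ∘ ((Equiv.swap i j)⁻¹ : Equiv.Perm (Fin m))
  · have hx : x = y ∘ Equiv.swap i j := hx'.trans hinv
    have h1 : ∀ c, c ≠ i → c ≠ j → x c = y c := by
      intro c hi hj
      rw [hx, Function.comp_apply, Equiv.swap_apply_of_ne_of_ne hi hj]
    have h2 : x i = y j := by simp [hx]
    have h3 : x j = y i := by simp [hx]
    rw [if_pos hx', if_pos h1, if_pos ⟨h2, h3⟩, h2, h3]
    have := invNum_comp_swap y i j hij
    rw [hx, this]
    rcases lt_trichotomy (y i) (y j) with h | h | h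
    · simp [h, h.ne']
    · simp [h]
    · simp [h, h.not_gt, h.ne]
  · have hx : ¬ x = y ∘ Equiv.swap i j := fun h => hx' (h.trans hinv.symm)
    rw [if_neg hx']
    by_cases h1 : ∀ c, c ≠ i → c ≠ j → x c = y c
    · rw [if_pos h1, if_neg]
      rintro ⟨h2, h3⟩
      apply hx
      ext1 c
      rw [Function.comp_apply]
      by_cases hi : c = i
      · rw [hi, Equiv.swap_apply_left, h2]
      · by_cases hj : c = j
        · rw [hj, Equiv.swap_apply_right, h3]
        · rw [Equiv.swap_apply_of_ne_of_ne hi hj, h1 c hi hj]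
    · rw [if_neg h1]

theorem qPerm_word {q : ℂ} (hq : q ≠ 0) (N : ℕ) {m : ℕ}
    (w : List {ij : Fin m × Fin m // (ij.2 : ℕ) = ij.1 + 1}) :
    qPerm q N (w.map fun s => Equiv.swap s.1.1 s.1.2).prod
      = (w.map fun s => atPair s.1.1 s.1.2 (qSwap q N)).prod := by
  induction w with
  | nil => simpa using qPerm_one q N m
  | cons s w ih =>
    rw [List.map_cons, List.prod_cons, qPerm_mul hq, ih, qPerm_swap q N s.1.1 s.1.2 s.2,
      List.map_cons, List.prod_cons]

/-- The `q`-antisymmetrizer `A_m^q = (1/m!) ∑_σ sgn(σ) P_σ^q`. -/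
def qAntisymmetrizer (q : ℂ) (N m : ℕ) : Matrix (Fin m → Fin N) (Fin m → Fin N) ℂ :=
  ((m.factorial : ℂ)⁻¹) •
    ∑ σ : Equiv.Perm (Fin m), ((Equiv.Perm.sign σ : ℤ) : ℂ) • qPerm q N σ

/-! ### Sklyanin minors -/

section Minors

variable {A : Type*} [Ring A] [Algebra ℂ A]

/-- A complex series in `u⁻¹` as a series over the `ℂ`-algebra `A`. -/
def scalarSeries (A : Type*) [Ring A] [Algebra ℂ A] : PowerSeries ℂ →+* PowerSeries A :=
  PowerSeries.map (algebraMap ℂ A)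

/-- `f(u) ↦ f(c u)` for a series `f` in `u⁻¹`. -/
def rescaleArg (c : ℂ) (f : PowerSeries A) : PowerSeries A :=
  PowerSeries.mk fun r => (c⁻¹) ^ r • PowerSeries.coeff r f

/-- `R̄ᵗ(x)`, the partial transpose of `R̄(x) = R(x, 1) / (x - 1)`, for a series `x` in `u⁻¹`
without constant term. -/
def RBarT (q : ℂ) (N : ℕ) (x : PowerSeries ℂ) :
    Matrix (Fin N × Fin N) (Fin N × Fin N) (PowerSeries ℂ) :=
  transpose₁ ((x - 1)⁻¹ • RMat q N x 1)

/-- The product `⟨S₁, …, S_m⟩` at `u_a = u q^{-2a+2}` (zero-based: `u_a = u q^{-2a}`):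
the factors are `S_a(u_a) R̄ᵗ_{a,a+1} ⋯ R̄ᵗ_{a,m}` for `a = 1, …, m`, in this order, with
`R̄ᵗ_{ab} = R̄ᵗ_{ab}(u_a⁻¹ u_b⁻¹)`. -/
def angleProd (q : ℂ) {N : ℕ} (m : ℕ) (S : Matrix (Fin N) (Fin N) (PowerSeries A)) :
    Matrix (Fin m → Fin N) (Fin m → Fin N) (PowerSeries A) :=
  ((List.finRange m).map fun a =>
    atSite a (S.map (rescaleArg (q ^ (-2 * ((a : ℕ) : ℤ))))) *
      (((List.finRange m).filter fun b => a < b).map fun b =>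
        (atPair a b (RBarT q N
          ((q ^ (2 * (a : ℕ) + 2 * (b : ℕ))) • (PowerSeries.X : PowerSeries ℂ) ^ 2))).map
            (scalarSeries A)).prod).prod

/-- The Sklyanin minor `s^{i₁ ⋯ i_m}_{j₁ ⋯ j_m}(u)`: the coefficients of
`A_m^q ⟨S₁, …, S_m⟩ = (1/m!) ∑ s^{i₁ ⋯ i_m}_{j₁ ⋯ j_m}(u) ⊗ E_{i₁j₁} ⊗ ⋯ ⊗ E_{i_m j_m}`. -/
def minor (q : ℂ) {N m : ℕ} (S : Matrix (Fin N) (Fin N) (PowerSeries A)) (i j : Fin m → Fin N) :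
    PowerSeries A :=
  (m.factorial : ℂ) •
    ((qAntisymmetrizer q N m).map (fun c => scalarSeries A (PowerSeries.C c)) *
      angleProd q m S) i j

/-- The Sklyanin determinant `sdet_q S(u) = s^{1 ⋯ N}_{1 ⋯ N}(u)`. -/
def sdet (q : ℂ) {N : ℕ} (S : Matrix (Fin N) (Fin N) (PowerSeries A)) : PowerSeries A :=
  minor q S (id : Fin N → Fin N) id

/-- The series `s♯_ij(u)`. Its coefficients are rational functions of `u`, written as power series
in `z = u⁻¹`: numerator and denominator are multiplied by `z`, so that
`(u⁻¹ - u) / (q u⁻¹ - q⁻¹ u) = (z² - 1) / (q z² - q⁻¹)`, and so on. -/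
def sSharp (q : ℂ) {N : ℕ} (S : Matrix (Fin N) (Fin N) (PowerSeries A)) (i j : Fin N) :
    PowerSeries A :=
  let z : PowerSeries ℂ := PowerSeries.X
  let den : PowerSeries ℂ := q • z ^ 2 - PowerSeries.C q⁻¹
  if i = j then S i i
  else if i < j then
    scalarSeries A ((z ^ 2 - 1) * den⁻¹) * S i j
      + scalarSeries A (((q - q⁻¹) • z ^ 2) * den⁻¹) * S j i
  else
    scalarSeries A ((z ^ 2 - 1) * den⁻¹) * S i j
      + scalarSeries A (PowerSeries.C (q - q⁻¹) * den⁻¹) * S j i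

end Minors

/-! ### The map `p ↦ p'` -/

/-- The map on ordered pairs of distinct elements of `ω₁ < ⋯ < ω_N` (`N ≥ 3`), in terms of the
three largest elements `ωN = ω_N`, `ωN1 = ω_{N-1}`, `ωN2 = ω_{N-2}`. -/
def pairMap {α : Type*} [DecidableEq α] (ωN ωN1 ωN2 : α) (a b : α) : α × α :=
  if (a = ωN1 ∧ b = ωN) ∨ (a = ωN ∧ b = ωN1) then (ωN1, ωN2)
  else if b = ωN then (ωN1, a)
  else if a = ωN then (b, ωN1)
  else (b, a)

/-- The image `(p₁', …, p_{N-1}', ω_N)` of a sequence `(p₁, …, p_N)` of distinct elements, where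
`ω₁ < ⋯ < ω_N` are its values in increasing order. The pair `(p₁', p_{N-1}')` is the image of
`(p₁, p_N)` under `pairMap`, and `(p₂', …, p_{N-2}')` is found in the same way from
`(p₂, …, p_{N-1})`, that is, after deleting `p₁` and `p_N`. For `N ≤ 2` the image is the
increasing sequence. -/
def primeSeq {α : Type*} [LinearOrder α] : (N : ℕ) → (Fin N → α) → (Fin N → α)
  | 0, p => p
  | 1, p => p
  | 2, p => ![min (p 0) (p 1), max (p 0) (p 1)]
  | m + 3, p =>
    let ω : Fin (m + 3) → α := p ∘ Tuple.sort p
    let ωN := ω (Fin.last (m + 2))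
    let ωN1 := ω ⟨m + 1, by omega⟩
    let ωN2 := ω ⟨m, by omega⟩
    let pr := pairMap ωN ωN1 ωN2 (p 0) (p (Fin.last (m + 2)))
    let inner : Fin (m + 1) → α := primeSeq (m + 1) fun k => p k.succ.castSucc
    Fin.cons pr.1
      (Fin.snoc (Fin.snoc (Fin.init inner : Fin m → α) pr.2 : Fin (m + 1) → α) ωN
        : Fin (m + 2) → α)

/-- The map `π_N`, `p ↦ p' = (p₁', …, p_N')` on permutations of `1, …, N`. -/
def primePerm {N : ℕ} (p : Equiv.Perm (Fin N)) : Fin N → Fin N := primeSeq N p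

end Sklyanin

end

/-! Everything is expressed through the contraction `psi M m t I c`: the row vector of the
`q`-antisymmetrizer with index set `I`, applied to `⟨M_t, …, M_{t+m-1}⟩` and read off in the columns
`c`. The Sklyanin determinant is the case of all rows and `c = id` (`sdet_eq_psi`). Write `P` for
`P^q`. Two mechanisms make contractions computable.

Rows. The parameters of `R̄ᵗ_{12}, …, R̄ᵗ_{1m}` form a geometric progression of ratio `q²`. This
product therefore preserves the span of the antisymmetric row vectors in the factors `2, …, m`: its
`(k, l)` entry in the first factor replaces `k` by `l` in the index set, up to an explicit scalar
(`sum_antisymRow_mul_mono`). So the first matrix can be peeled off. If the first column `l` lies in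
`I`, the diagonal entries produce `M j l`, the off-diagonal ones produce `M l j`, both multiply the
contraction with rows `I \ {j}`, and together they are the entry `s♯_{jl}` (`psi_cons_of_mem`). At
the other end the last matrix factors out on the right (`psi_snoc`). What remains has the identity
in the last place, and it loses its last tensor factor whenever the last column differs from all the
others, because `R̄ᵗ - 1` lives on the vectors `e_i ⊗ e_i` (`psi_snoc_of_notMem`).

Columns. At `v = q⁻² u` the matrix `R(u, v)` degenerates to a multiple of `1 - P`, and the
reflection equation becomes a fusion relation `(1 - P) S₁ R̄ᵗ₁₂ S₂ = X (1 - P)`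
(`fusion_of_reflection`). Combined with the exchange relation `mono₂_exchange`, it makes
contractions `q`-antisymmetric in the columns (`isColumnAntisym_psi`), so columns may be reordered
at the cost of a power of `-q`.

The recursion (`psi_eq_sum`) treats rows `I` with maximum `w`, columns `I \ {w}` in any order, and
an arbitrary last column `c`. Splitting off the last matrix gives a sum over `k` with the factor `M
k c`. Put `l = k` if `k ≠ w`, and let `l` be the largest element of `I \ {w}` if `k = w`. Move the
column `l` to the front; no other remaining column equals `k`, so the last factor splits off, and
expansion along the first row gives `s♯_{jl}`. There remain the rows `I \ {j, k}` and the columns `I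
\ {w, l}`. If `w'` is the maximum of these rows, the columns are `I \ {j, k, w'}` together with one
more element `e`; moving `e` to the end restores the initial situation with two rows fewer and `e`
in the role of `c`. The pair `(l, e)` is the image of `(j, k)` in the definition of `p ↦ p'`
(`pairMap_spec`), and the collected powers of `-q` give the exponent `l(p') - l(p)`. -/

noncomputable section
namespace Sklyanin

/-! ### Spectral parameters and weights -/

/-- A sequence of spectral parameters `y_n` with `y_{n+1} = q² y_n`, in a commutative ring in which
`q` and all `y_n - 1` are invertible. -/
structure SpectralData (K : Type*) [CommRing K] where
  Q : K
  Qi : K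
  y : ℕ → K
  d : ℕ → K
  hQ : Q * Qi = 1
  hy : ∀ n, y (n + 1) = Q ^ 2 * y n
  hd : ∀ n, d n * (y n - 1) = 1

/-! ### Inversions of sequences that enumerate a finite set -/

section Combinatorics

variable {ι : Type*} [LinearOrder ι]

/-- The number of elements of `I` below `j`. -/
def below (I : Finset ι) (j : ι) : ℕ := (I.filter fun i => i < j).card

/-- The number of elements of `I` above `j`. -/
def above (I : Finset ι) (j : ι) : ℕ := (I.filter fun i => j < i).card

theorem below_insert {I : Finset ι} {a : ι} (ha : a ∉ I) (j : ι) :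
    below (insert a I) j = below I j + if a < j then 1 else 0 := by
  unfold below
  rw [Finset.filter_insert]
  split_ifs with h
  · rw [Finset.card_insert_of_notMem (by simp [ha])]
  · rfl

theorem below_erase_self (I : Finset ι) (j : ι) : below (I.erase j) j = below I j := by
  unfold below
  congr 1
  ext i
  simp only [Finset.mem_filter, Finset.mem_erase]
  constructor
  · rintro ⟨⟨_, h⟩, h'⟩
    exact ⟨h, h'⟩
  · rintro ⟨h, h'⟩
    exact ⟨⟨h'.ne, h⟩, h'⟩

theorem invNum_eq_sum {m : ℕ} (p : Fin m → ι) :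
    invNum p = ∑ a, ∑ b, if a < b ∧ p b < p a then 1 else 0 := by
  rw [invNum, Finset.card_filter, Fintype.sum_prod_type]

theorem invNum_cons {m : ℕ} (a : ι) (p : Fin m → ι) :
    invNum (Fin.cons a p : Fin (m + 1) → ι)
      = (Finset.univ.filter fun i => p i < a).card + invNum p := by
  rw [invNum_eq_sum, invNum_eq_sum, Fin.sum_univ_succ, Finset.card_filter]
  simp only [Fin.sum_univ_succ, Fin.cons_zero, Fin.cons_succ, Fin.succ_lt_succ_iff,
    Fin.not_lt_zero, Fin.succ_pos, false_and, true_and, if_false, zero_add]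

theorem invNum_snoc {m : ℕ} (p : Fin m → ι) (a : ι) :
    invNum (Fin.snoc p a : Fin (m + 1) → ι)
      = invNum p + (Finset.univ.filter fun i => a < p i).card := by
  rw [invNum_eq_sum, invNum_eq_sum, Fin.sum_univ_castSucc, Finset.card_filter]
  simp only [Fin.sum_univ_castSucc, Fin.snoc_castSucc, Fin.snoc_last, Fin.castSucc_lt_castSucc_iff,
    Fin.castSucc_lt_last, (Fin.castSucc_lt_last _).not_gt, lt_irrefl, false_and, true_and, if_false,
    add_zero, Finset.sum_add_distrib, Finset.sum_const_zero]

theorem card_filter_comp {m : ℕ} {p : Fin m → ι} (hp : Function.Injective p) {I : Finset ι}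
    (hI : Finset.univ.image p = I) (P : ι → Prop) [DecidablePred P] :
    (Finset.univ.filter fun i => P (p i)).card = (I.filter P).card := by
  rw [← hI, Finset.filter_image, Finset.card_image_of_injective _ hp]

theorem image_cons_univ {m : ℕ} (a : ι) (p : Fin m → ι) :
    Finset.univ.image (Fin.cons a p : Fin (m + 1) → ι) = insert a (Finset.univ.image p) := by
  ext i
  simp [Fin.exists_fin_succ, eq_comm]

theorem image_snoc_univ {m : ℕ} (p : Fin m → ι) (a : ι) :
    Finset.univ.image (Fin.snoc p a : Fin (m + 1) → ι) = insert a (Finset.univ.image p) := by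
  ext i
  simp [Fin.exists_fin_succ', eq_comm, or_comm]

/-- The recursive form of "the sequence enumerates `I`". It drives the recursions for `antisymRow`
and `primeSeq`, together with its mirror image `inj_image_snoc_iff`. -/
theorem inj_image_cons_iff {m : ℕ} {a : ι} {p : Fin m → ι} {I : Finset ι} :
    (Function.Injective (Fin.cons a p : Fin (m + 1) → ι)
      ∧ Finset.univ.image (Fin.cons a p : Fin (m + 1) → ι) = I)
    ↔ a ∈ I ∧ Function.Injective p ∧ Finset.univ.image p = I.erase a := by
  rw [image_cons_univ, Fin.cons_injective_iff]
  constructor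
  · rintro ⟨⟨h1, h2⟩, rfl⟩
    refine ⟨Finset.mem_insert_self _ _, h2, ?_⟩
    rw [Finset.erase_insert]
    simpa using h1
  · rintro ⟨h1, h2, h3⟩
    rw [h3]
    refine ⟨⟨?_, h2⟩, Finset.insert_erase h1⟩
    have : a ∉ Finset.univ.image p := by simp [h3]
    simpa using this

theorem inj_image_snoc_iff {m : ℕ} {a : ι} {p : Fin m → ι} {I : Finset ι} :
    (Function.Injective (Fin.snoc p a : Fin (m + 1) → ι)
      ∧ Finset.univ.image (Fin.snoc p a : Fin (m + 1) → ι) = I)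
    ↔ a ∈ I ∧ Function.Injective p ∧ Finset.univ.image p = I.erase a := by
  rw [image_snoc_univ, Fin.snoc_injective_iff]
  constructor
  · rintro ⟨⟨h1, h2⟩, rfl⟩
    refine ⟨Finset.mem_insert_self _ _, h1, ?_⟩
    rw [Finset.erase_insert]
    simpa using h2
  · rintro ⟨h1, h2, h3⟩
    rw [h3]
    refine ⟨⟨h2, ?_⟩, Finset.insert_erase h1⟩
    have : a ∉ Finset.univ.image p := by simp [h3]
    simpa using this

end Combinatorics

theorem sum_cons_fun {ι β : Type*} [Fintype ι] [AddCommMonoid β] {m : ℕ}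
    (f : (Fin (m + 1) → ι) → β) :
    ∑ r, f r = ∑ a : ι, ∑ r : Fin m → ι, f (Fin.cons a r) := by
  rw [← (Fin.consEquiv fun _ : Fin (m + 1) => ι).sum_comp, Fintype.sum_prod_type]
  rfl

theorem sum_snoc_fun {ι β : Type*} [Fintype ι] [AddCommMonoid β] {m : ℕ}
    (f : (Fin (m + 1) → ι) → β) :
    ∑ r, f r = ∑ a : ι, ∑ r : Fin m → ι, f (Fin.snoc r a) := by
  rw [← (Fin.snocEquiv fun _ : Fin (m + 1) => ι).sum_comp, Fintype.sum_prod_type]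
  rfl

namespace SpectralData

variable {K : Type*} [CommRing K] (D : SpectralData K)
variable {ι : Type*} [LinearOrder ι]

/-- The weight `(-q)^{-#{i ∈ I, i < j}}`. -/
def wt (I : Finset ι) (j : ι) : K := (-D.Qi) ^ below I j

/-- The inverse of `wt`. -/
def wtInv (I : Finset ι) (j : ι) : K := (-D.Q) ^ below I j

theorem neg_mul_neg_pow (n : ℕ) : (-D.Q) ^ n * (-D.Qi) ^ n = 1 := by
  rw [← mul_pow, neg_mul_neg, D.hQ, one_pow]

theorem wtInv_mul_wt (I : Finset ι) (j : ι) : D.wtInv I j * D.wt I j = 1 :=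
  D.neg_mul_neg_pow _

/-- The row vector of the `q`-antisymmetrizer for the index set `I`. -/
def antisymRow {m : ℕ} (I : Finset ι) (r : Fin m → ι) : K :=
  open Classical in
  if Function.Injective r ∧ Finset.univ.image r = I then (-D.Qi) ^ invNum r else 0

/-- The leading entry `a` forms inversions with exactly the elements of `I` below it, which is the
exponent in `wt`. -/
theorem antisymRow_cons {m : ℕ} (I : Finset ι) (a : ι) (r : Fin m → ι) :
    D.antisymRow I (Fin.cons a r : Fin (m + 1) → ι)
      = if a ∈ I then D.wt I a * D.antisymRow (I.erase a) r else 0 := by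
  unfold antisymRow
  simp only [inj_image_cons_iff]
  by_cases h1 : a ∈ I
  · by_cases h2 : Function.Injective r ∧ Finset.univ.image r = I.erase a
    · rw [if_pos ⟨h1, h2⟩, if_pos h1, if_pos h2, invNum_cons,
        card_filter_comp h2.1 h2.2 (fun i => i < a), pow_add, wt, ← below_erase_self, below]
    · rw [if_neg (fun h => h2 h.2), if_pos h1, if_neg h2, mul_zero]
  · rw [if_neg (fun h => h1 h.1), if_neg h1]

theorem antisymRow_snoc {m : ℕ} (I : Finset ι) (a : ι) (r : Fin m → ι) :
    D.antisymRow I (Fin.snoc r a : Fin (m + 1) → ι)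
      = if a ∈ I then (-D.Qi) ^ above (I.erase a) a * D.antisymRow (I.erase a) r else 0 := by
  unfold antisymRow
  simp only [inj_image_snoc_iff]
  by_cases h1 : a ∈ I
  · by_cases h2 : Function.Injective r ∧ Finset.univ.image r = I.erase a
    · rw [if_pos ⟨h1, h2⟩, if_pos h1, if_pos h2, invNum_snoc,
        card_filter_comp h2.1 h2.2 (fun i => a < i), add_comm, pow_add, above]
    · rw [if_neg (fun h => h2 h.2), if_pos h1, if_neg h2, mul_zero]
  · rw [if_neg (fun h => h1 h.1), if_neg h1]

/-! ### Monodromy of the transposed R-matrix -/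

/-- The entries of `R̄ᵗ - 1` on the span of the vectors `e_i ⊗ e_i`. -/
def gam (n : ℕ) (i j : ι) : K :=
  if i = j then D.d n * (D.Qi * D.y n - D.Q) - 1
  else if i < j then D.d n * ((D.Qi - D.Q) * D.y n) else D.d n * (D.Qi - D.Q)

/-- The matrix `(R̄ᵗ)_{ij}` in the first tensor factor, for fixed indices in the second one. -/
def locR (n : ℕ) (i j : ι) : Matrix ι ι K :=
  Matrix.of fun k l => (if i = j ∧ k = l then 1 else 0) + if k = i ∧ l = j then D.gam n i j else 0

theorem wt_insert {I : Finset ι} {a : ι} (ha : a ∉ I) (j : ι) :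
    D.wt (insert a I) j = D.wt I j * if a < j then -D.Qi else 1 := by
  rw [wt, wt, below_insert ha, pow_add]
  split_ifs <;> simp

theorem wtInv_insert {I : Finset ι} {a : ι} (ha : a ∉ I) (j : ι) :
    D.wtInv (insert a I) j = D.wtInv I j * if a < j then -D.Q else 1 := by
  rw [wtInv, wtInv, below_insert ha, pow_add]
  split_ifs <;> simp

variable [Fintype ι]

/-- The product of the R-matrices `R̄ᵗ_{01} ⋯ R̄ᵗ_{0m}` as a matrix in the factor `0`, for fixed
indices in the factors `1, …, m`. -/
def mono : (m : ℕ) → ℕ → (Fin m → ι) → (Fin m → ι) → Matrix ι ι K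
  | 0, _, _, _ => 1
  | m + 1, n, r, r' => D.locR n (r 0) (r' 0) * mono m (n + 1) (Fin.tail r) (Fin.tail r')

/-- The scalar by which the monodromy acts on `antisymRow`. -/
def coef (n : ℕ) (I : Finset ι) (k l : ι) : K :=
  if k = l then (if k ∈ I then D.gam n k k + 1 else 1)
  else if k ∈ I ∧ l ∉ I then D.gam n k l * D.wt (I.erase k) k * D.wtInv (I.erase k) l else 0

/-- The index set to which the monodromy sends `I`. -/
def target (I : Finset ι) (k l : ι) : Finset ι := if k = l then I else insert l (I.erase k)

theorem locR_mul_apply (n : ℕ) (i j : ι) (A : Matrix ι ι K) (k l : ι) :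
    (D.locR n i j * A) k l
      = (if i = j then A k l else 0) + if k = i then D.gam n i j * A j l else 0 := by
  rw [Matrix.mul_apply]
  simp only [locR, Matrix.of_apply, add_mul, Finset.sum_add_distrib, ite_mul, one_mul, zero_mul]
  congr 1
  · by_cases h : i = j <;> simp [h]
  · by_cases h : k = i <;> simp [h]

/-- The two summands come from the two parts of `locR` at the first site: the identity part forces
`r 0 = j`, while the part on the vectors `e_i ⊗ e_i` forces `r 0 = k` and passes `j` on as the
auxiliary row index. -/
theorem sum_antisymRow_succ {m : ℕ} (n : ℕ) (I : Finset ι) (k l j : ι) (r' : Fin m → ι) :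
    ∑ r : Fin (m + 1) → ι, D.antisymRow I r * D.mono (m + 1) n r (Fin.cons j r') k l
      = (if j ∈ I then D.wt I j * ∑ r, D.antisymRow (I.erase j) r * D.mono m (n + 1) r r' k l
          else 0)
        + if k ∈ I then D.wt I k * D.gam n k j *
            ∑ r, D.antisymRow (I.erase k) r * D.mono m (n + 1) r r' j l else 0 := by
  rw [sum_cons_fun]
  simp only [mono, Fin.cons_zero, Fin.tail_cons, antisymRow_cons, locR_mul_apply, mul_add,
    Finset.sum_add_distrib]
  congr 1
  · rw [Finset.sum_eq_single j]
    · by_cases h : j ∈ I <;> simp [h, Finset.mul_sum, mul_assoc]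
    · intro a _ ha
      simp [ha]
    · simp
  · rw [Finset.sum_eq_single k]
    · by_cases h : k ∈ I <;> simp [h, Finset.mul_sum, mul_assoc, mul_left_comm]
    · intro a _ ha
      simp [ha.symm]
    · simp

end SpectralData

/-! ### One-site relations between entries of `R̄ᵗ` at consecutive parameters -/

namespace SpectralData

variable {K : Type*} [CommRing K] (D : SpectralData K)
variable {ι : Type*} [LinearOrder ι]

/-- This relation and the next two are what `coef_step` asks for once the common weights are
removed; all three rest on `y (n + 1) = Q² y n`. Here a diagonal entry acts on a set containing both
`k` and `j`. -/
theorem gam_relation_diag (n : ℕ) {k j : ι} (h : k ≠ j) :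
    (if k < j then -D.Qi else 1) * (D.gam (n + 1) k k + 1)
      + (if j < k then -D.Qi else 1) * (D.gam n k j * D.gam (n + 1) j k)
      = (D.gam n k k + 1) * if k < j then -D.Qi else 1 := by
  have h1 := D.hQ
  have h2 := D.hy n
  have h3 := D.hd n
  have h4 := D.hd (n + 1)
  simp only [gam, h, h.symm, if_true, if_false]
  rcases lt_or_gt_of_ne h with h | h
  · simp only [h, h.not_gt, if_true, if_false]
    grind
  · simp only [h, h.not_gt, if_true, if_false]
    grind

/-- The two ways of creating an index `l` that is already present cancel, as antisymmetry of the row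
vector demands. -/
theorem gam_relation_cancel (n : ℕ) {k l : ι} (h : k ≠ l) :
    (if k < l then -D.Qi else 1) * D.gam (n + 1) k l
      + (if l < k then -D.Qi else 1) * (D.gam n k l * (D.gam (n + 1) l l + 1)) = 0 := by
  have h1 := D.hQ
  have h2 := D.hy n
  have h3 := D.hd n
  have h4 := D.hd (n + 1)
  simp only [gam, h, if_true, if_false]
  rcases lt_or_gt_of_ne h with h | h
  · simp only [h, h.not_gt, if_true, if_false]
    grind
  · simp only [h, h.not_gt, if_true, if_false]
    grind

/-- The replacement of `k` by `l` seen past a third index `j`; the factors on the right record how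
`j` enters the weights of `coef` and of the target set. -/
theorem gam_relation_distinct (n : ℕ) {k j l : ι} (hkj : k ≠ j) (hjl : j ≠ l) (hkl : k ≠ l) :
    (if k < j then -D.Qi else 1) * D.gam (n + 1) k l
      + (if j < k then -D.Qi else 1) * (D.gam n k j * D.gam (n + 1) j l)
      = D.gam n k l * (if j < k then -D.Qi else 1) * (if l < j then -D.Qi else 1)
        * (if j < l then -D.Q else 1) := by
  have h1 := D.hQ
  have h2 := D.hy n
  have h3 := D.hd n
  have h4 := D.hd (n + 1)
  simp only [gam, hkj, hjl, hkl, if_false]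
  rcases lt_or_gt_of_ne hkj with a | a <;> rcases lt_or_gt_of_ne hjl with b | b <;>
    rcases lt_or_gt_of_ne hkl with c | c <;>
    simp only [a, b, c, a.not_gt, b.not_gt, c.not_gt, if_true, if_false]
  · grind
  · exact absurd (a.trans b) c.not_gt
  · grind
  · grind
  · grind
  · grind
  · exact absurd (b.trans a) c.not_gt
  · grind

end SpectralData

/-! ### Action of the monodromy on antisymmetric row vectors -/

namespace SpectralData

variable {K : Type*} [CommRing K] (D : SpectralData K)
variable {ι : Type*} [LinearOrder ι]

theorem antisymRow_zero (I : Finset ι) (r : Fin 0 → ι) :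
    D.antisymRow I r = if I = ∅ then 1 else 0 := by
  have h : invNum r = 0 := by simp [invNum]
  simp [antisymRow, Function.injective_of_subsingleton, h, eq_comm]

theorem wt_erase_self (I : Finset ι) (j : ι) : D.wt (I.erase j) j = D.wt I j := by
  rw [wt, wt, below_erase_self]

theorem wt_erase {I : Finset ι} {a : ι} (ha : a ∈ I) (j : ι) :
    D.wt I j = D.wt (I.erase a) j * if a < j then -D.Qi else 1 := by
  rw [← D.wt_insert (Finset.notMem_erase a I), Finset.insert_erase ha]

theorem wtInv_erase {I : Finset ι} {a : ι} (ha : a ∈ I) (j : ι) :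
    D.wtInv I j = D.wtInv (I.erase a) j * if a < j then -D.Q else 1 := by
  rw [← D.wtInv_insert (Finset.notMem_erase a I), Finset.insert_erase ha]

theorem coef_self_mem (n : ℕ) {I : Finset ι} {k : ι} (h : k ∈ I) :
    D.coef n I k k = D.gam n k k + 1 := by
  simp [coef, h]

theorem coef_self_notMem (n : ℕ) {I : Finset ι} {k : ι} (h : k ∉ I) : D.coef n I k k = 1 := by
  simp [coef, h]

theorem coef_of_mem_notMem (n : ℕ) {I : Finset ι} {k l : ι} (hk : k ∈ I) (hl : l ∉ I) :
    D.coef n I k l = D.gam n k l * D.wt (I.erase k) k * D.wtInv (I.erase k) l := by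
  have : k ≠ l := fun h => hl (h ▸ hk)
  simp [coef, hk, hl, this]

theorem coef_eq_zero_of_notMem (n : ℕ) {I : Finset ι} {k l : ι} (hkl : k ≠ l) (hk : k ∉ I) :
    D.coef n I k l = 0 := by
  simp [coef, hk, hkl]

theorem coef_eq_zero_of_mem (n : ℕ) {I : Finset ι} {k l : ι} (hkl : k ≠ l) (hl : l ∈ I) :
    D.coef n I k l = 0 := by
  simp [coef, hl, hkl]

theorem target_self (I : Finset ι) (k : ι) : target I k k = I := by simp [target]

theorem target_of_ne (I : Finset ι) {k l : ι} (h : k ≠ l) :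
    target I k l = insert l (I.erase k) := by simp [target, h]

/-- One step of the recursion for the action of the monodromy on the row vectors. -/
theorem coef_step (n : ℕ) (I : Finset ι) (k l j : ι) (X : Finset ι → K) :
    (if j ∈ I then D.wt I j * (D.coef (n + 1) (I.erase j) k l * X (target (I.erase j) k l)) else 0)
        + (if k ∈ I then D.wt I k * D.gam n k j *
            (D.coef (n + 1) (I.erase k) j l * X (target (I.erase k) j l)) else 0)
      = D.coef n I k l * if j ∈ target I k l then
          D.wt (target I k l) j * X ((target I k l).erase j) else 0 := by
  by_cases hk : k ∈ I
  swap
  · have hk' : k ∉ I.erase j := fun h => hk (Finset.mem_of_mem_erase h)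
    rw [if_neg hk, add_zero]
    by_cases hkl : k = l
    · subst hkl
      simp only [D.coef_self_notMem _ hk, D.coef_self_notMem _ hk', target_self, one_mul]
    · simp [D.coef_eq_zero_of_notMem _ hkl hk, D.coef_eq_zero_of_notMem _ hkl hk']
  rw [if_pos hk]
  have hkk : k ∉ I.erase k := Finset.notMem_erase k I
  have hjj : j ∉ I.erase j := Finset.notMem_erase j I
  by_cases hjk : j = k
  · subst hjk
    rw [if_pos hk]
    by_cases hjl : j = l
    · subst hjl
      simp only [D.coef_self_notMem _ hjj, D.coef_self_mem _ hk, target_self, if_pos hk]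
      ring
    · simp [D.coef_eq_zero_of_notMem _ hjl hjj, target_of_ne _ hjl, hjl]
  have hkj : k ≠ j := Ne.symm hjk
  have hkIj : k ∈ I.erase j := Finset.mem_erase.2 ⟨hkj, hk⟩
  by_cases hkl : k = l
  · subst hkl
    rw [D.coef_self_mem _ hk, target_self I]
    by_cases hj : j ∈ I
    · have hjIk : j ∈ I.erase k := Finset.mem_erase.2 ⟨hjk, hj⟩
      simp only [if_pos hj, D.coef_self_mem _ hkIj, D.coef_of_mem_notMem _ hjIk hkk, target_self,
        target_of_ne _ hjk]
      have e1 : insert k ((I.erase k).erase j) = I.erase j := by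
        rw [Finset.erase_right_comm, Finset.insert_erase hkIj]
      have e2 : D.wt I k = D.wt ((I.erase k).erase j) k * if j < k then -D.Qi else 1 := by
        rw [← D.wt_erase_self I k, D.wt_erase hjIk]
      have e3 : D.wt I j = D.wt ((I.erase k).erase j) j * if k < j then -D.Qi else 1 := by
        rw [D.wt_erase hk, D.wt_erase_self]
      rw [e1, e2, e3]
      have h1 := D.gam_relation_diag n hkj
      have h2 := D.wtInv_mul_wt ((I.erase k).erase j) k
      -- All weights are now taken relative to the set without `k` and `j`; `h2` cancels the weight
      -- of `k` against the inverse weight contained in `coef`.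
      linear_combination (D.wt ((I.erase k).erase j) j * X (I.erase j)) * h1
        + ((if j < k then -D.Qi else 1) * D.gam n k j * D.gam (n + 1) j k *
          D.wt ((I.erase k).erase j) j * X (I.erase j)) * h2
    · have hjIk : j ∉ I.erase k := fun h => hj (Finset.mem_of_mem_erase h)
      simp [hj, D.coef_eq_zero_of_notMem _ hjk hjIk]
  by_cases hl : l ∈ I
  -- The target would contain `l` twice, so the total must vanish. Only for `j = l` is this a
  -- genuine cancellation of two terms.
  · rw [D.coef_eq_zero_of_mem _ hkl hl, zero_mul]
    have hlIk : l ∈ I.erase k := Finset.mem_erase.2 ⟨Ne.symm hkl, hl⟩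
    by_cases hjl : j = l
    · subst hjl
      simp only [if_pos hl, D.coef_self_mem _ hlIk, target_self, D.coef_of_mem_notMem _ hkIj hjj,
        target_of_ne _ hkj]
      have e1 : insert j ((I.erase j).erase k) = I.erase k := by
        rw [Finset.erase_right_comm, Finset.insert_erase hlIk]
      have e2 : D.wt I k = D.wt ((I.erase j).erase k) k * if j < k then -D.Qi else 1 := by
        rw [D.wt_erase_self, D.wt_erase hl]
      have e3 : D.wt I j = D.wt ((I.erase j).erase k) j * if k < j then -D.Qi else 1 := by
        rw [← D.wt_erase_self I j, D.wt_erase hkIj]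
      rw [e1, e2, e3]
      have h1 := D.gam_relation_cancel n hkj
      have h2 := D.wtInv_mul_wt ((I.erase j).erase k) j
      linear_combination (D.wt ((I.erase j).erase k) k * X (I.erase k)) * h1
        + ((if k < j then -D.Qi else 1) * D.gam (n + 1) k j *
          D.wt ((I.erase j).erase k) k * X (I.erase k)) * h2
    · have hlIj : l ∈ I.erase j := Finset.mem_erase.2 ⟨Ne.symm hjl, hl⟩
      simp [D.coef_eq_zero_of_mem _ hkl hlIj, D.coef_eq_zero_of_mem _ hjl hlIk]
  have hlIj : l ∉ I.erase j := fun h => hl (Finset.mem_of_mem_erase h)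
  have hlIk : l ∉ I.erase k := fun h => hl (Finset.mem_of_mem_erase h)
  rw [D.coef_of_mem_notMem _ hk hl, target_of_ne I hkl]
  by_cases hjl : j = l
  · subst hjl
    simp only [hl, if_false, D.coef_self_notMem _ hlIk, target_self, Finset.mem_insert_self, if_true,
      Finset.erase_insert hlIk]
    have e2 : D.wt (insert j (I.erase k)) j = D.wt (I.erase k) j := by
      rw [D.wt_insert hlIk, if_neg (lt_irrefl _), mul_one]
    rw [e2, ← D.wt_erase_self I k]
    have h2 := D.wtInv_mul_wt (I.erase k) j
    linear_combination (-D.gam n k j * D.wt (I.erase k) k * X (I.erase k)) * h2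
  by_cases hj : j ∈ I
  · have hjIk : j ∈ I.erase k := Finset.mem_erase.2 ⟨hjk, hj⟩
    have hjt : j ∈ insert l (I.erase k) := Finset.mem_insert_of_mem hjIk
    simp only [if_pos hj, if_pos hjt, D.coef_of_mem_notMem _ hkIj hlIj,
      D.coef_of_mem_notMem _ hjIk hlIk, target_of_ne _ hkl, target_of_ne _ hjl]
    have hlJ : l ∉ (I.erase k).erase j := fun h => hlIk (Finset.mem_of_mem_erase h)
    have e1 : (insert l (I.erase k)).erase j = insert l ((I.erase k).erase j) := by
      rw [Finset.erase_insert_of_ne (Ne.symm hjl)]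
    have e2 : D.wt I k = D.wt ((I.erase k).erase j) k * if j < k then -D.Qi else 1 := by
      rw [← D.wt_erase_self I k, D.wt_erase hjIk]
    have e3 : D.wt I j = D.wt ((I.erase k).erase j) j * if k < j then -D.Qi else 1 := by
      rw [D.wt_erase hk, ← D.wt_erase_self (I.erase k)]
    have e4 : D.wt (insert l (I.erase k)) j
        = D.wt ((I.erase k).erase j) j * if l < j then -D.Qi else 1 := by
      rw [D.wt_insert hlIk, ← D.wt_erase_self (I.erase k)]
    have e5 : D.wt (I.erase k) k
        = D.wt ((I.erase k).erase j) k * if j < k then -D.Qi else 1 := D.wt_erase hjIk k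
    have e6 : D.wtInv (I.erase k) l
        = D.wtInv ((I.erase k).erase j) l * if j < l then -D.Q else 1 := D.wtInv_erase hjIk l
    rw [e1, e2, e3, e4, e5, e6, Finset.erase_right_comm (s := I) (a := j) (b := k)]
    have h1 := D.gam_relation_distinct n hkj hjl hkl
    linear_combination (D.wt ((I.erase k).erase j) j * D.wt ((I.erase k).erase j) k
      * D.wtInv ((I.erase k).erase j) l * X (insert l ((I.erase k).erase j))) * h1
  · have hjIk : j ∉ I.erase k := fun h => hj (Finset.mem_of_mem_erase h)
    simp [hj, hjl, D.coef_eq_zero_of_notMem _ hjl hjIk]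

variable [Fintype ι]

/-- The action of the monodromy on the row vector `antisymRow`. -/
theorem sum_antisymRow_mul_mono (m n : ℕ) (I : Finset ι) (k l : ι) (r' : Fin m → ι) :
    ∑ r, D.antisymRow I r * D.mono m n r r' k l
      = D.coef n I k l * D.antisymRow (target I k l) r' := by
  induction m generalizing n I k l with
  | zero =>
    simp only [Fintype.sum_unique, antisymRow_zero, mono]
    by_cases hkl : k = l
    · subst hkl
      rw [target_self, Matrix.one_apply_eq]
      by_cases hI : I = ∅
      · simp [hI, coef]
      · simp [hI]
    · simp [target_of_ne _ hkl, hkl]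
  | succ m ih =>
    rw [← Fin.cons_self_tail r', sum_antisymRow_succ]
    simp only [ih, antisymRow_cons]
    exact D.coef_step n I k l (r' 0) fun J => D.antisymRow J (Fin.tail r')

end SpectralData

namespace SpectralData

variable {K : Type*} [CommRing K] (D : SpectralData K)
variable {ι : Type*} [LinearOrder ι]

/-- Rewrites an off-diagonal contribution of the row `l` with the weight of the row `j`, so that it
can be merged with the diagonal contribution of the row `j`. The relative order of `j` and `l`
leaves the factor `-Qi` or `-Q` that appears in `sharp`. -/
theorem coef_erase_insert (n : ℕ) {I : Finset ι} {j l : ι} (hj : j ∈ I) (hl : l ∈ I) (h : j ≠ l) :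
    D.wt I l * D.coef n (I.erase l) j l
      = D.wt I j * (D.gam n j l * if j < l then -D.Qi else -D.Q) := by
  have hjl : j ∈ I.erase l := Finset.mem_erase.2 ⟨h, hj⟩
  have hlj : l ∈ I.erase j := Finset.mem_erase.2 ⟨h.symm, hl⟩
  rw [D.coef_of_mem_notMem _ hjl (Finset.notMem_erase l I)]
  have e1 : D.wt I l = D.wt ((I.erase l).erase j) l * if j < l then -D.Qi else 1 := by
    rw [← D.wt_erase_self I l, D.wt_erase hjl]
  have e2 : D.wt I j = D.wt ((I.erase l).erase j) j * if l < j then -D.Qi else 1 := by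
    rw [D.wt_erase_self, D.wt_erase hl]
  rw [e1, e2, D.wt_erase_self (I.erase l) j]
  have h2 := D.wtInv_mul_wt ((I.erase l).erase j) l
  have h3 := D.hQ
  rw [D.wt_erase_self (I.erase l) j] at *
  rcases lt_or_gt_of_ne h with h | h
  · simp only [h, h.not_gt, if_true, if_false]
    linear_combination (-D.Qi * D.gam n j l * D.wt (I.erase l) j) * h2
  · simp only [h, h.not_gt, if_true, if_false]
    linear_combination (D.gam n j l * D.wt (I.erase l) j) * h2
      - (D.gam n j l * D.wt (I.erase l) j) * h3

theorem gam_self (n : ℕ) (i j : ι) : D.gam n i i = D.gam n j j := by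
  simp [gam]

variable [Fintype ι]
variable {B : Type*} [Ring B] [Algebra K B]

/-! ### The products `⟨S_1, …, S_m⟩` in recursive form -/

/-- The entries of `⟨M_t, M_{t+1}, …, M_{t+m-1}⟩`. -/
def ang (M : ℕ → Matrix ι ι B) : (m : ℕ) → ℕ → (Fin m → ι) → (Fin m → ι) → B
  | 0, _, _, _ => 1
  | m + 1, t, r, c => ∑ r' : Fin m → ι, ∑ k, D.mono m (2 * t + 1) (Fin.tail r) r' k (c 0) •
      (M t (r 0) k * ang M m (t + 1) r' (Fin.tail c))

theorem ang_cons_cons (M : ℕ → Matrix ι ι B) (m t : ℕ) (a b : ι) (r c : Fin m → ι) :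
    D.ang M (m + 1) t (Fin.cons a r) (Fin.cons b c) =
      ∑ r' : Fin m → ι, ∑ k, D.mono m (2 * t + 1) r r' k b •
        (M t a k * D.ang M m (t + 1) r' c) := by
  simp only [ang, Fin.tail_cons, Fin.cons_zero]

/-- The contraction of `⟨M_t, …, M_{t+m-1}⟩` with the row vector `antisymRow`. -/
def psi (M : ℕ → Matrix ι ι B) (m t : ℕ) (I : Finset ι) (c : Fin m → ι) : B :=
  ∑ r, D.antisymRow I r • D.ang M m t r c

/-- The sum over the rows after the first meets only the monodromy, whose entries are scalars;
`sum_antisymRow_mul_mono` turns it into a contraction with one matrix fewer. -/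
theorem psi_cons (M : ℕ → Matrix ι ι B) (m t : ℕ) (I : Finset ι) (l : ι) (b : Fin m → ι) :
    D.psi M (m + 1) t I (Fin.cons l b) = ∑ j ∈ I, D.wt I j • ∑ k,
      D.coef (2 * t + 1) (I.erase j) k l •
        (M t j k * D.psi M m (t + 1) (target (I.erase j) k l) b) := by
  unfold psi
  rw [sum_cons_fun, ← Finset.sum_subset (Finset.subset_univ I)]
  · refine Finset.sum_congr rfl fun j hj => ?_
    simp only [ang_cons_cons, antisymRow_cons, if_pos hj, mul_smul, ← Finset.smul_sum]
    congr 1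
    simp only [Finset.mul_sum, mul_smul_comm, Finset.smul_sum, smul_smul]
    rw [Finset.sum_comm]
    simp only [← D.sum_antisymRow_mul_mono, Finset.sum_smul]
    conv_rhs => rw [Finset.sum_comm]
    refine Finset.sum_congr rfl fun r' _ => ?_
    rw [Finset.sum_comm]
  · intro j _ hj
    simp [antisymRow_cons, hj]

/-- The entries of the matrix `S♯`. -/
def sharp (n : ℕ) (M : Matrix ι ι B) (j l : ι) : B :=
  if j = l then M j j else (D.gam n j j + 1) • M j l
    + (D.gam n j l * if j < l then -D.Qi else -D.Q) • M l j

/-- Expansion along the first row, for a column index in the set of rows. -/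
theorem psi_cons_of_mem (M : ℕ → Matrix ι ι B) (m t : ℕ) {I : Finset ι} {l : ι} (hl : l ∈ I)
    (b : Fin m → ι) :
    D.psi M (m + 1) t I (Fin.cons l b)
      = ∑ j ∈ I, D.wt I j • (D.sharp (2 * t + 1) (M t) j l * D.psi M m (t + 1) (I.erase j) b) := by
  rw [psi_cons, ← Finset.add_sum_erase I _ hl, ← Finset.add_sum_erase I _ hl]
  -- Rows `j ≠ l`: the index `l` already lies in `I.erase j`, so only the diagonal entry `k = l` of
  -- the monodromy survives.
  have h1 : ∀ j ∈ I.erase l, D.wt I j • ∑ k, D.coef (2 * t + 1) (I.erase j) k l •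
        (M t j k * D.psi M m (t + 1) (target (I.erase j) k l) b)
      = D.wt I j • ((D.gam (2 * t + 1) j j + 1) • (M t j l * D.psi M m (t + 1) (I.erase j) b)) := by
    intro j hj
    have hlj : l ∈ I.erase j := Finset.mem_erase.2 ⟨(Finset.ne_of_mem_erase hj).symm, hl⟩
    rw [Finset.sum_eq_single l]
    · rw [target_self, D.coef_self_mem _ hlj, D.gam_self _ l j]
    · intro k _ hk
      rw [D.coef_eq_zero_of_mem _ hk hlj, zero_smul]
    · simp
  -- Row `l`: now `l` is free, every `k ∈ I` contributes, and inserting `l` in place of `k` leaves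
  -- `I.erase k`.
  have h2 : D.wt I l • ∑ k, D.coef (2 * t + 1) (I.erase l) k l •
        (M t l k * D.psi M m (t + 1) (target (I.erase l) k l) b)
      = D.wt I l • (M t l l * D.psi M m (t + 1) (I.erase l) b)
        + ∑ j ∈ I.erase l, D.wt I j • ((D.gam (2 * t + 1) j l * if j < l then -D.Qi else -D.Q) •
          (M t l j * D.psi M m (t + 1) (I.erase j) b)) := by
    rw [← Finset.add_sum_erase _ _ (Finset.mem_univ l), smul_add, target_self,
      D.coef_self_notMem _ (Finset.notMem_erase l I), one_smul]
    congr 1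
    rw [← Finset.sum_subset (Finset.erase_subset_erase l (Finset.subset_univ I)),
      Finset.smul_sum]
    · refine Finset.sum_congr rfl fun j hj => ?_
      have hne := Finset.ne_of_mem_erase hj
      have hjI := Finset.mem_of_mem_erase hj
      rw [smul_smul, D.coef_erase_insert _ hjI hl hne, smul_smul, target_of_ne _ hne,
        Finset.erase_right_comm,
        Finset.insert_erase (Finset.mem_erase.2 ⟨hne.symm, hl⟩)]
    · intro k hk hk'
      rw [D.coef_eq_zero_of_notMem _ (Finset.ne_of_mem_erase hk) hk', zero_smul]
  rw [Finset.sum_congr rfl h1, h2, add_assoc, ← Finset.sum_add_distrib]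
  congr 1
  · simp [sharp]
  · refine Finset.sum_congr rfl fun j hj => ?_
    rw [sharp, if_neg (Finset.ne_of_mem_erase hj), add_mul, smul_add, smul_mul_assoc,
      smul_mul_assoc, add_comm]

theorem ang_one (M : ℕ → Matrix ι ι B) (t : ℕ) (r c : Fin 1 → ι) :
    D.ang M 1 t r c = M t (r 0) (c 0) := by
  simp only [ang, mono, Fintype.sum_unique, mul_one]
  rw [Finset.sum_eq_single (c 0)]
  · rw [Matrix.one_apply_eq, one_smul]
  · intro k _ hk
    rw [Matrix.one_apply_ne hk, zero_smul]
  · simp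

/-- Splitting off the last matrix. -/
theorem ang_snoc {M M' : ℕ → Matrix ι ι B} (m t : ℕ) (hM : ∀ a < t + m, M' a = M a)
    (h1 : M' (t + m) = 1) (r : Fin (m + 1) → ι) (b : Fin m → ι) (c : ι) :
    D.ang M (m + 1) t r (Fin.snoc b c)
      = ∑ k, D.ang M' (m + 1) t r (Fin.snoc b k) * M (t + m) k c := by
  -- The last matrix is the rightmost factor of the product and no R-matrix follows it, so it
  -- multiplies the rest on the right.
  induction m generalizing t with
  | zero =>
    have h1' : M' t = 1 := h1
    change D.ang M 1 t r (Fin.snoc b c) = ∑ k, D.ang M' 1 t r (Fin.snoc b k) * M t k c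
    simp only [ang_one, Fin.snoc_zero, h1']
    rw [Finset.sum_eq_single (r 0)]
    · rw [Matrix.one_apply_eq, one_mul]
    · intro k _ hk
      rw [Matrix.one_apply_ne hk.symm, zero_mul]
    · simp
  | succ m ih =>
    rw [← Fin.cons_self_tail r, ← Fin.cons_self_tail b]
    simp only [← Fin.cons_snoc_eq_snoc_cons, ang_cons_cons, Finset.sum_mul]
    rw [hM t (by omega)]
    have := fun r' => ih (t + 1) (fun a ha => hM a (by omega)) (by rw [← h1]; congr 1; omega) r'
      (Fin.tail b)
    simp only [this, Finset.mul_sum, Finset.smul_sum]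
    rw [show t + 1 + m = t + (m + 1) by omega]
    conv_rhs => rw [Finset.sum_comm]
    refine Finset.sum_congr rfl fun r' _ => ?_
    rw [Finset.sum_comm]
    simp only [mul_assoc, smul_mul_assoc]

theorem mono_cons_cons (m n : ℕ) (r r' : Fin m → ι) (a a' : ι) :
    D.mono (m + 1) n (Fin.cons a r) (Fin.cons a' r')
      = D.locR n a a' * D.mono m (n + 1) r r' := rfl

theorem mono_snoc (m n : ℕ) (r r' : Fin m → ι) (a a' : ι) :
    D.mono (m + 1) n (Fin.snoc r a) (Fin.snoc r' a')
      = D.mono m n r r' * D.locR (n + m) a a' := by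
  induction m generalizing n with
  | zero => simp [mono, Fin.snoc_zero]
  | succ m ih =>
    rw [← Fin.cons_self_tail r, ← Fin.cons_self_tail r', ← Fin.cons_snoc_eq_snoc_cons,
      ← Fin.cons_snoc_eq_snoc_cons, mono_cons_cons, mono_cons_cons, ih, Matrix.mul_assoc,
      show n + 1 + m = n + (m + 1) by omega]

/-- `R̄ᵗ - 1` is supported on the vectors `e_i ⊗ e_i`, so `R̄ᵗ` is invisible when its two column
indices differ. -/
theorem mul_locR_apply_of_ne (n : ℕ) (A : Matrix ι ι K) {a c l : ι} (h : l ≠ c) (k : ι) :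
    (A * D.locR n a c) k l = if a = c then A k l else 0 := by
  rw [Matrix.mul_apply]
  by_cases hac : a = c <;> simp [locR, h, hac]

/-- If the last matrix is the identity and the last column index differs from the other ones, then
the last tensor factor splits off. -/
theorem ang_snoc_of_notMem {M : ℕ → Matrix ι ι B} (m t : ℕ) (h1 : M (t + m) = 1)
    (r b : Fin m → ι) (c : ι) (hc : ∀ i, b i ≠ c) (e : ι) :
    D.ang M (m + 1) t (Fin.snoc r e) (Fin.snoc b c) = if e = c then D.ang M m t r b else 0 := by
  induction m generalizing t e with
  | zero =>
    by_cases h : e = c <;>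
      simp [ang, mono, Matrix.one_apply, Fin.snoc_zero, show M t = 1 from h1, h]
  | succ m ih =>
    rw [← Fin.cons_self_tail r, ← Fin.cons_self_tail b, ← Fin.cons_snoc_eq_snoc_cons,
      ← Fin.cons_snoc_eq_snoc_cons, ang_cons_cons, ang_cons_cons, sum_snoc_fun]
    have := fun r' e' => ih (t + 1) (by rw [← h1]; congr 1; omega) r' (Fin.tail b)
      (fun i => hc i.succ) e'
    simp only [this, mono_snoc]
    -- By induction the later matrices keep the last index at `c`. The first monodromy then ends in
    -- an R-matrix with the distinct column indices `b 0` and `c`, which acts as the identity.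
    rw [Finset.sum_eq_single c]
    · simp only [if_true, D.mul_locR_apply_of_ne _ _ (hc 0)]
      by_cases h : e = c <;> simp [h]
    · intro e' _ he'
      simp [he']
    · simp

/-- The form of `ang_snoc` for the contraction with `antisymRow`. -/
theorem psi_snoc {M M' : ℕ → Matrix ι ι B} (m t : ℕ) (hM : ∀ a < t + m, M' a = M a)
    (h1 : M' (t + m) = 1) (I : Finset ι) (b : Fin m → ι) (c : ι) :
    D.psi M (m + 1) t I (Fin.snoc b c)
      = ∑ k, D.psi M' (m + 1) t I (Fin.snoc b k) * M (t + m) k c := by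
  simp only [psi, D.ang_snoc m t hM h1, Finset.sum_mul, Finset.smul_sum]
  rw [Finset.sum_comm]
  simp only [smul_mul_assoc]

/-- The form of `ang_snoc_of_notMem` for the contraction with `antisymRow`. -/
theorem psi_snoc_of_notMem {M : ℕ → Matrix ι ι B} (m t : ℕ) (h1 : M (t + m) = 1) (I : Finset ι)
    (b : Fin m → ι) (c : ι) (hc : ∀ i, b i ≠ c) :
    D.psi M (m + 1) t I (Fin.snoc b c)
      = if c ∈ I then (-D.Qi) ^ above (I.erase c) c • D.psi M m t (I.erase c) b else 0 := by
  rw [psi, sum_snoc_fun, Finset.sum_eq_single c]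
  · simp only [D.ang_snoc_of_notMem m t h1 _ _ _ hc, if_true, antisymRow_snoc]
    by_cases h : c ∈ I
    · simp only [if_pos h, mul_smul, psi, Finset.smul_sum]
    · simp [h]
  · intro e _ he
    simp [D.ang_snoc_of_notMem m t h1 _ _ _ hc, he]
  · simp

/-- The contraction depends on the matrices `M_t, …, M_{t+m-1}` only. -/
theorem ang_congr {M M' : ℕ → Matrix ι ι B} (m t : ℕ) (hM : ∀ a < t + m, M' a = M a)
    (r c : Fin m → ι) : D.ang M' m t r c = D.ang M m t r c := by
  induction m generalizing t with
  | zero => rfl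
  | succ m ih =>
    simp only [ang, hM t (by omega), fun r' => ih (t + 1) (fun a ha => hM a (by omega)) r']

theorem psi_congr {M M' : ℕ → Matrix ι ι B} (m t : ℕ) (hM : ∀ a < t + m, M' a = M a)
    (I : Finset ι) (c : Fin m → ι) : D.psi M' m t I c = D.psi M m t I c := by
  simp only [psi, D.ang_congr m t hM]

end SpectralData

namespace SpectralData

variable {K : Type*} [CommRing K] (D : SpectralData K)
variable {ι : Type*} [LinearOrder ι]

/-! ### Column antisymmetry -/

/-- The nonzero entries of the `q`-permutation operator. -/
def swapWt (a b : ι) : K := if a = b then 1 else if b < a then D.Q else D.Qi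

/-- The `q`-permutation operator. -/
def swapMat : Matrix (ι × ι) (ι × ι) K :=
  Matrix.of fun x y => if x = y.swap then D.swapWt x.1 x.2 else 0

theorem swapWt_mul (a b : ι) : D.swapWt a b * D.swapWt b a = 1 := by
  have := D.hQ
  rcases lt_trichotomy a b with h | h | h
  · simp [swapWt, h.ne, h.ne', h, h.not_gt, mul_comm, this]
  · simp [swapWt, h]
  · simp [swapWt, h.ne, h.ne', h, h.not_gt, this]

/-- An exchange of distinct neighbours changes the inversion number by one, and `swapWt` compensates
the resulting power of `q`, leaving only the sign. -/
theorem antisymRow_swap {m : ℕ} (I : Finset ι) (a b : ι) (r : Fin m → ι) :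
    D.swapWt b a * D.antisymRow I (Fin.cons b (Fin.cons a r) : Fin (m + 2) → ι)
      = - D.antisymRow I (Fin.cons a (Fin.cons b r) : Fin (m + 2) → ι) := by
  simp only [antisymRow_cons, Finset.mem_erase]
  by_cases hab : a = b
  · simp [hab]
  by_cases ha : a ∈ I
  swap
  · simp [ha]
  by_cases hb : b ∈ I
  swap
  · simp [hb]
  have hba : b ≠ a := fun h => hab h.symm
  simp only [ha, hb, hab, hba, ne_eq, not_false_iff, and_self, if_true]
  have hQ := D.hQ
  rw [Finset.erase_right_comm, D.wt_erase ha b, D.wt_erase hb a]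
  rcases lt_or_gt_of_ne hab with h | h
  · simp only [swapWt, h, hba, h.not_gt, if_true, if_false]
    linear_combination (-(D.wt (I.erase a) b * D.wt (I.erase b) a *
      D.antisymRow ((I.erase a).erase b) r)) * hQ
  · simp only [swapWt, h, hba, h.not_gt, if_true, if_false]
    ring

variable [Fintype ι]

theorem swapMat_mul_apply (A : Matrix (ι × ι) (ι × ι) K) (a b : ι) (y : ι × ι) :
    (D.swapMat * A : Matrix (ι × ι) (ι × ι) K) (a, b) y = D.swapWt a b * A (b, a) y := by
  rw [Matrix.mul_apply, Finset.sum_eq_single (b, a)]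
  · simp [swapMat]
  · rintro ⟨c, d⟩ _ h
    simp only [swapMat, Matrix.of_apply, Prod.swap_prod_mk]
    rw [if_neg, zero_mul]
    rintro ⟨rfl, rfl⟩
    exact h rfl
  · simp

theorem mul_swapMat_apply (A : Matrix (ι × ι) (ι × ι) K) (x : ι × ι) (c d : ι) :
    (A * D.swapMat : Matrix (ι × ι) (ι × ι) K) x (c, d) = A x (d, c) * D.swapWt d c := by
  rw [Matrix.mul_apply, Finset.sum_eq_single (d, c)]
  · simp [swapMat]
  · rintro y _ h
    simp [swapMat, h]
  · simp

theorem swapMat_mul_self : (D.swapMat : Matrix (ι × ι) (ι × ι) K) * D.swapMat = 1 := by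
  ext ⟨a, b⟩ ⟨c, d⟩
  rw [swapMat_mul_apply]
  by_cases h : b = d ∧ a = c
  · obtain ⟨rfl, rfl⟩ := h
    simp [swapMat, swapWt_mul]
  · have : ¬ (a = c ∧ b = d) := fun h' => h h'.symm
    simp [swapMat, h, this]

/-- The product `R̄ᵗ_{1b} R̄ᵗ_{2b}` for fixed indices in the factor `b`. -/
def locRR (n : ℕ) (a c : ι) : Matrix (ι × ι) (ι × ι) K :=
  ∑ a', D.locR n a a' ⊗ₖ D.locR (n + 1) a' c

/-- The product `R̄ᵗ_{2b} R̄ᵗ_{1b}` for fixed indices in the factor `b`. -/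
def locRR' (n : ℕ) (a c : ι) : Matrix (ι × ι) (ι × ι) K :=
  ∑ a', D.locR n a' c ⊗ₖ D.locR (n + 1) a a'

theorem locRR_apply (n : ℕ) (a c k₁ k₂ l₁ l₂ : ι) :
    D.locRR n a c (k₁, k₂) (l₁, l₂)
      = (if a = c ∧ k₁ = l₁ ∧ k₂ = l₂ then 1 else 0)
        + (if k₁ = a ∧ l₁ = c ∧ k₂ = l₂ then D.gam n a c else 0)
        + (if k₁ = l₁ ∧ k₂ = a ∧ l₂ = c then D.gam (n + 1) a c else 0)
        + (if k₁ = a ∧ l₁ = k₂ ∧ l₂ = c then D.gam n a k₂ * D.gam (n + 1) k₂ c else 0) := by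
  simp only [locRR, Matrix.sum_apply, Matrix.kroneckerMap_apply, locR, Matrix.of_apply, add_mul,
    mul_add, Finset.sum_add_distrib, ← add_assoc]
  congr 1
  · congr 1
    · congr 1
      · rw [Finset.sum_eq_single a]
        · split_ifs <;> grind
        · intro b _ hb
          simp [hb.symm]
        · simp
      · rw [Finset.sum_eq_single c]
        · split_ifs <;> grind
        · intro b _ hb
          simp [hb]
        · simp
    · rw [Finset.sum_eq_single a]
      · split_ifs <;> grind
      · intro b _ hb
        simp [hb.symm]
      · simp
  · rw [Finset.sum_eq_single k₂]
    · split_ifs <;> grind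
    · intro b _ hb
      simp [hb.symm]
    · simp

theorem locRR'_apply (n : ℕ) (a c k₁ k₂ l₁ l₂ : ι) :
    D.locRR' n a c (k₁, k₂) (l₁, l₂)
      = (if a = c ∧ k₁ = l₁ ∧ k₂ = l₂ then 1 else 0)
        + (if k₁ = a ∧ l₁ = c ∧ k₂ = l₂ then D.gam n a c else 0)
        + (if k₁ = l₁ ∧ k₂ = a ∧ l₂ = c then D.gam (n + 1) a c else 0)
        + (if k₂ = a ∧ l₂ = k₁ ∧ l₁ = c then D.gam (n + 1) a k₁ * D.gam n k₁ c else 0) := by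
  simp only [locRR', Matrix.sum_apply, Matrix.kroneckerMap_apply, locR, Matrix.of_apply, add_mul,
    mul_add, Finset.sum_add_distrib, ← add_assoc]
  congr 1
  · congr 1
    · congr 1
      · rw [Finset.sum_eq_single a]
        · split_ifs <;> grind
        · intro b _ hb
          simp [hb.symm]
        · simp
      · rw [Finset.sum_eq_single a]
        · split_ifs <;> grind
        · intro b _ hb
          simp [hb.symm]
        · simp
    · rw [Finset.sum_eq_single c]
      · split_ifs <;> grind
      · intro b _ hb
        simp [hb]
      · simp
  · rw [Finset.sum_eq_single k₁]
    · split_ifs <;> grind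
    · intro b _ hb
      simp [hb.symm]
    · simp

end SpectralData

/-! ### Exchange relation for two transposed R-matrices -/

namespace SpectralData

variable {K : Type*} [CommRing K] (D : SpectralData K)
variable {ι : Type*} [LinearOrder ι] [Fintype ι]

-- An instance of the Yang–Baxter equation: `1 - P` is the R-matrix at ratio `q²` up to a scalar
-- (`RMat_fusion`), and `q²` is the ratio of the parameters `y (n + 1)` and `y n`. The entries
-- depend only on coincidences and order of the indices, so it is checked case by case.
set_option maxHeartbeats 1000000 in
set_option linter.unusedSimpArgs false in
theorem locRR_exchange (n : ℕ) (a c : ι) :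
    (1 - D.swapMat) * D.locRR n a c = D.locRR' n a c * (1 - D.swapMat) := by
  ext ⟨k₁, k₂⟩ ⟨l₁, l₂⟩
  rw [sub_mul, mul_sub, one_mul, mul_one, Matrix.sub_apply, Matrix.sub_apply, swapMat_mul_apply,
    mul_swapMat_apply]
  simp only [locRR_apply, locRR'_apply]
  by_cases h1 : k₁ = a <;> by_cases h2 : k₂ = a <;> by_cases h3 : l₁ = c <;> by_cases h4 : l₂ = c
  all_goals (try subst h1); all_goals (try subst h2); all_goals (try subst h3); all_goals (try subst h4)
  all_goals simp only [*, true_and, and_true, if_true, if_false, false_and, and_false, add_zero, zero_add, mul_zero, zero_mul]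
  all_goals
    have hQ := D.hQ
    have hy := D.hy n
    have hd := D.hd n
    have hd' := D.hd (n + 1)
    simp only [gam, swapWt]
    generalize D.Q = Q at *
    generalize D.Qi = Qi at *
    generalize D.y n = y at *
    generalize D.y (n + 1) = y' at *
    generalize D.d n = d at *
    generalize D.d (n + 1) = d' at *
    try grind
  -- The surviving cases are those in which the relative order of the free indices still matters;
  -- they are split by order.
  · by_cases h5 : k₂ = l₂
    · subst h5
      rcases lt_trichotomy k₂ l₁ with h6 | h6 | h6 <;>
      simp only [*, lt_irrefl, ne_of_lt, ne_of_gt, not_lt_of_gt, if_true, if_false, false_and, and_false, true_and, and_true] at * <;>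
      grind
    · simp [h5, Ne.symm h5]
  · by_cases h5 : k₂ = l₁
    · subst h5
      rcases lt_trichotomy k₂ l₂ with h6 | h6 | h6 <;>
      simp only [*, lt_irrefl, ne_of_lt, ne_of_gt, not_lt_of_gt, if_true, if_false, false_and, and_false, true_and, and_true] at * <;>
      grind
    · simp [h5, Ne.symm h5]
  · by_cases h5 : k₂ = l₂
    · subst h5
      rcases lt_trichotomy k₁ k₂ with h6 | h6 | h6 <;>
      simp only [*, lt_irrefl, ne_of_lt, ne_of_gt, not_lt_of_gt, if_true, if_false, false_and, and_false, true_and, and_true] at * <;>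
      grind
    · simp [h5, Ne.symm h5]
  · by_cases h5 : k₂ = l₁
    · subst h5
      rcases lt_trichotomy k₁ k₂ with h6 | h6 | h6 <;>
      rcases lt_trichotomy k₂ l₂ with h7 | h7 | h7 <;>
      rcases lt_trichotomy k₁ l₂ with h8 | h8 | h8 <;>
      simp only [*, lt_irrefl, ne_of_lt, ne_of_gt, not_lt_of_gt, if_true, if_false, false_and, and_false, true_and, and_true] at * <;>
      grind
    · simp [h5, Ne.symm h5]
  · by_cases h5 : k₁ = l₂
    · subst h5
      rcases lt_trichotomy k₁ k₂ with h6 | h6 | h6 <;>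
      simp only [*, lt_irrefl, ne_of_lt, ne_of_gt, not_lt_of_gt, if_true, if_false, false_and, and_false, true_and, and_true] at * <;>
      grind
    · simp [h5, Ne.symm h5]
  · by_cases h5 : k₁ = l₂
    · subst h5
      rcases lt_trichotomy k₁ k₂ with h6 | h6 | h6 <;>
      rcases lt_trichotomy k₁ l₁ with h7 | h7 | h7 <;>
      rcases lt_trichotomy k₂ l₁ with h8 | h8 | h8 <;>
      simp only [*, lt_irrefl, ne_of_lt, ne_of_gt, not_lt_of_gt, if_true, if_false, false_and, and_false, true_and, and_true] at * <;>
      grind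
    · simp [h5, Ne.symm h5]
  · by_cases h5 : k₁ = l₁
    · subst h5
      rcases lt_trichotomy k₁ k₂ with h6 | h6 | h6 <;>
      rcases lt_trichotomy k₁ l₂ with h7 | h7 | h7 <;>
      rcases lt_trichotomy k₂ l₂ with h8 | h8 | h8 <;>
      simp only [*, lt_irrefl, ne_of_lt, ne_of_gt, not_lt_of_gt, if_true, if_false, false_and, and_false, true_and, and_true] at * <;>
      grind
    · grind

end SpectralData

/-! ### Pairs of monodromy matrices and the fusion relation -/

namespace SpectralData

variable {K : Type*} [CommRing K] (D : SpectralData K)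
variable {ι : Type*} [LinearOrder ι] [Fintype ι]
variable {B : Type*} [Ring B] [Algebra K B]

/-- The product of two monodromy matrices, as a matrix in the two auxiliary factors. -/
def mono₂ (m n : ℕ) (r r'' : Fin m → ι) : Matrix (ι × ι) (ι × ι) K :=
  ∑ r', D.mono m n r r' ⊗ₖ D.mono m (n + 1) r' r''

/-- The product of two monodromy matrices in the opposite order. -/
def mono₂' (m n : ℕ) (r r'' : Fin m → ι) : Matrix (ι × ι) (ι × ι) K :=
  ∑ r', D.mono m n r' r'' ⊗ₖ D.mono m (n + 1) r r'

/-- R-matrices without a common tensor factor commute, so `(R̄ᵗ₁₃ ⋯ R̄ᵗ₁ₘ)(R̄ᵗ₂₃ ⋯ R̄ᵗ₂ₘ)` regroups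
site by site; `1 - P` can then be moved through one site at a time. -/
theorem mono₂_cons (m n : ℕ) (a c : ι) (r r'' : Fin m → ι) :
    D.mono₂ (m + 1) n (Fin.cons a r) (Fin.cons c r'')
      = D.locRR n a c * D.mono₂ m (n + 1) r r'' := by
  simp only [mono₂, locRR, sum_cons_fun, mono_cons_cons, Matrix.mul_kronecker_mul, Finset.sum_mul,
    Finset.mul_sum]
  rw [Finset.sum_comm]

theorem mono₂'_cons (m n : ℕ) (a c : ι) (r r'' : Fin m → ι) :
    D.mono₂' (m + 1) n (Fin.cons a r) (Fin.cons c r'')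
      = D.locRR' n a c * D.mono₂' m (n + 1) r r'' := by
  simp only [mono₂', locRR', sum_cons_fun, mono_cons_cons, Matrix.mul_kronecker_mul, Finset.sum_mul,
    Finset.mul_sum]
  rw [Finset.sum_comm]

theorem mono₂_exchange (m n : ℕ) (r r'' : Fin m → ι) :
    (1 - D.swapMat) * D.mono₂ m n r r'' = D.mono₂' m n r r'' * (1 - D.swapMat) := by
  induction m generalizing n with
  | zero =>
    simp [mono₂, mono₂', mono]
  | succ m ih =>
    rw [← Fin.cons_self_tail r, ← Fin.cons_self_tail r'', mono₂_cons, mono₂'_cons,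
      ← Matrix.mul_assoc, locRR_exchange, Matrix.mul_assoc, ih, Matrix.mul_assoc]

/-- The R-matrix `R̄ᵗ` in two factors. -/
def pairR (n : ℕ) : Matrix (ι × ι) (ι × ι) K :=
  Matrix.of fun x y => D.locR n x.2 y.2 x.1 y.1

/-- The product `S_1 R̄ᵗ_{12} S_2`. -/
def sandwich (n : ℕ) (M M' : Matrix ι ι B) : Matrix (ι × ι) (ι × ι) B :=
  (M ⊗ₖ 1) * (D.pairR n).map (algebraMap K B) * (1 ⊗ₖ M')

/-- The fusion relation for two matrices. -/
def Fusion (n : ℕ) (M M' : Matrix ι ι B) : Prop :=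
  ∃ X, ((1 : Matrix (ι × ι) (ι × ι) K) - D.swapMat).map (algebraMap K B) * D.sandwich n M M'
    = X * ((1 : Matrix (ι × ι) (ι × ι) K) - D.swapMat).map (algebraMap K B)

theorem sandwich_apply (n : ℕ) (M M' : Matrix ι ι B) (a b c d : ι) :
    D.sandwich n M M' (a, b) (c, d)
      = ∑ b', ∑ k, D.locR n b b' k c • (M a k * M' b' d) := by
  rw [sandwich, Matrix.mul_apply, Fintype.sum_prod_type, Finset.sum_eq_single c]
  · refine Finset.sum_congr rfl fun b' _ => ?_
    rw [Matrix.mul_apply, Fintype.sum_prod_type, Finset.sum_mul]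
    refine Finset.sum_congr rfl fun k _ => ?_
    rw [Finset.sum_eq_single b]
    · simp only [Matrix.kroneckerMap_apply, Matrix.one_apply_eq, mul_one, one_mul, Matrix.map_apply,
        pairR, Matrix.of_apply]
      rw [← Algebra.commutes, mul_assoc, Algebra.smul_def]
    · intro e _ he
      simp [Matrix.kroneckerMap_apply, Matrix.one_apply_ne he.symm]
    · simp
  · intro e _ he
    refine Finset.sum_eq_zero fun b' _ => ?_
    simp [Matrix.kroneckerMap_apply, Matrix.one_apply_ne he]
  · simp

omit [LinearOrder ι] in
theorem sum_sum_comm {β : Type*} [AddCommMonoid β] (f : ι → ι → ι → ι → β) :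
    ∑ c, ∑ e, ∑ b, ∑ k, f b k e c = ∑ b, ∑ k, ∑ e, ∑ c, f b k e c := by
  have h := Finset.sum_comm (s := (Finset.univ : Finset (ι × ι)))
    (t := (Finset.univ : Finset (ι × ι))) (f := fun p q => f q.1 q.2 p.2 p.1)
  simp only [Fintype.sum_prod_type] at h
  rw [h]
  refine Finset.sum_congr rfl fun b _ => Finset.sum_congr rfl fun k _ => ?_
  rw [Finset.sum_comm]

/-- The matrix `M (t + 1)` acts in the second factor and commutes with the R-matrices joining the
first factor to the sites after the second. This collects the first two matrices into the sandwich
to which `Fusion` applies. -/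
theorem ang_cons_cons_cons (M : ℕ → Matrix ι ι B) (m t : ℕ) (a b c d : ι) (r s : Fin m → ι) :
    D.ang M (m + 2) t (Fin.cons a (Fin.cons b r)) (Fin.cons c (Fin.cons d s))
      = ∑ r'', (D.sandwich (2 * t + 1) (M t) (M (t + 1)) *
          (D.mono₂ m (2 * t + 2) r r'').map (algebraMap K B)) (a, b) (c, d)
            * D.ang M m (t + 2) r'' s := by
  have lhs : D.ang M (m + 2) t (Fin.cons a (Fin.cons b r)) (Fin.cons c (Fin.cons d s))
      = ∑ b', ∑ r', ∑ k, ∑ r'', ∑ e, ∑ c', (D.locR (2 * t + 1) b b' k c' *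
          (D.mono m (2 * t + 1 + 1) r r' c' c * D.mono m (2 * (t + 1) + 1) r' r'' e d)) •
            (M t a k * (M (t + 1) b' e * D.ang M m (t + 1 + 1) r'' s)) := by
    rw [ang_cons_cons, sum_cons_fun]
    simp only [ang_cons_cons, mono_cons_cons, Matrix.mul_apply, Finset.sum_smul, Finset.mul_sum,
      Finset.smul_sum, Finset.sum_mul, mul_smul_comm, smul_smul, mul_assoc]
  have rhs : ∀ r'', (D.sandwich (2 * t + 1) (M t) (M (t + 1)) *
          (D.mono₂ m (2 * t + 2) r r'').map (algebraMap K B)) (a, b) (c, d)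
            * D.ang M m (t + 2) r'' s
      = ∑ b', ∑ k, ∑ e, ∑ c', ∑ r', (D.locR (2 * t + 1) b b' k c' *
          (D.mono m (2 * t + 1 + 1) r r' c' c * D.mono m (2 * (t + 1) + 1) r' r'' e d)) •
            (M t a k * (M (t + 1) b' e * D.ang M m (t + 1 + 1) r'' s)) := by
    intro r''
    rw [Matrix.mul_apply, Fintype.sum_prod_type, Finset.sum_mul, ← sum_sum_comm]
    refine Finset.sum_congr rfl fun c' _ => ?_
    rw [Finset.sum_mul]
    refine Finset.sum_congr rfl fun e _ => ?_
    rw [sandwich_apply, Matrix.map_apply, ← Algebra.commutes, ← Algebra.smul_def, mono₂,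
      Matrix.sum_apply, Finset.smul_sum, Finset.sum_mul]
    refine Finset.sum_congr rfl fun b' _ => ?_
    rw [Finset.smul_sum, Finset.sum_mul]
    refine Finset.sum_congr rfl fun k _ => ?_
    rw [Finset.sum_smul, Finset.sum_mul]
    refine Finset.sum_congr rfl fun r' _ => ?_
    rw [Matrix.kroneckerMap_apply, smul_smul, smul_mul_assoc, mul_assoc (M t a k), mul_comm]
    rfl
  rw [lhs]
  simp only [rhs, Finset.sum_comm (s := (Finset.univ : Finset ι))
    (t := (Finset.univ : Finset (Fin m → ι)))]
  rw [Finset.sum_comm]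

end SpectralData

/-! ### Column antisymmetry of the contractions -/

namespace SpectralData

variable {K : Type*} [CommRing K] (D : SpectralData K)
variable {ι : Type*} [LinearOrder ι]
variable {B : Type*} [Ring B] [Algebra K B]

/-- A function of sequences which changes as the columns of a quantum minor under the
transpositions of neighbours. -/
def IsColumnAntisym {m : ℕ} (F : (Fin m → ι) → B) : Prop :=
  ∀ (i j : Fin m), (j : ℕ) = i + 1 → ∀ b : Fin m → ι,
    F b + D.swapWt (b j) (b i) • F (b ∘ Equiv.swap i j) = 0

/-- `swapWt` is `q` or `q⁻¹` according to the change of the inversion number, so normalisation by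
`(-q)^{inv}` turns antisymmetry into invariance. -/
theorem IsColumnAntisym.comp_swap {m : ℕ} {F : (Fin m → ι) → B} (hF : D.IsColumnAntisym F)
    {i j : Fin m} (hij : (j : ℕ) = i + 1) {b : Fin m → ι} (hb : Function.Injective b) :
    (-D.Q) ^ invNum (b ∘ Equiv.swap i j) • F (b ∘ Equiv.swap i j) = (-D.Q) ^ invNum b • F b := by
  have hne : b i ≠ b j := fun h => by
    have := hb h
    rw [this] at hij
    omega
  have h := hF i j hij b
  have hinv := invNum_comp_swap b i j hij
  rw [eq_neg_of_add_eq_zero_left h, ← neg_smul, smul_smul]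
  congr 1
  rcases lt_or_gt_of_ne hne with h | h
  · rw [if_pos h] at hinv
    have : invNum (b ∘ Equiv.swap i j) = invNum b + 1 := by omega
    rw [this, swapWt, if_neg hne.symm, if_pos h, pow_succ]
  · rw [if_neg h.not_gt, if_pos h] at hinv
    have : invNum b = invNum (b ∘ Equiv.swap i j) + 1 := by omega
    rw [this, swapWt, if_neg hne.symm, if_neg h.not_gt, pow_succ]
    have := D.hQ
    linear_combination (-(-D.Q) ^ invNum (b ∘ Equiv.swap i j)) * this

theorem IsColumnAntisym.comp_perm {m : ℕ} {F : (Fin m → ι) → B} (hF : D.IsColumnAntisym F)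
    (σ : Equiv.Perm (Fin m)) {b : Fin m → ι} (hb : Function.Injective b) :
    (-D.Q) ^ invNum (b ∘ σ) • F (b ∘ σ) = (-D.Q) ^ invNum b • F b := by
  cases m with
  | zero => rw [Subsingleton.elim (b ∘ σ) b]
  | succ m =>
    have hσ : σ ∈ Submonoid.closure
        (Set.range fun i : Fin m => Equiv.swap i.castSucc i.succ) := by
      rw [Equiv.Perm.mclosure_swap_castSucc_succ]
      trivial
    induction hσ using Submonoid.closure_induction generalizing b with
    | mem x hx =>
      obtain ⟨i, rfl⟩ := hx
      exact hF.comp_swap D (by simp) hb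
    | one => rfl
    | mul x y _ _ hx hy =>
      rw [Equiv.Perm.coe_mul, ← Function.comp_assoc, hy (hb.comp x.injective), hx hb]

/-- Up to the normalising power of `-q`, the values depend on the set of columns only. -/
theorem IsColumnAntisym.eq_of_image_eq {m : ℕ} {F : (Fin m → ι) → B} (hF : D.IsColumnAntisym F)
    {b b' : Fin m → ι} (hb : Function.Injective b) (hb' : Function.Injective b')
    (h : Finset.univ.image b' = Finset.univ.image b) :
    (-D.Q) ^ invNum b' • F b' = (-D.Q) ^ invNum b • F b := by
  have hr : Set.range b' = Set.range b := by
    have := congrArg (fun s : Finset ι => (s : Set ι)) h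
    simpa using this
  let σ : Equiv.Perm (Fin m) := (Equiv.ofInjective b' hb').trans
    ((Equiv.setCongr hr).trans (Equiv.ofInjective b hb).symm)
  have hσ : b' = b ∘ σ := by
    ext1 i
    have := Equiv.apply_ofInjective_symm hb (Equiv.setCongr hr (Equiv.ofInjective b' hb' i))
    simp only [σ, Function.comp_apply, Equiv.trans_apply, this]
    rfl
  rw [hσ]
  exact hF.comp_perm D σ hb

variable [Fintype ι]

/-- Exhibits the row vector as a left multiple of `1 - P` in its first two factors. Taking only the
entries in increasing order avoids a division by `2`. -/
theorem vecMul_one_sub_swapMat {m : ℕ} (I : Finset ι) (r : Fin m → ι) :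
    Matrix.vecMul (fun x : ι × ι => if x.1 < x.2 then
        D.antisymRow I (Fin.cons x.1 (Fin.cons x.2 r) : Fin (m + 2) → ι) else 0) (1 - D.swapMat)
      = fun x => D.antisymRow I (Fin.cons x.1 (Fin.cons x.2 r) : Fin (m + 2) → ι) := by
  ext ⟨c, d⟩
  rw [Matrix.vecMul_sub, Matrix.vecMul_one, Pi.sub_apply]
  have : ∀ u : ι × ι → K, Matrix.vecMul u D.swapMat (c, d) = u (d, c) * D.swapWt d c := by
    intro u
    rw [Matrix.vecMul, dotProduct, Finset.sum_eq_single (d, c)]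
    · simp [swapMat]
    · rintro y _ h
      simp [swapMat, h]
    · simp
  rw [this]
  simp only
  rcases lt_trichotomy c d with h | h | h
  · simp [h, h.not_gt]
  · subst h
    simp [antisymRow_cons]
  · rw [if_neg h.not_gt, if_pos h, zero_sub, mul_comm, antisymRow_swap, neg_neg]

/-- The factor `1 - P` hidden in the row vector passes through the sandwich by fusion and through
the two monodromies by the exchange relation. It then stands on the right, where `(1 - P)(1 + P) =
0`. -/
theorem psi_swap_zero (M : ℕ → Matrix ι ι B) (m t : ℕ) (hM : D.Fusion (2 * t + 1) (M t) (M (t + 1)))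
    (I : Finset ι) (c d : ι) (s : Fin m → ι) :
    D.psi M (m + 2) t I (Fin.cons c (Fin.cons d s))
      + D.swapWt d c • D.psi M (m + 2) t I (Fin.cons d (Fin.cons c s)) = 0 := by
  obtain ⟨X, hX⟩ := hM
  let al : K →+* B := algebraMap K B
  let Z : (Fin m → ι) → (Fin m → ι) → Matrix (ι × ι) (ι × ι) B := fun r r'' =>
    D.sandwich (2 * t + 1) (M t) (M (t + 1)) * (D.mono₂ m (2 * t + 2) r r'').map al
  let v : (Fin m → ι) → ι × ι → B := fun r x =>
    al (D.antisymRow I (Fin.cons x.1 (Fin.cons x.2 r) : Fin (m + 2) → ι))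
  have hpsi : ∀ c d, D.psi M (m + 2) t I (Fin.cons c (Fin.cons d s))
      = ∑ r, ∑ r'', Matrix.vecMul (v r) (Z r r'') (c, d) * D.ang M m (t + 2) r'' s := by
    intro c d
    rw [psi, sum_cons_fun]
    simp only [sum_cons_fun, ang_cons_cons_cons]
    rw [← Fintype.sum_prod_type', Finset.sum_comm]
    refine Finset.sum_congr rfl fun r _ => ?_
    simp only [Finset.smul_sum]
    rw [Finset.sum_comm]
    refine Finset.sum_congr rfl fun r'' _ => ?_
    rw [Matrix.vecMul, dotProduct, Finset.sum_mul]
    refine Finset.sum_congr rfl fun x _ => ?_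
    rw [Algebra.smul_def, mul_assoc]
  have key : ∀ r r'', Matrix.vecMul (v r) (Z r r'') (c, d)
      + D.swapWt d c • Matrix.vecMul (v r) (Z r r'') (d, c) = 0 := by
    intro r r''
    have hz : Z r r'' * ((1 : Matrix (ι × ι) (ι × ι) K) + D.swapMat).map al
        = Z r r'' + Z r r'' * D.swapMat.map al := by
      rw [Matrix.map_add _ (map_add al), mul_add, Matrix.map_one _ (map_zero al) (map_one al),
        mul_one]
    have hv : v r = Matrix.vecMul (fun x : ι × ι => al (if x.1 < x.2 then
        D.antisymRow I (Fin.cons x.1 (Fin.cons x.2 r) : Fin (m + 2) → ι) else 0))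
          (((1 : Matrix (ι × ι) (ι × ι) K) - D.swapMat).map al) := by
      ext x
      have := congrFun (D.vecMul_one_sub_swapMat I r) x
      simp only [v]
      rw [← this]
      exact RingHom.map_vecMul al _ _ x
    have h0 : Matrix.vecMul (v r) (Z r r'' * ((1 : Matrix (ι × ι) (ι × ι) K) + D.swapMat).map al)
        = 0 := by
      rw [hv, Matrix.vecMul_vecMul, ← mul_assoc]
      simp only [Z]
      rw [← mul_assoc, hX, mul_assoc X, ← Matrix.map_mul, mono₂_exchange, mul_assoc X,
        ← Matrix.map_mul, mul_assoc, show ((1 : Matrix (ι × ι) (ι × ι) K) - D.swapMat)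
          * (1 + D.swapMat) = 0 by rw [sub_mul, mul_add, mul_add, swapMat_mul_self, one_mul, mul_one, one_mul]; abel]
      simp
    rw [hz, Matrix.vecMul_add, ← Matrix.vecMul_vecMul _ (Z r r'')] at h0
    have h1 := congrFun h0 (c, d)
    rw [Pi.add_apply, Pi.zero_apply] at h1
    rw [← h1]
    congr 1
    generalize Matrix.vecMul (v r) (Z r r'') = w
    rw [Matrix.vecMul, dotProduct, Finset.sum_eq_single (d, c)]
    · simp [swapMat, al, Algebra.smul_def, Algebra.commutes]
    · rintro y _ h
      simp [swapMat, h]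
    · simp
  rw [hpsi, hpsi, Finset.smul_sum, ← Finset.sum_add_distrib]
  refine Finset.sum_eq_zero fun r _ => ?_
  rw [Finset.smul_sum, ← Finset.sum_add_distrib]
  refine Finset.sum_eq_zero fun r'' _ => ?_
  rw [← smul_mul_assoc, ← add_mul, key, zero_mul]

/-- Away from the first column, `psi_cons` strips the first matrix without touching the later
columns, and the claim descends to shorter contractions with other index sets. -/
theorem psi_swap (M : ℕ → Matrix ι ι B) (m t : ℕ) (i j : Fin m) (hij : (j : ℕ) = i + 1)
    (hM : D.Fusion (2 * (t + i) + 1) (M (t + i)) (M (t + i + 1))) (I : Finset ι) (b : Fin m → ι) :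
    D.psi M m t I b + D.swapWt (b j) (b i) • D.psi M m t I (b ∘ Equiv.swap i j) = 0 := by
  induction m generalizing t I with
  | zero => exact i.elim0
  | succ m ih =>
    induction i using Fin.cases with
    | zero =>
      obtain ⟨m, rfl⟩ : ∃ k, m = k + 1 := ⟨m - 1, by omega⟩
      have hj : j = 1 := by
        ext
        simpa using hij
      subst hj
      have e1 : b = Fin.cons (b 0) (Fin.cons (b 1) (Fin.tail (Fin.tail b))) := by
        ext k
        refine Fin.cases rfl (fun k => ?_) k
        refine Fin.cases rfl (fun k => ?_) k
        rfl
      have e2 : b ∘ Equiv.swap 0 1 = Fin.cons (b 1) (Fin.cons (b 0) (Fin.tail (Fin.tail b))) := by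
        ext k
        refine Fin.cases ?_ (fun k => ?_) k
        · simp
        refine Fin.cases ?_ (fun k => ?_) k
        · simp
        · have h1 : k.succ.succ ≠ 0 := Fin.succ_ne_zero _
          have h2 : k.succ.succ ≠ 1 := fun h => Fin.succ_ne_zero k (Fin.succ_injective _ h)
          simp [Equiv.swap_apply_of_ne_of_ne h1 h2, Fin.tail]
      rw [e2]
      conv_lhs => rw [e1]
      exact D.psi_swap_zero M m t hM I _ _ _
    | succ i =>
      obtain ⟨j, rfl⟩ : ∃ k, j = Fin.succ k := by
        refine ⟨⟨j - 1, by omega⟩, ?_⟩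
        ext
        simp
        omega
      have hij' : (j : ℕ) = i + 1 := by simpa using hij
      have e : b ∘ Equiv.swap i.succ j.succ
          = Fin.cons (b 0) (Fin.tail b ∘ Equiv.swap i j) := by
        ext k
        refine Fin.cases ?_ (fun k => ?_) k
        · simp [Equiv.swap_apply_of_ne_of_ne (Fin.succ_ne_zero i).symm (Fin.succ_ne_zero j).symm]
        · rw [Function.comp_apply, ← (Fin.succ_injective m).map_swap]
          rfl
      have hM' : D.Fusion (2 * (t + 1 + i) + 1) (M (t + 1 + i)) (M (t + 1 + i + 1)) := by
        have : t + (i.succ : Fin (m + 1)).val = t + 1 + i := by simp; omega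
        rwa [this] at hM
      have h := fun J => ih (t + 1) i j hij' hM' J (Fin.tail b)
      rw [e]
      have hc : D.psi M (m + 1) t I b = D.psi M (m + 1) t I (Fin.cons (b 0) (Fin.tail b)) := by
        rw [Fin.cons_self_tail]
      rw [hc, psi_cons, psi_cons, Finset.smul_sum, ← Finset.sum_add_distrib]
      refine Finset.sum_eq_zero fun a _ => ?_
      rw [smul_comm, ← smul_add, Finset.smul_sum, ← Finset.sum_add_distrib]
      refine smul_eq_zero_of_right _ (Finset.sum_eq_zero fun k _ => ?_)
      rw [smul_comm, ← smul_add, ← mul_smul_comm, ← mul_add]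
      have h' := h (target (I.erase a) k (b 0))
      rw [show b j.succ = Fin.tail b j from rfl, show b i.succ = Fin.tail b i from rfl, h', mul_zero,
        smul_zero]

theorem isColumnAntisym_psi {M : ℕ → Matrix ι ι B} {m t : ℕ}
    (hM : ∀ i, i + 1 < m → D.Fusion (2 * (t + i) + 1) (M (t + i)) (M (t + i + 1))) (I : Finset ι) :
    D.IsColumnAntisym (D.psi M m t I) := fun i j hij b =>
  D.psi_swap M m t i j hij (hM i (by omega)) I b

/-- Fusion is required of the first `m` matrices only, so that the last one may be replaced by the
identity. -/
theorem isColumnAntisym_psi_snoc {M : ℕ → Matrix ι ι B} {m t : ℕ}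
    (hM : ∀ i, i + 1 < m → D.Fusion (2 * (t + i) + 1) (M (t + i)) (M (t + i + 1))) (I : Finset ι)
    (c : ι) : D.IsColumnAntisym fun b : Fin m → ι => D.psi M (m + 1) t I (Fin.snoc b c) := by
  intro i j hij b
  have h := D.psi_swap M (m + 1) t i.castSucc j.castSucc hij (hM i (by omega)) I (Fin.snoc b c)
  have e : (Fin.snoc b c : Fin (m + 1) → ι) ∘ Equiv.swap i.castSucc j.castSucc
      = Fin.snoc (b ∘ Equiv.swap i j) c := by
    ext k
    refine Fin.lastCases ?_ (fun k => ?_) k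
    · simp [Equiv.swap_apply_of_ne_of_ne (Fin.castSucc_lt_last i).ne' (Fin.castSucc_lt_last j).ne']
    · rw [Function.comp_apply, ← (Fin.castSucc_injective m).map_swap]
      simp
  rw [e, Fin.snoc_castSucc, Fin.snoc_castSucc] at h
  exact h

end SpectralData

/-! ### The map `p ↦ p'` -/

section PrimeSeq

variable {ι : Type*} [LinearOrder ι]

theorem isGreatest_erase {I : Finset ι} {w a : ι} (hw : IsGreatest (I : Set ι) w) (h : a ≠ w) :
    IsGreatest ((I.erase a : Finset ι) : Set ι) w :=
  ⟨Finset.mem_coe.2 (Finset.mem_erase.2 ⟨h.symm, hw.1⟩), fun _ hi => hw.2 (Finset.mem_of_mem_erase hi)⟩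

/-- The properties of the image of a pair under `pairMap`. -/
theorem pairMap_spec {I : Finset ι} {w w₁ w₂ w' j k : ι} (hw : IsGreatest (I : Set ι) w)
    (hw₁ : IsGreatest ((I.erase w : Finset ι) : Set ι) w₁)
    (hw₂ : IsGreatest (((I.erase w).erase w₁ : Finset ι) : Set ι) w₂)
    (hj : j ∈ I) (hjk : j ≠ k)
    (hw' : IsGreatest (((I.erase j).erase k : Finset ι) : Set ι) w') :
    (pairMap w w₁ w₂ j k).1 = (if k = w then w₁ else k)
      ∧ (pairMap w w₁ w₂ j k).2 ∉ ((I.erase j).erase k).erase w'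
      ∧ insert (pairMap w w₁ w₂ j k).2 (((I.erase j).erase k).erase w')
        = (I.erase w).erase (pairMap w w₁ w₂ j k).1 := by
  have h₁ : w₁ ∈ I.erase w := hw₁.1
  have h₁' : w₁ ≠ w := Finset.ne_of_mem_erase h₁
  have h₂ : w₂ ∈ (I.erase w).erase w₁ := hw₂.1
  have hwI : w ∈ I := hw.1
  have hw'I : w' ∈ (I.erase j).erase k := hw'.1
  unfold pairMap
  -- In the order of the clauses of `pairMap`, the largest remaining element `w'` is `w₂`, `w₁`,
  -- `w₁`, `w`, and the second entry of the image is `w₂`, `j`, `w₁`, `j`.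
  by_cases hA : (j = w₁ ∧ k = w) ∨ (j = w ∧ k = w₁)
  · rw [if_pos hA]
    have hI : (I.erase j).erase k = (I.erase w).erase w₁ := by
      rcases hA with ⟨rfl, rfl⟩ | ⟨rfl, rfl⟩
      · rw [Finset.erase_right_comm]
      · rfl
    rw [hI] at hw' ⊢
    have := hw'.unique hw₂
    subst this
    refine ⟨?_, Finset.notMem_erase _ _, Finset.insert_erase hw'.1⟩
    rcases hA with ⟨rfl, rfl⟩ | ⟨rfl, rfl⟩
    · simp
    · simp [h₁']
  · rw [if_neg hA]
    by_cases hB : k = w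
    · subst hB
      have hj₁ : j ≠ w₁ := fun h => hA (Or.inl ⟨h, rfl⟩)
      rw [if_pos rfl, if_pos rfl, Finset.erase_right_comm (s := I)]
      rw [Finset.erase_right_comm (s := I)] at hw'
      have := hw'.unique (isGreatest_erase hw₁ hj₁)
      subst this
      refine ⟨rfl, by simp, ?_⟩
      rw [Finset.erase_right_comm, Finset.insert_erase]
      simp [hj₁, hjk, hj]
    · rw [if_neg hB, if_neg hB]
      by_cases hC : j = w
      · subst hC
        have hk₁ : k ≠ w₁ := fun h => hA (Or.inr ⟨rfl, h⟩)
        rw [if_pos rfl]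
        have := hw'.unique (isGreatest_erase hw₁ hk₁)
        subst this
        exact ⟨rfl, Finset.notMem_erase _ _, Finset.insert_erase hw'I⟩
      · rw [if_neg hC]
        have := hw'.unique (isGreatest_erase (isGreatest_erase hw hC) hB)
        subst this
        refine ⟨rfl, by simp, ?_⟩
        rw [Finset.erase_right_comm (s := I), Finset.erase_right_comm (s := I.erase k),
          Finset.erase_right_comm (s := I) (a := k), Finset.insert_erase]
        simp [hC, hjk, hj]

theorem comp_sort_spec {m : ℕ} {p : Fin (m + 3) → ι} (hp : Function.Injective p) {I : Finset ι}
    (hI : Finset.univ.image p = I) :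
    IsGreatest (I : Set ι) (p (Tuple.sort p (Fin.last (m + 2))))
      ∧ IsGreatest ((I.erase (p (Tuple.sort p (Fin.last (m + 2)))) : Finset ι) : Set ι)
          (p (Tuple.sort p ⟨m + 1, by omega⟩))
      ∧ IsGreatest (((I.erase (p (Tuple.sort p (Fin.last (m + 2))))).erase
          (p (Tuple.sort p ⟨m + 1, by omega⟩)) : Finset ι) : Set ι)
          (p (Tuple.sort p ⟨m, by omega⟩)) := by
  have hmono : Monotone (p ∘ Tuple.sort p) := Tuple.monotone_sort p
  have hinj : Function.Injective (p ∘ Tuple.sort p) := hp.comp (Tuple.sort p).injective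
  have hmem : ∀ a, p (Tuple.sort p a) ∈ I := fun a => by
    rw [← hI]
    exact Finset.mem_image_of_mem _ (Finset.mem_univ _)
  have hex : ∀ i ∈ I, ∃ a, p (Tuple.sort p a) = i := by
    intro i hi
    rw [← hI] at hi
    obtain ⟨a, _, rfl⟩ := Finset.mem_image.1 hi
    exact ⟨(Tuple.sort p).symm a, by simp⟩
  have hne : ∀ a b, a ≠ b → p (Tuple.sort p a) ≠ p (Tuple.sort p b) := fun a b h h' =>
    h (hinj h')
  refine ⟨⟨hmem _, ?_⟩, ⟨?_, ?_⟩, ⟨?_, ?_⟩⟩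
  · intro i hi
    obtain ⟨a, rfl⟩ := hex i hi
    exact hmono (Fin.le_last a)
  · refine Finset.mem_coe.2 (Finset.mem_erase.2 ⟨hne _ _ ?_, hmem _⟩)
    simp [Fin.ext_iff]
  · intro i hi
    obtain ⟨h, hi⟩ := Finset.mem_erase.1 (Finset.mem_coe.1 hi)
    obtain ⟨a, rfl⟩ := hex i hi
    have : a ≠ Fin.last (m + 2) := fun h' => h (by rw [h'])
    refine hmono ?_
    rw [Fin.le_def]
    have h1 : (a : ℕ) ≠ m + 2 := fun h' => this (Fin.ext h')
    have := a.2
    simp only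
    omega
  · refine Finset.mem_coe.2 (Finset.mem_erase.2 ⟨hne _ _ ?_,
      Finset.mem_erase.2 ⟨hne _ _ ?_, hmem _⟩⟩)
    · simp [Fin.ext_iff]
    · simp [Fin.ext_iff]
  · intro i hi
    obtain ⟨h', hi⟩ := Finset.mem_erase.1 (Finset.mem_coe.1 hi)
    obtain ⟨h, hi⟩ := Finset.mem_erase.1 hi
    obtain ⟨a, rfl⟩ := hex i hi
    have h1 : (a : ℕ) ≠ m + 2 := fun h1 => h (by congr 2; exact Fin.ext h1)
    have h2 : (a : ℕ) ≠ m + 1 := fun h1 => h' (by congr 2; exact Fin.ext h1)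
    refine hmono ?_
    rw [Fin.le_def]
    have := a.2
    simp only
    omega

theorem exists_isGreatest_erase {m : ℕ} {p : Fin (m + 3) → ι} (hp : Function.Injective p)
    {I : Finset ι} (hI : Finset.univ.image p = I) {w : ι} (hw : IsGreatest (I : Set ι) w) :
    ∃ w₁ w₂, IsGreatest ((I.erase w : Finset ι) : Set ι) w₁
      ∧ IsGreatest (((I.erase w).erase w₁ : Finset ι) : Set ι) w₂ := by
  obtain ⟨h, h₁, h₂⟩ := comp_sort_spec hp hI
  rw [h.unique hw] at h₁ h₂
  exact ⟨_, _, h₁, h₂⟩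

/-- Frees the recursion from sorting. The last entry is isolated by `Fin.snoc` because in the
expansion it is replaced by an arbitrary last column. -/
theorem primeSeq_cons_snoc {m : ℕ} {p : Fin (m + 1) → ι} {j k : ι} {I : Finset ι} {w w₁ w₂ : ι}
    (hp : Function.Injective (Fin.cons j (Fin.snoc p k) : Fin (m + 3) → ι))
    (hI : Finset.univ.image (Fin.cons j (Fin.snoc p k) : Fin (m + 3) → ι) = I)
    (hw : IsGreatest (I : Set ι) w)
    (hw₁ : IsGreatest ((I.erase w : Finset ι) : Set ι) w₁)
    (hw₂ : IsGreatest (((I.erase w).erase w₁ : Finset ι) : Set ι) w₂) :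
    primeSeq (m + 3) (Fin.cons j (Fin.snoc p k))
      = Fin.snoc (Fin.cons (pairMap w w₁ w₂ j k).1 (Fin.snoc (Fin.init (primeSeq (m + 1) p))
          (pairMap w w₁ w₂ j k).2 : Fin (m + 1) → ι) : Fin (m + 2) → ι) w := by
  obtain ⟨h, h₁, h₂⟩ := comp_sort_spec hp hI
  have e := h.unique hw
  rw [e] at h₁ h₂
  have e₁ := h₁.unique hw₁
  rw [e₁] at h₂
  have e₂ := h₂.unique hw₂
  rw [primeSeq]
  simp only [Function.comp_apply, e, e₁, e₂]
  rw [← Fin.cons_snoc_eq_snoc_cons]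
  have e3 : (Fin.cons j (Fin.snoc p k) : Fin (m + 3) → ι) 0 = j := rfl
  have e4 : (Fin.cons j (Fin.snoc p k) : Fin (m + 3) → ι) (Fin.last (m + 2)) = k := by
    rw [← Fin.succ_last, Fin.cons_succ, Fin.snoc_last]
  have e5 : (fun i : Fin (m + 1) => (Fin.cons j (Fin.snoc p k) : Fin (m + 3) → ι) i.succ.castSucc)
      = p := by
    ext i
    rw [← Fin.succ_castSucc, Fin.cons_succ, Fin.snoc_castSucc]
  rw [e3, e4, e5]

theorem exists_isGreatest {I : Finset ι} (h : 0 < I.card) : ∃ w, IsGreatest (I : Set ι) w :=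
  ⟨_, I.isGreatest_max' (Finset.card_pos.1 h)⟩

/-- The entries of `p'` are, apart from the last one, all but the largest of those of `p`. -/
theorem primeSeq_spec (m : ℕ) (p : Fin (m + 1) → ι) (hp : Function.Injective p) {I : Finset ι}
    (hI : Finset.univ.image p = I) {w : ι} (hw : IsGreatest (I : Set ι) w) :
    (Function.Injective (Fin.init (primeSeq (m + 1) p) : Fin m → ι)
      ∧ Finset.univ.image (Fin.init (primeSeq (m + 1) p) : Fin m → ι) = I.erase w)
      ∧ primeSeq (m + 1) p (Fin.last m) = w := by
  induction m using Nat.strong_induction_on generalizing I w with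
  | _ m ih =>
  match m, p, hp, hI, ih with
  | 0, p, hp, hI, _ =>
    have : I = {p 0} := by rw [← hI]; simp
    subst this
    have : w = p 0 := by simpa using hw.1
    subst this
    exact ⟨⟨Function.injective_of_subsingleton _, by simp⟩, rfl⟩
  | 1, p, hp, hI, _ =>
    have hI' : I = {p 0, p 1} := by
      rw [← hI]
      ext i
      simp [Fin.exists_fin_two, eq_comm]
    subst hI'
    have h01 : p 0 ≠ p 1 := fun h => by simpa using hp h
    have hw' : w = max (p 0) (p 1) := by
      refine hw.unique ⟨?_, ?_⟩
      · rcases max_choice (p 0) (p 1) with h | h <;> simp [h]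
      · intro i hi
        have : i = p 0 ∨ i = p 1 := by simpa using hi
        rcases this with rfl | rfl
        · exact le_max_left _ _
        · exact le_max_right _ _
    subst hw'
    refine ⟨⟨Function.injective_of_subsingleton _, ?_⟩, rfl⟩
    have e : (Fin.init (primeSeq (1 + 1) p) : Fin 1 → ι) = fun _ => min (p 0) (p 1) := by
      ext i
      rw [Subsingleton.elim i 0]
      rfl
    rw [e]
    ext i
    rcases lt_or_gt_of_ne h01 with h | h
    · simp [min_eq_left h.le, max_eq_right h.le]
      grind
    · simp [min_eq_right h.le, max_eq_left h.le]
      grind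
  | m + 2, p, hp, hI, ih =>
    obtain ⟨j, p, rfl⟩ : ∃ j p', p = Fin.cons j p' := ⟨_, _, (Fin.cons_self_tail p).symm⟩
    obtain ⟨p, k, rfl⟩ : ∃ p' k, p = Fin.snoc p' k := ⟨_, _, (Fin.snoc_init_self p).symm⟩
    obtain ⟨w₁, w₂, h₁, h₂⟩ := exists_isGreatest_erase hp hI hw
    rw [primeSeq_cons_snoc hp hI hw h₁ h₂, Fin.init_snoc, Fin.snoc_last]
    obtain ⟨hj, hp', hI'⟩ := inj_image_cons_iff.1 ⟨hp, hI⟩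
    obtain ⟨hk, hp'', hI''⟩ := inj_image_snoc_iff.1 ⟨hp', hI'⟩
    obtain ⟨w', hw'⟩ : ∃ w', IsGreatest (((I.erase j).erase k : Finset ι) : Set ι) w' := by
      refine exists_isGreatest ?_
      rw [← hI'', Finset.card_pos]
      exact ⟨p 0, Finset.mem_image_of_mem _ (Finset.mem_univ _)⟩
    obtain ⟨i1, -⟩ := ih m (by omega) p hp'' hI'' hw'
    obtain ⟨s1, s2, s3⟩ := pairMap_spec hw h₁ h₂ hj
      (Finset.ne_of_mem_erase hk).symm hw'
    refine ⟨?_, rfl⟩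
    -- By `pairMap_spec` the inner values and the two entries of the image pair together exhaust
    -- `I.erase w`.
    rw [inj_image_cons_iff, inj_image_snoc_iff, ← s3, Finset.erase_insert s2]
    refine ⟨?_, Finset.mem_insert_self _ _, i1.1, i1.2⟩
    rw [s1]
    split_ifs with hkw
    · exact h₁.1
    · exact Finset.mem_erase.2 ⟨hkw, Finset.mem_of_mem_erase hk⟩

end PrimeSeq

namespace SpectralData

variable {K : Type*} [CommRing K] (D : SpectralData K) {ι : Type*} [LinearOrder ι]
variable {B : Type*} [Ring B] [Algebra K B]

/-! ### The expansion over permutations -/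

/-- The products in the expansion of the Sklyanin determinant. -/
def entryProd (M : ℕ → Matrix ι ι B) (m t : ℕ) (p p' : Fin m → ι) : B :=
  (List.ofFn fun k : Fin m => if (k : ℕ) < m / 2 then
    D.sharp (2 * (t + k) + 1) (M (t + k)) (p k) (p' k) else M (t + k) (p k) (p' k)).prod

/-- Adding one entry at each end raises `m / 2` by one and shifts the positions by one, so the inner
entries keep their type, while the new first entry is of the form `s♯` and the new last one is
plain. -/
theorem entryProd_cons_snoc (M : ℕ → Matrix ι ι B) (m t : ℕ) (j k l c : ι) (p p' : Fin m → ι) :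
    D.entryProd M (m + 2) t (Fin.cons j (Fin.snoc p k)) (Fin.snoc (Fin.cons l p') c)
      = D.sharp (2 * t + 1) (M t) j l * (D.entryProd M m (t + 1) p p' * M (t + (m + 1)) k c) := by
  unfold entryProd
  rw [List.ofFn_succ, List.prod_cons, List.ofFn_succ', List.concat_eq_append, List.prod_append,
    List.prod_singleton, ← Fin.cons_snoc_eq_snoc_cons]
  have e1 : ((0 : Fin (m + 2)) : ℕ) < (m + 2) / 2 := by simp only [Fin.val_zero]; omega
  have e2 : ¬ ((Fin.last m).succ : ℕ) < (m + 2) / 2 := by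
    simp only [Fin.val_succ, Fin.val_last]; omega
  rw [if_pos e1, if_neg e2]
  have e3 : ∀ i : Fin m, (i : ℕ) + 1 < (m + 2) / 2 ↔ (i : ℕ) < m / 2 := fun i => by omega
  have e4 : ∀ i : Fin m, t + ((i : ℕ) + 1) = t + 1 + i := fun i => by omega
  simp only [e3, Fin.cons_succ, Fin.snoc_castSucc, Fin.snoc_last, Fin.cons_zero, Fin.val_succ,
    Fin.val_castSucc, Fin.val_last, Fin.val_zero, add_zero]
  simp only [e4]

theorem exists_injective_image_eq {m : ℕ} (I : Finset ι) (h : I.card = m) :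
    ∃ b : Fin m → ι, Function.Injective b ∧ Finset.univ.image b = I :=
  ⟨I.orderEmbOfFin h, (I.orderEmbOfFin h).injective, I.image_orderEmbOfFin_univ h⟩

theorem invNum_cons_of_image {m : ℕ} {a : ι} {p : Fin m → ι} {I : Finset ι}
    (hp : Function.Injective p) (hI : Finset.univ.image p = I.erase a) :
    invNum (Fin.cons a p : Fin (m + 1) → ι) = below I a + invNum p := by
  rw [invNum_cons, card_filter_comp hp hI fun i => i < a, ← below_erase_self, below]

theorem invNum_snoc_of_image {m : ℕ} {a : ι} {p : Fin m → ι} {I : Finset ι}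
    (hp : Function.Injective p) (hI : Finset.univ.image p = I) :
    invNum (Fin.snoc p a : Fin (m + 1) → ι) = invNum p + above I a := by
  rw [invNum_snoc, card_filter_comp hp hI fun i => a < i, above]

theorem antisymRow_ne_zero {m : ℕ} {I : Finset ι} {p : Fin m → ι} (h : D.antisymRow I p ≠ 0) :
    Function.Injective p ∧ Finset.univ.image p = I := by
  by_contra h'
  exact h (if_neg h')

variable [Fintype ι]

/-- The part of `⟨M_t, …⟩` with the last column index `k`, after the last matrix has been split
off. -/
theorem psi_update_snoc {M : ℕ → Matrix ι ι B} (hM : ∀ s, D.Fusion (2 * s + 1) (M s) (M (s + 1)))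
    (m t : ℕ) {I : Finset ι} {b : Fin (m + 1) → ι} (hb : Function.Injective b) {l k : ι}
    (hbI : l ∈ Finset.univ.image b) (hl : l ∈ I) {b' : Fin m → ι}
    (hb' : Function.Injective b')
    (hbI' : Finset.univ.image b' = (Finset.univ.image b).erase l) (hk : ∀ i, b' i ≠ k) :
    (-D.Q) ^ invNum b •
        D.psi (Function.update M (t + (m + 1)) 1) (m + 2) t I (Fin.snoc b k : Fin (m + 2) → ι)
      = ∑ j ∈ I, if k ∈ I.erase j then
          (D.wt I j * (-D.Qi) ^ above ((I.erase j).erase k) k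
              * (-D.Q) ^ below (Finset.univ.image b) l) •
            (D.sharp (2 * t + 1) (M t) j l *
              ((-D.Q) ^ invNum b' • D.psi M m (t + 1) ((I.erase j).erase k) b'))
        else 0 := by
  have hup : ∀ a < t + (m + 1), Function.update M (t + (m + 1)) 1 a = M a := fun a ha =>
    Function.update_of_ne ha.ne _ _
  have hanti := D.isColumnAntisym_psi_snoc (M := Function.update M (t + (m + 1)) 1) (m := m + 1)
    (t := t) (fun i hi => by
      rw [hup _ (by omega), hup _ (by omega)]
      exact hM _) I k
  obtain ⟨hc, hc'⟩ := inj_image_cons_iff.2 ⟨hbI, hb', hbI'⟩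
  -- The column `l` is brought to the front, which creates the power of `-q` counting the columns
  -- below `l`; as `l ∈ I`, the expansion in terms of `sharp` applies.
  rw [← IsColumnAntisym.eq_of_image_eq D hanti hb hc hc', invNum_cons_of_image hb' hbI',
    ← Fin.cons_snoc_eq_snoc_cons, D.psi_cons_of_mem _ _ _ hl, Finset.smul_sum]
  refine Finset.sum_congr rfl fun j _ => ?_
  rw [D.psi_snoc_of_notMem m (t + 1) (by
    rw [show t + 1 + m = t + (m + 1) by omega, Function.update_self]) _ _ _ hk,
    hup t (by omega)]
  split_ifs with h
  · rw [D.psi_congr m (t + 1) (M := M) (fun a ha => hup a (by omega))]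
    simp only [mul_smul_comm, smul_smul]
    congr 1
    ring
  · simp

/-- The expansion of `⟨M_t, …, M_{t+m}⟩` over permutations. -/
theorem psi_eq_sum {M : ℕ → Matrix ι ι B} (hM : ∀ s, D.Fusion (2 * s + 1) (M s) (M (s + 1)))
    (m t : ℕ) {I : Finset ι} {w : ι} (hw : IsGreatest (I : Set ι) w) {b : Fin m → ι}
    (hb : Function.Injective b) (hbI : Finset.univ.image b = I.erase w) (c : ι) :
    (-D.Q) ^ invNum b • D.psi M (m + 1) t I (Fin.snoc b c)
      = ∑ p : Fin (m + 1) → ι,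
        (D.antisymRow I p * (-D.Q) ^ invNum (Fin.init (primeSeq (m + 1) p) : Fin m → ι)) •
          D.entryProd M (m + 1) t p (Fin.snoc (Fin.init (primeSeq (m + 1) p)) c) := by
  -- The induction lowers `m` by two. The last column must stay arbitrary: in the inner contraction
  -- it is an element `e` which need not be the maximum of the inner rows.
  induction m using Nat.strong_induction_on generalizing t I w c with
  | _ m ih =>
  match m, b, hb, hbI, ih with
  | 0, b, hb, hbI, _ =>
    have e0 : ∀ b : Fin 0 → ι, invNum b = 0 := fun b => by simp [invNum]
    simp only [e0, pow_zero, one_smul, mul_one, psi]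
    refine Finset.sum_congr rfl fun p _ => ?_
    rw [D.ang_one M t]
    simp [entryProd]
    rfl
  | 1, b, hb, hbI, _ =>
    have hl : b 0 ∈ I.erase w := by
      rw [← hbI]
      exact Finset.mem_image_of_mem _ (Finset.mem_univ _)
    have e1 : ∀ b : Fin 1 → ι, invNum b = 0 := fun b => by simp [invNum]
    have hbc : (Fin.snoc b c : Fin 2 → ι) = Fin.cons (b 0) (fun _ => c) := by
      ext i
      refine Fin.cases ?_ (fun i => ?_) i
      · rfl
      · rw [Subsingleton.elim i (Fin.last 0)]
        rfl
    simp only [e1, pow_zero, one_smul, mul_one]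
    -- With two rows, `b 0` is the smaller element of `I` and hence the first entry of `p'` for both
    -- orders of `p`; one expansion suffices.
    rw [hbc, D.psi_cons_of_mem M 1 t (Finset.mem_of_mem_erase hl), sum_cons_fun,
      ← Finset.sum_subset (Finset.subset_univ I)]
    · refine Finset.sum_congr rfl fun j hj => ?_
      rw [psi, Finset.mul_sum, Finset.smul_sum]
      refine Finset.sum_congr rfl fun p _ => ?_
      rw [antisymRow_cons, if_pos hj, mul_smul_comm, smul_smul]
      by_cases hz : D.antisymRow (I.erase j) p = 0
      · simp [hz]
      obtain ⟨hp, hpI⟩ := D.antisymRow_ne_zero hz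
      obtain ⟨hp', hpI'⟩ := inj_image_cons_iff.2 ⟨hj, hp, hpI⟩
      obtain ⟨⟨-, h⟩, -⟩ := primeSeq_spec 1 _ hp' hpI' hw
      congr 1
      obtain ⟨i, -, hi⟩ := Finset.mem_image.1 (h ▸ hl)
      rw [Subsingleton.elim i 0] at hi
      have : (Fin.init (primeSeq (1 + 1) (Fin.cons j p : Fin 2 → ι)) : Fin 1 → ι) = b := by
        ext i
        rw [Subsingleton.elim i 0]
        exact hi
      rw [this, ang_one]
      have hb0 : (Fin.snoc b c : Fin 2 → ι) = Fin.snoc (Fin.cons (b 0) Fin.elim0 : Fin 1 → ι) c := by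
        congr 1
        ext i
        rw [Subsingleton.elim i 0]
        rfl
      have hp0 : (Fin.cons j p : Fin 2 → ι) = Fin.cons j (Fin.snoc (Fin.elim0 : Fin 0 → ι) (p 0)) := by
        congr 1
        ext i
        rw [Subsingleton.elim i 0]
        rfl
      rw [hb0, hp0, entryProd_cons_snoc]
      simp [entryProd]
    · intro j _ hj
      refine Finset.sum_eq_zero fun p _ => ?_
      rw [antisymRow_cons, if_neg hj, zero_smul]
  | m + 2, b, hb, hbI, ih =>
    have hup : ∀ a < t + (m + 2), Function.update M (t + (m + 2)) 1 a = M a := fun a ha =>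
      Function.update_of_ne ha.ne _ _
    rw [D.psi_snoc (m + 2) t hup (Function.update_self _ _ _), Finset.smul_sum, sum_cons_fun]
    -- On the right, `p` is cut into its ends `j`, `k` and its middle; `k` is matched with the row
    -- index of the last matrix split off on the left.
    rw [Finset.sum_congr rfl fun j _ => sum_snoc_fun _, Finset.sum_comm]
    refine Finset.sum_congr rfl fun k _ => ?_
    have hcard : I.card = m + 3 := by
      rw [← Finset.card_erase_add_one hw.1, ← hbI, Finset.card_image_of_injective _ hb]
      simp
    rw [← smul_mul_assoc]
    by_cases hk : k ∈ I
    swap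
    · have hkb : ∀ i, b i ≠ k := by
        rintro i rfl
        exact hk (Finset.mem_of_mem_erase (hbI ▸ Finset.mem_image_of_mem _ (Finset.mem_univ i)))
      rw [D.psi_snoc_of_notMem (m + 2) t (Function.update_self _ _ _) _ _ _ hkb, if_neg hk, smul_zero,
        zero_mul]
      refine (Finset.sum_eq_zero fun j _ => Finset.sum_eq_zero fun p _ => ?_).symm
      rw [antisymRow_cons, antisymRow_snoc, if_neg fun h => hk (Finset.mem_of_mem_erase h),
        mul_zero, ite_self, zero_mul, zero_smul]
    obtain ⟨w₁, w₂, hw₁, hw₂⟩ : ∃ w₁ w₂, IsGreatest ((I.erase w : Finset ι) : Set ι) w₁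
        ∧ IsGreatest (((I.erase w).erase w₁ : Finset ι) : Set ι) w₂ := by
      obtain ⟨b', h, h'⟩ := exists_injective_image_eq I hcard
      exact exists_isGreatest_erase h h' hw
    -- Removing `l` from the columns `I.erase w` must leave none equal to `k`. This forces `l = k`
    -- unless `k = w`; in that case any column would do, and `w₁` is the choice made by `pairMap`.
    obtain ⟨l, hlk⟩ : ∃ l, l = if k = w then w₁ else k := ⟨_, rfl⟩
    have hl : l ∈ I.erase w := by
      rw [hlk]
      split_ifs with h
      · exact hw₁.1
      · exact Finset.mem_erase.2 ⟨h, hk⟩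
    obtain ⟨b', hb', hbI'⟩ := exists_injective_image_eq (m := m + 1) ((I.erase w).erase l) (by
      rw [Finset.card_erase_of_mem hl, Finset.card_erase_of_mem hw.1]
      omega)
    have hkb : ∀ i, b' i ≠ k := by
      intro i h
      have : k ∈ (I.erase w).erase l := by
        rw [← h, ← hbI']
        exact Finset.mem_image_of_mem _ (Finset.mem_univ _)
      rw [hlk] at this
      split_ifs at this with h'
      · simp [h'] at this
      · simp at this
    rw [D.psi_update_snoc hM (m + 1) t hb (l := l) (k := k) (by rw [hbI]; exact hl)
      (Finset.mem_of_mem_erase hl) hb' (by rw [hbI', hbI]) hkb, Finset.sum_mul,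
      ← Finset.sum_subset (Finset.subset_univ I)]
    · refine Finset.sum_congr rfl fun j hj => ?_
      split_ifs with hkj
      swap
      · rw [zero_mul]
        refine (Finset.sum_eq_zero fun p _ => ?_).symm
        rw [antisymRow_cons, if_pos hj, antisymRow_snoc, if_neg hkj, mul_zero, zero_mul, zero_smul]
      have hjk := (Finset.ne_of_mem_erase hkj).symm
      have hcard' : ((I.erase j).erase k).card = m + 1 := by
        rw [Finset.card_erase_of_mem hkj, Finset.card_erase_of_mem hj]
        omega
      obtain ⟨w', hw'⟩ : ∃ w', IsGreatest (((I.erase j).erase k : Finset ι) : Set ι) w' :=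
        exists_isGreatest (by omega)
      obtain ⟨s1, s2, s3⟩ := pairMap_spec hw hw₁ hw₂ hj hjk hw'
      rw [← hlk] at s1
      rw [s1] at s3
      -- By `s3` the columns that are left are the remaining rows without their maximum `w'`,
      -- together with `e`. Once `e` is moved to the end, the induction hypothesis applies with `e`
      -- as last column.
      obtain ⟨e, he⟩ : ∃ e, e = (pairMap w w₁ w₂ j k).2 := ⟨_, rfl⟩
      rw [← he] at s2 s3
      obtain ⟨b₂, hb₂, hbI₂⟩ := exists_injective_image_eq (m := m) (((I.erase j).erase k).erase w')
        (by rw [Finset.card_erase_of_mem hw'.1]; omega)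
      obtain ⟨hc, hc'⟩ := inj_image_snoc_iff.2 (⟨Finset.mem_insert_self _ _, hb₂, by
        rw [Finset.erase_insert s2, hbI₂]⟩ : e ∈ insert e (((I.erase j).erase k).erase w') ∧
          Function.Injective b₂ ∧ Finset.univ.image b₂
            = (insert e (((I.erase j).erase k).erase w')).erase e)
      rw [← IsColumnAntisym.eq_of_image_eq D (D.isColumnAntisym_psi (M := M) (m := m + 1) (t := t + 1)
        (fun i _ => hM _) _) hb' hc (by rw [hc', s3, hbI']), invNum_snoc_of_image hb₂ hbI₂, pow_add,
        mul_comm ((-D.Q) ^ invNum b₂), mul_smul ((-D.Q) ^ above _ e), ih m (by omega) (t + 1) hw' hb₂ hbI₂ e, Finset.smul_sum,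
        Finset.mul_sum, Finset.smul_sum, Finset.sum_mul]
      refine Finset.sum_congr rfl fun p _ => ?_
      rw [antisymRow_cons, if_pos hj, antisymRow_snoc, if_pos hkj]
      by_cases hz : D.antisymRow ((I.erase j).erase k) p = 0
      · simp [hz]
      obtain ⟨hp, hpI⟩ := D.antisymRow_ne_zero hz
      obtain ⟨hp1, hpI1⟩ := inj_image_snoc_iff.2 ⟨hkj, hp, hpI⟩
      obtain ⟨hp2, hpI2⟩ := inj_image_cons_iff.2 ⟨hj, hp1, hpI1⟩
      obtain ⟨⟨i1, i2⟩, -⟩ := primeSeq_spec m p hp hpI hw'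
      rw [primeSeq_cons_snoc hp2 hpI2 hw hw₁ hw₂, Fin.init_snoc, s1, ← he, entryProd_cons_snoc]
      obtain ⟨i3, i4⟩ := inj_image_snoc_iff.2 (⟨Finset.mem_insert_self _ _, i1, by
        rw [Finset.erase_insert s2, i2]⟩ : e ∈ insert e (((I.erase j).erase k).erase w') ∧
          Function.Injective (Fin.init (primeSeq (m + 1) p) : Fin m → ι) ∧
          Finset.univ.image (Fin.init (primeSeq (m + 1) p) : Fin m → ι)
            = (insert e (((I.erase j).erase k).erase w')).erase e)
      rw [invNum_cons_of_image i3 (I := I.erase w) (by rw [i4, s3]), invNum_snoc_of_image i1 i2, hbI]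
      simp only [mul_smul_comm, smul_mul_assoc, smul_smul, mul_assoc]
      congr 1
      ring
    · intro j _ hj
      refine Finset.sum_eq_zero fun p _ => ?_
      rw [antisymRow_cons, if_neg hj, zero_mul, zero_smul]

end SpectralData

/-! ### The spectral parameters of the twisted `q`-Yangians -/

theorem RMat_apply (q : ℂ) (N : ℕ) {K : Type*} [CommRing K] [Algebra ℂ K] (u v : K)
    (a b c d : Fin N) :
    RMat q N u v (a, b) (c, d)
      = (if a = c ∧ b = d then (if a = b then q⁻¹ • u - q • v else u - v) else 0)
        + if a = d ∧ b = c then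
            (if b < a then (q⁻¹ - q) • u else if a < b then (q⁻¹ - q) • v else 0) else 0 := by
  have key : ∀ i j k l : Fin N,
      (Matrix.single i j (1 : K) ⊗ₖ Matrix.single k l (1 : K)) (a, b) (c, d)
        = if i = a then (if k = b then (if j = c ∧ l = d then 1 else 0) else 0) else 0 := by
    intro i j k l
    simp only [Matrix.kroneckerMap_apply, Matrix.single_apply]
    grind
  have e2 : ∀ (P : Fin N → Fin N → Prop) [∀ i j, Decidable (P i j)] (t : K),
      (∑ i : Fin N, ∑ j : Fin N, if P i j then
        t • (Matrix.single i j (1 : K) ⊗ₖ Matrix.single j i (1 : K)) else 0) (a, b) (c, d)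
      = if P a b then (if a = d ∧ b = c then t else 0) else 0 := by
    intro P _ t
    simp only [Matrix.sum_apply]
    rw [Finset.sum_eq_single a, Finset.sum_eq_single b]
    · by_cases hP : P a b
      · simp only [if_pos hP, Matrix.smul_apply, key, if_true, smul_eq_mul]
        grind
      · simp [hP]
    · intro j _ hj
      by_cases hP : P a j
      · rw [if_pos hP, Matrix.smul_apply, key]
        simp [hj]
      · simp [hP]
    · simp
    · intro i _ hi
      refine Finset.sum_eq_zero fun j _ => ?_
      by_cases hP : P i j
      · rw [if_pos hP, Matrix.smul_apply, key]
        simp [hi]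
      · simp [hP]
    · simp
  have e0 : (∑ i : Fin N, ∑ j : Fin N, if i ≠ j then
        (u - v) • (Matrix.single i i (1 : K) ⊗ₖ Matrix.single j j (1 : K)) else 0) (a, b) (c, d)
      = if a ≠ b then (if a = c ∧ b = d then u - v else 0) else 0 := by
    simp only [Matrix.sum_apply]
    rw [Finset.sum_eq_single a, Finset.sum_eq_single b]
    · by_cases hP : a ≠ b
      · simp only [if_pos hP, Matrix.smul_apply, key, if_true, smul_eq_mul]
        grind
      · simp [hP]
    · intro j _ hj
      by_cases hP : a ≠ j
      · rw [if_pos hP, Matrix.smul_apply, key]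
        simp [hj]
      · simp [hP]
    · simp
    · intro i _ hi
      refine Finset.sum_eq_zero fun j _ => ?_
      by_cases hP : i ≠ j
      · rw [if_pos hP, Matrix.smul_apply, key]
        simp [hi]
      · simp [hP]
    · simp
  have e1 : (∑ i : Fin N, (q⁻¹ • u - q • v) •
        (Matrix.single i i (1 : K) ⊗ₖ Matrix.single i i (1 : K))) (a, b) (c, d)
      = if a = b then (if a = c ∧ b = d then q⁻¹ • u - q • v else 0) else 0 := by
    simp only [Matrix.sum_apply, Matrix.smul_apply, key, smul_eq_mul, mul_ite, mul_one, mul_zero,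
      Finset.sum_ite_eq', Finset.mem_univ, if_true]
    grind
  unfold RMat
  rw [Matrix.add_apply, Matrix.add_apply, Matrix.add_apply, e0, e1, e2 (fun i j => j < i),
    e2 (fun i j => i < j)]
  rcases lt_trichotomy a b with h | h | h
  · simp [h, h.ne, h.not_gt]
  · simp [h]
  · simp [h, h.ne', h.not_gt]

/-- The spectral parameters `u_a⁻¹ u_b⁻¹ = q^{2a+2b} u⁻²`. -/
def spectralData {q : ℂ} (hq : q ≠ 0) : SpectralData (PowerSeries ℂ) where
  Q := PowerSeries.C q
  Qi := PowerSeries.C q⁻¹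
  y n := q ^ (2 * n) • PowerSeries.X ^ 2
  d n := (q ^ (2 * n) • PowerSeries.X ^ 2 - 1)⁻¹
  hQ := by rw [← map_mul, mul_inv_cancel₀ hq, map_one]
  hy n := by
    rw [← map_pow, ← PowerSeries.smul_eq_C_mul, smul_smul, ← pow_add]
    congr 2
    ring
  hd n := PowerSeries.inv_mul_cancel _ (by simp)

theorem RBarT_eq {q : ℂ} (hq : q ≠ 0) (N n : ℕ) :
    RBarT q N (q ^ (2 * n) • (PowerSeries.X : PowerSeries ℂ) ^ 2) = (spectralData hq).pairR n := by
  have hd := (spectralData hq).hd n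
  ext ⟨a, b⟩ ⟨c, d⟩ : 1
  simp only [RBarT, transpose₁, SpectralData.pairR, SpectralData.locR, Matrix.of_apply,
    Matrix.smul_apply, RMat_apply, SpectralData.gam, smul_eq_mul]
  change (spectralData hq).d n * _ = _
  have hy : q ^ (2 * n) • (PowerSeries.X : PowerSeries ℂ) ^ 2 = (spectralData hq).y n := rfl
  have hQ : (spectralData hq).Q = PowerSeries.C q := rfl
  have hQi : (spectralData hq).Qi = PowerSeries.C q⁻¹ := rfl
  simp only [hy, PowerSeries.smul_eq_C_mul, map_sub, ← hQ, ← hQi]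
  generalize spectralData hq = D at *
  by_cases h1 : c = a
  · subst h1
    by_cases h2 : b = d
    · subst h2
      by_cases h3 : c = b
      · subst h3
        simp
      · simp [h3, hd, Ne.symm h3]
    · by_cases h3 : c = d
      · subst h3
        simp [h2, Ne.symm h2]
      · simp [h2, h3]
  · have h1' : a ≠ c := Ne.symm h1
    by_cases h3 : c = d ∧ b = a
    · obtain ⟨rfl, rfl⟩ := h3
      simp [h1, h1']
      rcases lt_or_gt_of_ne h1 with h | h
      · simp [h, h.not_gt]
      · simp [h]
    · have h3' : ¬ (a = b ∧ c = d) := fun h => h3 ⟨h.2, h.1.symm⟩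
      simp [h1, h1', h3, h3']

variable {A : Type*} [Ring A] [Algebra ℂ A]

/-- The `ℂ[[u⁻¹]]`-algebra of series with coefficients in a `ℂ`-algebra. -/
instance seriesAlgebra : Algebra (PowerSeries ℂ) (PowerSeries A) :=
  RingHom.toAlgebra' (scalarSeries A) fun c x => by
    ext n
    rw [PowerSeries.coeff_mul, PowerSeries.coeff_mul, ← Finset.Nat.sum_antidiagonal_swap]
    refine Finset.sum_congr rfl fun p _ => ?_
    simp only [scalarSeries, PowerSeries.coeff_map, Prod.fst_swap, Prod.snd_swap]
    exact Algebra.commutes _ _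

theorem algebraMap_series : algebraMap (PowerSeries ℂ) (PowerSeries A) = scalarSeries A := rfl

theorem C_smul_series (c : ℂ) (x : PowerSeries A) : PowerSeries.C c • x = c • x := by
  rw [Algebra.smul_def, algebraMap_series, scalarSeries, PowerSeries.map_C]
  ext n
  rw [PowerSeries.coeff_C_mul, PowerSeries.coeff_smul, Algebra.smul_def]

theorem coeff_rescaleArg (c : ℂ) (f : PowerSeries A) (n : ℕ) :
    PowerSeries.coeff n (rescaleArg c f) = c⁻¹ ^ n • PowerSeries.coeff n f :=
  PowerSeries.coeff_mk _ _

theorem rescaleArg_mul (c : ℂ) (f g : PowerSeries A) :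
    rescaleArg c (f * g) = rescaleArg c f * rescaleArg c g := by
  ext n
  rw [coeff_rescaleArg, PowerSeries.coeff_mul, PowerSeries.coeff_mul, Finset.smul_sum]
  refine Finset.sum_congr rfl fun p hp => ?_
  rw [coeff_rescaleArg, coeff_rescaleArg, smul_mul_smul_comm, ← pow_add,
    Finset.HasAntidiagonal.mem_antidiagonal.1 hp]

theorem rescaleArg_add (c : ℂ) (f g : PowerSeries A) :
    rescaleArg c (f + g) = rescaleArg c f + rescaleArg c g := by
  ext n
  simp [coeff_rescaleArg]

theorem rescaleArg_scalarSeries (c : ℂ) (f : PowerSeries ℂ) :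
    rescaleArg c (scalarSeries A f) = scalarSeries A (PowerSeries.rescale c⁻¹ f) := by
  ext n
  simp [coeff_rescaleArg, scalarSeries, Algebra.smul_def]

theorem rescale_C_eq (c b : ℂ) : PowerSeries.rescale c (PowerSeries.C b) = PowerSeries.C b := by
  ext n
  rw [PowerSeries.coeff_rescale, PowerSeries.coeff_C]
  split_ifs with h <;> simp [h]

/-- The matrices `S(u_a)`. -/
def shifted (q : ℂ) {N : ℕ} (S : Matrix (Fin N) (Fin N) (PowerSeries A)) (a : ℕ) :
    Matrix (Fin N) (Fin N) (PowerSeries A) :=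
  S.map (rescaleArg (q ^ (-2 * (a : ℤ))))

/-- The coefficients of `s♯` at `u_a` come from the entries of `R̄ᵗ_{a,a+1}`, whose argument `u_a⁻¹
u_{a+1}⁻¹` is `y (2a + 1)`. -/
theorem rescaleArg_sSharp {q : ℂ} (hq : q ≠ 0) {N : ℕ}
    (S : Matrix (Fin N) (Fin N) (PowerSeries A)) (a : ℕ) (i j : Fin N) :
    rescaleArg (q ^ (-2 * (a : ℤ))) (sSharp q S i j)
      = (spectralData hq).sharp (2 * a + 1) (shifted q S a) i j := by
  have hc : (q ^ (-2 * (a : ℤ)))⁻¹ = q ^ (2 * a) := by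
    rw [neg_mul, zpow_neg, inv_inv]
    norm_cast
  have hz : PowerSeries.rescale (q ^ (2 * a)) (PowerSeries.X ^ 2 : PowerSeries ℂ)
      = q ^ (4 * a) • PowerSeries.X ^ 2 := by
    rw [map_pow, PowerSeries.rescale_X, mul_pow, ← map_pow, ← pow_mul, PowerSeries.smul_eq_C_mul]
    congr 3
    ring
  have hC : ∀ b : ℂ, PowerSeries.rescale (q ^ (2 * a)) (PowerSeries.C b) = PowerSeries.C b :=
    rescale_C_eq _
  have hQ := (spectralData hq).hQ
  have hd := (spectralData hq).hd (2 * a + 1)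
  have hy : (spectralData hq).y (2 * a + 1)
      = PowerSeries.C q ^ 2 * (q ^ (4 * a) • PowerSeries.X ^ 2) := by
    have : (spectralData hq).y (2 * a + 1) = q ^ (2 * (2 * a + 1)) • PowerSeries.X ^ 2 := rfl
    rw [this, ← map_pow, ← PowerSeries.smul_eq_C_mul, smul_smul]
    congr 1
    ring
  -- After rescaling, the denominator `q z² - q⁻¹` is `q⁻¹ (y (2a + 1) - 1)`.
  have hden : PowerSeries.rescale (q ^ (2 * a)) (q • PowerSeries.X ^ 2 - PowerSeries.C q⁻¹)⁻¹
      = (spectralData hq).Q * (spectralData hq).d (2 * a + 1) := by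
    have h1 : (q • PowerSeries.X ^ 2 - PowerSeries.C q⁻¹ : PowerSeries ℂ)⁻¹ *
        (q • PowerSeries.X ^ 2 - PowerSeries.C q⁻¹) = 1 :=
      PowerSeries.inv_mul_cancel _ (by simp [hq])
    have h2 := congrArg (PowerSeries.rescale (q ^ (2 * a))) h1
    rw [map_mul, map_one, map_sub, PowerSeries.smul_eq_C_mul, map_mul, hz, hC, hC] at h2
    rw [← PowerSeries.smul_eq_C_mul, ← PowerSeries.smul_eq_C_mul] at h2
    have h3 : q • (q ^ (4 * a) • PowerSeries.X ^ 2) - PowerSeries.C q⁻¹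
        = (spectralData hq).Qi * ((spectralData hq).y (2 * a + 1) - 1) := by
      have h4 : (spectralData hq).Q * (q ^ (4 * a) • PowerSeries.X ^ 2)
          = q • (q ^ (4 * a) • PowerSeries.X ^ 2) := (PowerSeries.smul_eq_C_mul _ _).symm
      have h5 : (spectralData hq).Qi = PowerSeries.C q⁻¹ := rfl
      have h6 : (spectralData hq).Q = PowerSeries.C q := rfl
      rw [← h5, ← h4, hy, ← h6]
      linear_combination (-(spectralData hq).Q * (q ^ (4 * a) • PowerSeries.X ^ 2)) * hQ
    rw [h3] at h2
    linear_combination ((spectralData hq).Q * (spectralData hq).d (2 * a + 1)) * h2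
      - PowerSeries.rescale (q ^ (2 * a)) (q • PowerSeries.X ^ 2 - PowerSeries.C q⁻¹)⁻¹ *
        ((spectralData hq).d (2 * a + 1) * ((spectralData hq).y (2 * a + 1) - 1)) * hQ
      - PowerSeries.rescale (q ^ (2 * a)) (q • PowerSeries.X ^ 2 - PowerSeries.C q⁻¹)⁻¹ * hd
  have h6 : PowerSeries.C q = (spectralData hq).Q := rfl
  have h7 : PowerSeries.C q⁻¹ = (spectralData hq).Qi := rfl
  have hal : PowerSeries.rescale (q ^ (2 * a)) ((PowerSeries.X ^ 2 - 1) *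
        (q • PowerSeries.X ^ 2 - PowerSeries.C q⁻¹)⁻¹)
      = (spectralData hq).gam (2 * a + 1) i i + 1 := by
    rw [map_mul, hden, map_sub, hz, map_one, SpectralData.gam, if_pos rfl, hy, h6]
    linear_combination (-(spectralData hq).d (2 * a + 1) * (spectralData hq).Q *
      (q ^ (4 * a) • PowerSeries.X ^ 2)) * hQ
  have hlt : PowerSeries.rescale (q ^ (2 * a)) (((q - q⁻¹) • PowerSeries.X ^ 2) *
        (q • PowerSeries.X ^ 2 - PowerSeries.C q⁻¹)⁻¹)
      = (spectralData hq).d (2 * a + 1) *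
        (((spectralData hq).Qi - (spectralData hq).Q) * (spectralData hq).y (2 * a + 1))
          * -(spectralData hq).Qi := by
    rw [map_mul, hden, PowerSeries.smul_eq_C_mul, map_mul, hz, hC, map_sub, hy, h6, h7]
    linear_combination ((spectralData hq).d (2 * a + 1) * (spectralData hq).Q *
      (q ^ (4 * a) • PowerSeries.X ^ 2) * ((spectralData hq).Qi - (spectralData hq).Q)) * hQ
  have hgt : PowerSeries.rescale (q ^ (2 * a)) (PowerSeries.C (q - q⁻¹) *
        (q • PowerSeries.X ^ 2 - PowerSeries.C q⁻¹)⁻¹)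
      = (spectralData hq).d (2 * a + 1) * ((spectralData hq).Qi - (spectralData hq).Q)
          * -(spectralData hq).Q := by
    rw [map_mul, hden, hC, map_sub, h6, h7]
    ring
  unfold sSharp SpectralData.sharp
  by_cases hij : i = j
  · simp [hij, shifted]
  rw [if_neg hij, if_neg hij, ← hal]
  simp only [SpectralData.gam, if_neg hij]
  split_ifs with h
  · rw [rescaleArg_add, rescaleArg_mul, rescaleArg_mul, rescaleArg_scalarSeries,
      rescaleArg_scalarSeries, hc, hlt, Algebra.smul_def, Algebra.smul_def]
    rfl
  · rw [rescaleArg_add, rescaleArg_mul, rescaleArg_mul, rescaleArg_scalarSeries,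
      rescaleArg_scalarSeries, hc, hgt, Algebra.smul_def, Algebra.smul_def]
    rfl

/-! ### Insertion of a tensor factor -/

section InsertSite

variable {N m : ℕ} {B : Type*} [Semiring B]

/-- The operator `X` acting in all tensor factors but the one with index `i`. -/
def insertSite (i : Fin (m + 1)) (X : Matrix (Fin m → Fin N) (Fin m → Fin N) B) :
    Matrix (Fin (m + 1) → Fin N) (Fin (m + 1) → Fin N) B :=
  Matrix.of fun x y => if x i = y i then X (i.removeNth x) (i.removeNth y) else 0

theorem insertSite_one (i : Fin (m + 1)) :
    insertSite i (1 : Matrix (Fin m → Fin N) (Fin m → Fin N) B) = 1 := by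
  ext x y
  have : x = y ↔ x i = y i ∧ i.removeNth x = i.removeNth y := by
    rw [funext_iff, Fin.forall_iff_succAbove i, funext_iff]
    rfl
  simp only [insertSite, Matrix.of_apply, Matrix.one_apply, this]
  split_ifs <;> tauto

theorem insertSite_mul (i : Fin (m + 1)) (X Y : Matrix (Fin m → Fin N) (Fin m → Fin N) B) :
    insertSite i (X * Y) = insertSite i X * insertSite i Y := by
  ext x y
  rw [Matrix.mul_apply, ← (Fin.insertNthEquiv (fun _ => Fin N) i).sum_comp, Fintype.sum_prod_type]
  have e : ∀ (k : Fin N) (z : Fin m → Fin N),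
      i.removeNth ((Fin.insertNthEquiv (fun _ => Fin N) i) (k, z)) = z := fun k z =>
    Fin.removeNth_insertNth (α := fun _ => Fin N) i k z
  simp only [insertSite, Matrix.of_apply, Fin.insertNthEquiv_apply, Fin.insertNth_apply_same, e]
  rw [Finset.sum_eq_single (x i)]
  · by_cases h : x i = y i
    · simp only [h, if_true, Matrix.mul_apply]
    · simp [h]
  · intro k _ hk
    simp [Ne.symm hk]
  · simp

theorem insertSite_list_prod (i : Fin (m + 1))
    (l : List (Matrix (Fin m → Fin N) (Fin m → Fin N) B)) :
    insertSite i l.prod = (l.map (insertSite i)).prod := by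
  induction l with
  | nil => exact insertSite_one i
  | cons X l ih => rw [List.prod_cons, insertSite_mul, ih, List.map_cons, List.prod_cons]

theorem insertSite_atSite (i : Fin (m + 1)) (a : Fin m) (X : Matrix (Fin N) (Fin N) B) :
    insertSite i (atSite a X) = atSite (i.succAbove a) X := by
  ext x y
  simp only [insertSite, atSite, Matrix.of_apply]
  rw [← ite_and]
  refine if_congr ?_ rfl rfl
  rw [Fin.forall_iff_succAbove i]
  simp [(Fin.succAbove_ne i a).symm, Fin.removeNth_apply]

theorem insertSite_atPair (i : Fin (m + 1)) (a b : Fin m)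
    (X : Matrix (Fin N × Fin N) (Fin N × Fin N) B) :
    insertSite i (atPair a b X) = atPair (i.succAbove a) (i.succAbove b) X := by
  ext x y
  simp only [insertSite, atPair, Matrix.of_apply]
  rw [← ite_and]
  refine if_congr ?_ rfl rfl
  rw [Fin.forall_iff_succAbove i]
  simp [(Fin.succAbove_ne i a).symm, (Fin.succAbove_ne i b).symm, Fin.removeNth_apply]

theorem insertSite_map {B' : Type*} [Semiring B'] (f : B' →+* B) (i : Fin (m + 1))
    (X : Matrix (Fin m → Fin N) (Fin m → Fin N) B') :
    insertSite i (X.map f) = (insertSite i X).map f := by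
  ext x y
  simp only [insertSite, Matrix.of_apply, Matrix.map_apply]
  split_ifs <;> simp

theorem insertSite_zero_cons (X : Matrix (Fin m → Fin N) (Fin m → Fin N) B) (a b : Fin N)
    (r c : Fin m → Fin N) :
    insertSite 0 X (Fin.cons a r) (Fin.cons b c) = if a = b then X r c else 0 := rfl

theorem removeNth_one_cons_cons {α : Type*} (k a : α) (r : Fin m → α) :
    (1 : Fin (m + 2)).removeNth (Fin.cons k (Fin.cons a r) : Fin (m + 2) → α) = Fin.cons k r := by
  ext i
  refine Fin.cases ?_ (fun i => ?_) i
  · rfl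
  · rw [Fin.removeNth_apply, Fin.cons_succ, show (1 : Fin (m + 2)) = Fin.succ 0 from rfl,
      Fin.succ_succAbove_succ, Fin.cons_succ, Fin.zero_succAbove, Fin.cons_succ]

theorem atPair_zero_one_cons (X : Matrix (Fin N × Fin N) (Fin N × Fin N) B) (k a k' a' : Fin N)
    (r r' : Fin m → Fin N) :
    atPair 0 1 X (Fin.cons k (Fin.cons a r) : Fin (m + 2) → Fin N) (Fin.cons k' (Fin.cons a' r'))
      = if r = r' then X (k, a) (k', a') else 0 := by
  simp only [atPair, Matrix.of_apply]
  refine if_congr ?_ rfl rfl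
  rw [Fin.forall_fin_succ, Fin.forall_fin_succ, funext_iff]
  simp [Fin.ext_iff]

theorem atSite_zero_cons (X : Matrix (Fin N) (Fin N) B) (a b : Fin N) (r c : Fin m → Fin N) :
    atSite 0 X (Fin.cons a r : Fin (m + 1) → Fin N) (Fin.cons b c)
      = if r = c then X a b else 0 := by
  simp only [atSite, Matrix.of_apply]
  refine if_congr ?_ rfl rfl
  rw [Fin.forall_fin_succ, funext_iff]
  simp

end InsertSite

namespace SpectralData

variable {K : Type*} [CommRing K] (D : SpectralData K) {N : ℕ}

/-- The products `R̄ᵗ_{01} ⋯ R̄ᵗ_{0m}` in terms of their entries. -/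
theorem prod_atPair_apply (m n : ℕ) (k l : Fin N) (r r' : Fin m → Fin N) :
    ((List.finRange m).map fun b : Fin m => atPair 0 b.succ (D.pairR (n + b))).prod
      (Fin.cons k r : Fin (m + 1) → Fin N) (Fin.cons l r') = D.mono m n r r' k l := by
  induction m generalizing n k l with
  | zero =>
    rw [Subsingleton.elim r r']
    simp only [List.finRange_zero, List.map_nil, List.prod_nil, mono, Matrix.one_apply,
      Fin.cons_inj, and_true]
  | succ m ih =>
    rw [← Fin.cons_self_tail r, ← Fin.cons_self_tail r', mono_cons_cons, List.finRange_succ,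
      List.map_cons, List.map_map, List.prod_cons]
    -- All R-matrices but the first leave site `1` alone, so they are insertions of the shorter
    -- product at that site.
    have h : ((fun b : Fin (m + 1) => atPair (N := N) 0 b.succ (D.pairR (n + b))) ∘ Fin.succ)
        = fun b : Fin m => insertSite 1 (atPair 0 b.succ (D.pairR (n + 1 + b))) := by
      ext1 b
      rw [insertSite_atPair, Function.comp_apply, show (1 : Fin (m + 2)) = Fin.succ 0 from rfl,
        Fin.succ_succAbove_succ, Fin.succ_succAbove_zero, Fin.zero_succAbove, Fin.val_succ,
        show n + ((b : ℕ) + 1) = n + 1 + b by omega]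
    rw [h, ← Function.comp_def (insertSite 1), ← List.map_map, ← insertSite_list_prod,
      Matrix.mul_apply, Matrix.mul_apply, sum_cons_fun]
    refine Finset.sum_congr rfl fun k' _ => ?_
    rw [sum_cons_fun, Finset.sum_eq_single (r' 0), Finset.sum_eq_single (Fin.tail r)]
    · have e := atPair_zero_one_cons (D.pairR (ι := Fin N) n) k (r 0) k' (r' 0) (Fin.tail r) (Fin.tail r)
      rw [if_pos rfl] at e
      change atPair 0 1 (D.pairR (n + 0)) _ _ * _ = _
      rw [add_zero, e]
      simp only [insertSite, Matrix.of_apply, removeNth_one_cons_cons]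
      rw [ih]
      exact congrArg _ (if_pos rfl)
    · intro s _ hs
      have e := atPair_zero_one_cons (D.pairR (ι := Fin N) n) k (r 0) k' (r' 0) (Fin.tail r) s
      rw [if_neg hs.symm] at e
      change atPair 0 1 (D.pairR (n + 0)) _ _ * _ = _
      rw [add_zero, e, zero_mul]
    · simp
    · intro a _ ha
      refine Finset.sum_eq_zero fun s _ => ?_
      rw [insertSite, Matrix.of_apply, if_neg (by exact ha), mul_zero]
    · simp

variable {B : Type*} [Ring B] [Algebra K B]

/-- The products `⟨M_t, …, M_{t+m-1}⟩` are the entries of a product of matrices. -/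
theorem prod_atSite_apply (M : ℕ → Matrix (Fin N) (Fin N) B) (m t : ℕ) (r c : Fin m → Fin N) :
    (((List.finRange m).map fun a : Fin m =>
      atSite a (M (t + a)) * (((List.finRange m).filter fun b => a < b).map fun b =>
        (atPair a b (D.pairR (2 * t + a + b))).map (algebraMap K B)).prod).prod : Matrix (Fin m → Fin N) (Fin m → Fin N) B) r c
      = D.ang M m t r c := by
  induction m generalizing t with
  | zero =>
    rw [Subsingleton.elim r c]
    simp [ang]
  | succ m ih =>
    rw [← Fin.cons_self_tail r, ← Fin.cons_self_tail c, ang_cons_cons, List.finRange_succ,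
      List.map_cons, List.map_map, List.prod_cons]
    -- The blocks after the first do not act in site `0`; raising both site indices by one is
    -- absorbed by `t ↦ t + 1`.
    have h : ((fun a : Fin (m + 1) => atSite a (M (t + a)) *
        (((0 :: (List.finRange m).map Fin.succ).filter fun b => a < b).map fun b =>
          (atPair a b (D.pairR (ι := Fin N) (2 * t + a + b))).map (algebraMap K B)).prod) ∘ Fin.succ)
        = fun a : Fin m => insertSite 0 (atSite a (M (t + 1 + a)) *
            (((List.finRange m).filter fun b => a < b).map fun b =>
              (atPair a b (D.pairR (2 * (t + 1) + a + b))).map (algebraMap K B)).prod) := by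
      ext1 a
      have hf : ((fun b : Fin (m + 1) => decide (a.succ < b)) ∘ Fin.succ)
          = fun b => decide (a < b) := by
        ext1 b
        simp
      rw [Function.comp_apply, List.filter_cons_of_neg (by simp), List.filter_map, List.map_map, hf,
        insertSite_mul, insertSite_atSite, insertSite_list_prod, List.map_map, Fin.zero_succAbove,
        Fin.val_succ, show t + ((a : ℕ) + 1) = t + 1 + a by omega]
      congr 3
      ext1 b
      rw [Function.comp_apply, Function.comp_apply, insertSite_map, insertSite_atPair,
        Fin.zero_succAbove, Fin.zero_succAbove, Fin.val_succ,
        show 2 * t + ((a : ℕ) + 1) + (b + 1) = 2 * (t + 1) + a + b by omega]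
    have h0 : (((0 :: (List.finRange m).map Fin.succ).filter fun b => (0 : Fin (m + 1)) < b).map
          fun b => (atPair 0 b (D.pairR (ι := Fin N) (2 * t + (0 : Fin (m + 1)) + b))).map
            (algebraMap K B)).prod
        = (((List.finRange m).map fun b : Fin m =>
            atPair 0 b.succ (D.pairR (ι := Fin N) (2 * t + 1 + b))).prod).map
            (algebraMap K B) := by
      have hf : ((fun b : Fin (m + 1) => decide (0 < b)) ∘ Fin.succ) = fun _ : Fin m => true := by
        ext1 b
        simp
      rw [List.filter_cons_of_neg (by simp), List.filter_map, List.map_map, hf, List.filter_true,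
        ← RingHom.mapMatrix_apply, map_list_prod, List.map_map]
      congr 2
      ext1 b
      rw [Function.comp_apply, Function.comp_apply, RingHom.mapMatrix_apply, Fin.val_succ,
        Fin.val_zero, show 2 * t + 0 + ((b : ℕ) + 1) = 2 * t + 1 + b by omega]
    rw [h, h0, ← Function.comp_def (insertSite 0), ← List.map_map, ← insertSite_list_prod,
      Matrix.mul_apply, sum_cons_fun, Finset.sum_eq_single (c 0)]
    · refine Finset.sum_congr rfl fun r' _ => ?_
      rw [insertSite_zero_cons, if_pos rfl, ih, Matrix.mul_apply, sum_cons_fun, Finset.sum_mul]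
      refine Finset.sum_congr rfl fun k _ => ?_
      rw [Finset.sum_eq_single (Fin.tail r)]
      · rw [atSite_zero_cons, if_pos rfl, Matrix.map_apply, prod_atPair_apply, Algebra.smul_def,
          ← mul_assoc, Algebra.commutes]
        rfl
      · intro s _ hs
        rw [atSite_zero_cons, if_neg hs.symm, zero_mul]
      · simp
    · intro a _ ha
      refine Finset.sum_eq_zero fun s _ => ?_
      rw [insertSite_zero_cons, if_neg ha, mul_zero]
    · simp

end SpectralData

/-! ### The Sklyanin determinant as a contraction -/

variable {A : Type*} [Ring A] [Algebra ℂ A]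

theorem angleProd_apply {q : ℂ} (hq : q ≠ 0) {N : ℕ} (m : ℕ)
    (S : Matrix (Fin N) (Fin N) (PowerSeries A)) (r c : Fin m → Fin N) :
    angleProd q m S r c = (spectralData hq).ang (shifted q S) m 0 r c := by
  rw [← SpectralData.prod_atSite_apply, angleProd]
  have h : ∀ a b : Fin m, RBarT q N (q ^ (2 * (a : ℕ) + 2 * (b : ℕ)) • PowerSeries.X ^ 2)
      = (spectralData hq).pairR (2 * 0 + (a : ℕ) + b) := fun a b => by
    rw [← RBarT_eq, show 2 * (2 * 0 + (a : ℕ) + b) = 2 * a + 2 * b by ring]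
  simp only [h, zero_add, shifted, algebraMap_series]

theorem sign_eq_neg_one_pow_invNum {m : ℕ} (σ : Equiv.Perm (Fin m)) :
    ((Equiv.Perm.sign σ : ℤ) : ℂ) = (-1) ^ invNum σ := by
  rw [Equiv.Perm.sign_eq_prod_prod_Ioi, invNum_eq_sum, ← Finset.prod_pow_eq_pow_sum]
  push_cast
  refine Finset.prod_congr rfl fun i _ => ?_
  rw [← Finset.prod_pow_eq_pow_sum, ← Finset.prod_subset (Finset.subset_univ (Finset.Ioi i))]
  · refine Finset.prod_congr rfl fun j hj => ?_
    have hij := Finset.mem_Ioi.1 hj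
    rcases lt_or_gt_of_ne (σ.injective.ne hij.ne) with h | h
    · simp [h, h.not_gt]
    · simp [h, h.not_gt, hij]
  · intro j _ hj
    rw [Finset.mem_Ioi] at hj
    simp [hj]

/-- In the row of the identity sequence only `σ = r` contributes, with value `sgn(σ) q^{-l(σ)} =
(-q)^{-l(σ)}`. -/
theorem factorial_mul_qAntisymmetrizer_apply {q : ℂ} (hq : q ≠ 0) {N : ℕ} (r : Fin N → Fin N) :
    PowerSeries.C ((N.factorial : ℂ) * qAntisymmetrizer q N N id r)
      = (spectralData hq).antisymRow Finset.univ r := by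
  have h0 : invNum (id : Fin N → Fin N) = 0 := by
    rw [invNum, Finset.card_eq_zero, Finset.filter_eq_empty_iff]
    rintro ⟨a, b⟩ - ⟨h, h'⟩
    exact lt_asymm h h'
  rw [qAntisymmetrizer, Matrix.smul_apply, smul_eq_mul, mul_inv_cancel_left₀
    (Nat.cast_ne_zero.2 N.factorial_ne_zero), Matrix.sum_apply]
  simp only [Matrix.smul_apply, qPerm, Matrix.of_apply, smul_eq_mul, h0]
  by_cases hr : Function.Injective r
  · obtain ⟨σ, rfl⟩ : ∃ σ : Equiv.Perm (Fin N), σ = r :=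
      ⟨Equiv.ofBijective r (Finite.injective_iff_bijective.1 hr), rfl⟩
    have e : (spectralData hq).antisymRow Finset.univ σ
        = (-(spectralData hq).Qi) ^ invNum σ :=
      if_pos ⟨hr, Finset.image_univ_of_surjective σ.surjective⟩
    have e' : (spectralData hq).Qi = PowerSeries.C q⁻¹ := rfl
    rw [e, e', Finset.sum_eq_single σ, if_pos, sign_eq_neg_one_pow_invNum, ← map_neg, ← map_pow,
      neg_pow q⁻¹, Nat.cast_zero, zero_sub, zpow_neg, zpow_natCast, inv_pow]
    · ext i
      simp
    · intro τ _ hτ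
      rw [if_neg, mul_zero]
      intro h
      apply hτ
      ext i
      have := congrFun h (τ i)
      simp at this
      rw [this]
    · simp
  · rw [Finset.sum_eq_zero, map_zero]
    · exact (if_neg fun h => hr h.1).symm
    · intro σ _
      rw [if_neg, mul_zero]
      intro h
      apply hr
      intro i j hij
      have h1 := congrFun h (σ i)
      have h2 := congrFun h (σ j)
      simp at h1 h2
      rw [hij, ← h2] at h1
      exact σ.injective h1

theorem sdet_eq_psi {q : ℂ} (hq : q ≠ 0) {N : ℕ} (S : Matrix (Fin N) (Fin N) (PowerSeries A)) :
    sdet q S = (spectralData hq).psi (shifted q S) N 0 Finset.univ id := by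
  rw [sdet, minor, Matrix.mul_apply, Finset.smul_sum, SpectralData.psi]
  refine Finset.sum_congr rfl fun r _ => ?_
  rw [angleProd_apply hq, Matrix.map_apply, ← factorial_mul_qAntisymmetrizer_apply hq,
    ← algebraMap_series, ← Algebra.smul_def, map_mul, mul_smul, C_smul_series (N.factorial : ℂ)]

theorem sum_antisymRow_smul {K : Type*} [CommRing K] (D : SpectralData K) {B : Type*} [Ring B]
    [Algebra K B] {N : ℕ} (f : (Fin N → Fin N) → B) :
    ∑ r, D.antisymRow Finset.univ r • f r
      = ∑ σ : Equiv.Perm (Fin N), (-D.Qi) ^ invNum σ • f σ := by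
  symm
  refine Finset.sum_of_injOn (fun σ : Equiv.Perm (Fin N) => (σ : Fin N → Fin N))
    (DFunLike.coe_injective.injOn) (fun _ _ => Finset.mem_coe.2 (Finset.mem_univ _)) ?_ ?_
  · intro r _ hr
    rw [SpectralData.antisymRow, if_neg, zero_smul]
    rintro ⟨h, -⟩
    exact hr ⟨Equiv.ofBijective r (Finite.injective_iff_bijective.1 h), by simp, rfl⟩
  · intro σ _
    rw [SpectralData.antisymRow,
      if_pos ⟨σ.injective, Finset.image_univ_of_surjective σ.surjective⟩]

theorem isGreatest_univ_last (m : ℕ) :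
    IsGreatest ((Finset.univ : Finset (Fin (m + 1))) : Set (Fin (m + 1))) (Fin.last m) :=
  ⟨Finset.mem_coe.2 (Finset.mem_univ _), fun i _ => Fin.le_last i⟩

/-- The expansion of the Sklyanin determinant for a matrix satisfying the fusion relations. -/
theorem sdet_eq_sum_of_fusion {q : ℂ} (hq : q ≠ 0) {N : ℕ}
    {S : Matrix (Fin N) (Fin N) (PowerSeries A)}
    (hS : ∀ a, (spectralData hq).Fusion (2 * a + 1) (shifted q S a) (shifted q S (a + 1))) :
    sdet q S = ∑ p : Equiv.Perm (Fin N),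
      (-q) ^ ((invNum (primePerm p) : ℤ) - (invNum p : ℤ)) •
        (List.ofFn fun k : Fin N => rescaleArg (q ^ (-2 * ((k : ℕ) : ℤ)))
          (if (k : ℕ) < N / 2 then sSharp q S (p k) (primePerm p k)
            else S (p k) (primePerm p k))).prod := by
  have hprod : ∀ p : Equiv.Perm (Fin N),
      (List.ofFn fun k : Fin N => rescaleArg (q ^ (-2 * ((k : ℕ) : ℤ)))
          (if (k : ℕ) < N / 2 then sSharp q S (p k) (primePerm p k)
            else S (p k) (primePerm p k))).prod
        = (spectralData hq).entryProd (shifted q S) N 0 p (primePerm p) := by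
    intro p
    rw [SpectralData.entryProd]
    congr 2
    ext1 k
    simp only [zero_add]
    split_ifs
    · exact rescaleArg_sSharp hq S k _ _
    · rfl
  simp only [hprod]
  rw [sdet_eq_psi hq]
  cases N with
  | zero =>
    rw [SpectralData.psi, sum_antisymRow_smul]
    refine Finset.sum_congr rfl fun p _ => ?_
    have e0 : ∀ b : Fin 0 → Fin 0, invNum b = 0 := fun b => by simp [invNum]
    simp [e0, SpectralData.ang, SpectralData.entryProd]
  | succ m =>
    have hid : (id : Fin (m + 1) → Fin (m + 1)) = Fin.snoc Fin.castSucc (Fin.last m) := by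
      ext1 i
      refine Fin.lastCases ?_ (fun i => ?_) i <;> simp
    have hinj : Function.Injective (Fin.castSucc : Fin m → Fin (m + 1)) :=
      Fin.castSucc_injective m
    have him : Finset.univ.image (Fin.castSucc : Fin m → Fin (m + 1))
        = Finset.univ.erase (Fin.last m) := by
      ext i
      refine Fin.lastCases ?_ (fun i => ?_) i <;> simp [Fin.castSucc_ne_last]
    have h0 : invNum (Fin.castSucc : Fin m → Fin (m + 1)) = 0 := by
      rw [invNum, Finset.card_eq_zero, Finset.filter_eq_empty_iff]
      rintro ⟨a, b⟩ - ⟨h, h'⟩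
      exact lt_asymm h (Fin.castSucc_lt_castSucc_iff.1 h')
    have key := (spectralData hq).psi_eq_sum hS m 0 (isGreatest_univ_last m) hinj him (Fin.last m)
    rw [h0, pow_zero, one_smul, ← hid] at key
    simp only [mul_smul] at key
    rw [key, sum_antisymRow_smul]
    refine Finset.sum_congr rfl fun p _ => ?_
    obtain ⟨⟨h1, h2⟩, h3⟩ := primeSeq_spec m p p.injective
      (Finset.image_univ_of_surjective p.surjective) (isGreatest_univ_last m)
    have h4 : (Fin.snoc (Fin.init (primeSeq (m + 1) p)) (Fin.last m) : Fin (m + 1) → Fin (m + 1))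
        = primePerm p := by
      conv_lhs => rw [← h3]
      exact Fin.snoc_init_self _
    -- The last entry of `p'` is the largest index and forms no inversion.
    have h5 : invNum (primePerm p)
        = invNum (Fin.init (primeSeq (m + 1) p) : Fin m → Fin (m + 1)) := by
      rw [← h4, SpectralData.invNum_snoc_of_image h1 h2, above, Finset.card_eq_zero.2, add_zero]
      rw [Finset.filter_eq_empty_iff]
      exact fun i _ => (Fin.le_last i).not_gt
    have hQ : (spectralData hq).Q = PowerSeries.C q := rfl
    have hQi : (spectralData hq).Qi = PowerSeries.C q⁻¹ := rfl
    rw [h4, h5, smul_smul, hQ, hQi, ← map_neg, ← map_neg, ← map_pow, ← map_pow, ← map_mul,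
      C_smul_series, zpow_sub₀ (neg_ne_zero.2 hq), zpow_natCast, zpow_natCast, neg_inv, inv_pow,
      div_eq_mul_inv, mul_comm]

/-! ### Specialization of series in two variables -/

section EvalSeries

variable {F : Type*} [Ring F] [Algebra ℂ F]

/-- The exponents `d` with `d 0 + d 1 = n`. -/
def exponents (n : ℕ) : Finset (Fin 2 →₀ ℕ) := Finset.finsuppAntidiag Finset.univ n

theorem mem_exponents {n : ℕ} {d : Fin 2 →₀ ℕ} : d ∈ exponents n ↔ d 0 + d 1 = n := by
  simp [exponents, Finset.mem_finsuppAntidiag, Fin.sum_univ_two]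

/-- The monomial `c₀^{d₀} c₁^{d₁}`. -/
def evalMonomial (c : Fin 2 → ℂ) (d : Fin 2 →₀ ℕ) : ℂ := c 0 ^ d 0 * c 1 ^ d 1

theorem evalMonomial_add (c : Fin 2 → ℂ) (d e : Fin 2 →₀ ℕ) :
    evalMonomial c (d + e) = evalMonomial c d * evalMonomial c e := by
  simp only [evalMonomial, Finsupp.add_apply, pow_add]
  ring

/-- The substitution `z₀ ↦ c₀ z`, `z₁ ↦ c₁ z`. -/
def evalSeries (c : Fin 2 → ℂ) : MvPowerSeries (Fin 2) F →+* PowerSeries F where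
  toFun f := PowerSeries.mk fun n => ∑ d ∈ exponents n, evalMonomial c d • MvPowerSeries.coeff d f
  map_zero' := by
    ext n
    simp
  map_add' f g := by
    ext n
    simp [Finset.sum_add_distrib]
  map_one' := by
    ext n
    rw [PowerSeries.coeff_mk, PowerSeries.coeff_one]
    simp only [MvPowerSeries.coeff_one, smul_ite, smul_zero]
    rw [Finset.sum_ite_eq']
    by_cases h : n = 0
    · rw [if_pos (mem_exponents.2 (by simp [h])), if_pos h]
      simp [evalMonomial]
    · rw [if_neg (fun h' => h (by simpa using (mem_exponents.1 h').symm)), if_neg h]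
  map_mul' f g := by
    ext n
    rw [PowerSeries.coeff_mk, PowerSeries.coeff_mul]
    simp only [PowerSeries.coeff_mk, MvPowerSeries.coeff_mul, Finset.smul_sum,
      Finset.sum_mul_sum, ← Finset.sum_product']
    rw [Finset.sum_sigma', Finset.sum_sigma']
    -- A pair of exponents is grouped either by its sum or by its two total degrees.
    refine Finset.sum_bij' (fun x _ => ⟨(x.2.1 0 + x.2.1 1, x.2.2 0 + x.2.2 1), x.2⟩)
      (fun x _ => ⟨x.2.1 + x.2.2, x.2⟩) ?_ ?_ ?_ ?_ ?_
    · rintro ⟨d, a, b⟩ h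
      simp only [Finset.mem_sigma, mem_exponents, Finset.HasAntidiagonal.mem_antidiagonal,
        Finset.mem_product] at h ⊢
      obtain ⟨h, rfl⟩ := h
      simp only [Finsupp.add_apply] at h
      refine ⟨?_, trivial, trivial⟩
      omega
    · rintro ⟨⟨k, l⟩, a, b⟩ h
      simp only [Finset.mem_sigma, mem_exponents, Finset.HasAntidiagonal.mem_antidiagonal,
        Finset.mem_product, Finsupp.add_apply, and_true] at h ⊢
      omega
    · rintro ⟨d, a, b⟩ h
      simp only [Finset.mem_sigma, Finset.HasAntidiagonal.mem_antidiagonal] at h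
      simp [h.2]
    · rintro ⟨⟨k, l⟩, a, b⟩ h
      simp only [Finset.mem_sigma, mem_exponents, Finset.mem_product] at h
      simp [h.2.1, h.2.2]
    · rintro ⟨d, a, b⟩ h
      simp only [Finset.mem_sigma, Finset.HasAntidiagonal.mem_antidiagonal] at h
      rw [← h.2, evalMonomial_add, smul_mul_smul_comm]

theorem coeff_evalSeries (c : Fin 2 → ℂ) (f : MvPowerSeries (Fin 2) F) (n : ℕ) :
    PowerSeries.coeff n (evalSeries c f)
      = ∑ d ∈ exponents n, evalMonomial c d • MvPowerSeries.coeff d f :=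
  PowerSeries.coeff_mk n fun n => ∑ d ∈ exponents n, evalMonomial c d • MvPowerSeries.coeff d f

theorem evalSeries_map (c : Fin 2 → ℂ) (f : MvPowerSeries (Fin 2) ℂ) :
    evalSeries c (MvPowerSeries.map (algebraMap ℂ F) f) = scalarSeries F (evalSeries c f) := by
  ext n
  simp only [coeff_evalSeries, scalarSeries, PowerSeries.coeff_map, map_sum,
    MvPowerSeries.coeff_map, smul_eq_mul, map_mul, Algebra.smul_def]

theorem evalSeries_smul (c : Fin 2 → ℂ) (b : ℂ) (f : MvPowerSeries (Fin 2) ℂ) :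
    evalSeries c (b • f) = b • evalSeries c f := by
  ext n
  rw [PowerSeries.coeff_smul, coeff_evalSeries, coeff_evalSeries, Finset.smul_sum]
  refine Finset.sum_congr rfl fun d _ => ?_
  rw [MvPowerSeries.coeff_smul, smul_eq_mul, smul_eq_mul, smul_eq_mul]
  ring

theorem evalSeries_single (c : Fin 2 → ℂ) (k : Fin 2) (g : ℕ → F)
    (f : MvPowerSeries (Fin 2) F) (hf : ∀ d, MvPowerSeries.coeff d f
      = if d = Finsupp.single k (d k) then g (d k) else 0) :
    evalSeries c f = PowerSeries.mk fun n => c k ^ n • g n := by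
  ext n
  rw [coeff_evalSeries, PowerSeries.coeff_mk, Finset.sum_eq_single (Finsupp.single k n)]
  · rw [hf, Finsupp.single_eq_same, if_pos rfl]
    congr 1
    fin_cases k <;> simp [evalMonomial]
  · intro d hd hne
    rw [hf, if_neg, smul_zero]
    intro h
    apply hne
    rw [h]
    have := mem_exponents.1 hd
    rw [h] at this
    congr 1
    fin_cases k <;> simpa using this
  · intro h
    exfalso
    apply h
    rw [mem_exponents]
    fin_cases k <;> simp

theorem evalSeries_X (c : Fin 2 → ℂ) (k : Fin 2) :
    evalSeries c (MvPowerSeries.X k : MvPowerSeries (Fin 2) ℂ) = c k • PowerSeries.X := by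
  rw [evalSeries_single c k (fun n => if n = 1 then 1 else 0)]
  · ext n
    rw [PowerSeries.coeff_mk, PowerSeries.coeff_smul, PowerSeries.coeff_X]
    split_ifs with h <;> simp [h]
  · intro d
    rw [MvPowerSeries.coeff_X]
    by_cases h : d = Finsupp.single k (d k)
    · rw [if_pos h]
      refine if_congr ⟨fun h' => by rw [h', Finsupp.single_eq_same], fun h' => ?_⟩ rfl rfl
      rw [h, h']
    · rw [if_neg h, if_neg]
      intro h'
      apply h
      rw [h', Finsupp.single_eq_same]

end EvalSeries

/-! ### The fusion relations -/

theorem RMat_map {q : ℂ} {N : ℕ} (c : Fin 2 → ℂ) (u v : MvPowerSeries (Fin 2) ℂ) :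
    (RMat q N u v).map (evalSeries c) = RMat q N (evalSeries c u) (evalSeries c v) := by
  ext1 ⟨a, b⟩ ⟨k, l⟩
  rw [Matrix.map_apply, RMat_apply, RMat_apply]
  simp only [map_add, apply_ite (evalSeries c), map_sub, evalSeries_smul, map_zero]

/-- At ratio `q²` the coefficient `q⁻¹u - qv` vanishes and the others become proportional to the
entries of `1 - P`. This degeneration is the source of all antisymmetry in the columns. -/
theorem RMat_fusion {q : ℂ} (hq : q ≠ 0) (N : ℕ) (t : PowerSeries ℂ) :
    RMat q N (q ^ 2 • t) t
      = ((q ^ 2 - 1) • t) • ((1 : Matrix (Fin N × Fin N) (Fin N × Fin N) (PowerSeries ℂ))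
          - (spectralData hq).swapMat) := by
  have hQ : (spectralData hq).Q = PowerSeries.C q := rfl
  have hQi : (spectralData hq).Qi = PowerSeries.C q⁻¹ := rfl
  have e1 : PowerSeries.C q * PowerSeries.C q⁻¹ = (1 : PowerSeries ℂ) := (spectralData hq).hQ
  ext1 ⟨a, b⟩ ⟨c, d⟩
  rw [RMat_apply, Matrix.smul_apply, Matrix.sub_apply, Matrix.one_apply, SpectralData.swapMat,
    Matrix.of_apply, SpectralData.swapWt]
  simp only [PowerSeries.smul_eq_C_mul, map_sub, map_pow, map_one, hQ, hQi, smul_eq_mul,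
    Prod.mk.injEq, Prod.swap_prod_mk]
  by_cases h1 : a = b
  · subst h1
    by_cases h2 : a = c ∧ a = d
    · obtain ⟨rfl, rfl⟩ := h2
      simp
      linear_combination (PowerSeries.C q * t) * e1
    · have h3 : ¬ (a = d ∧ a = c) := fun h => h2 h.symm
      simp [h2, h3]
  · by_cases h2 : a = c ∧ b = d
    · obtain ⟨rfl, rfl⟩ := h2
      simp [h1]
      ring
    · by_cases h3 : a = d ∧ b = c
      · obtain ⟨rfl, rfl⟩ := h3
        rcases lt_or_gt_of_ne h1 with h | h
        · simp [h1, h, h.not_gt]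
          linear_combination (PowerSeries.C q * t) * e1
        · simp [h1, h]
          linear_combination (PowerSeries.C q * t) * e1
      · simp [h2, h3]

theorem transpose₁_RMat_eq {q : ℂ} (hq : q ≠ 0) (N n : ℕ) :
    transpose₁ (RMat q N ((spectralData hq).y n) 1)
      = ((spectralData hq).y n - 1) • (spectralData hq).pairR n := by
  rw [← RBarT_eq hq]
  change _ = ((spectralData hq).y n - 1) • ((spectralData hq).d n •
    transpose₁ (RMat q N ((spectralData hq).y n) 1))
  rw [smul_smul, mul_comm, (spectralData hq).hd, one_smul]

variable {A : Type*} [Ring A] [Algebra ℂ A]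

theorem X_smul_cancel {f g : PowerSeries A}
    (h : (PowerSeries.X : PowerSeries ℂ) • f = (PowerSeries.X : PowerSeries ℂ) • g) : f = g := by
  rw [Algebra.smul_def, Algebra.smul_def, algebraMap_series, scalarSeries, PowerSeries.map_X] at h
  ext n
  rw [← PowerSeries.coeff_succ_X_mul, h, PowerSeries.coeff_succ_X_mul]

theorem evalSeries_genMatrix {q : ℂ} {N : ℕ} (s : Fin N → Fin N → ℕ → A) {c : Fin 2 → ℂ}
    (k : Fin 2) (a : ℕ) (hc : c k = q ^ (2 * a)) :
    (genMatrix s k).map (evalSeries c)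
      = shifted q (Matrix.of fun i j => PowerSeries.mk (s i j)) a := by
  ext1 i j
  rw [Matrix.map_apply, evalSeries_single c k (s i j) (genMatrix s k i j) fun d => rfl]
  ext n
  rw [shifted, Matrix.map_apply, Matrix.of_apply, coeff_rescaleArg, PowerSeries.coeff_mk,
    PowerSeries.coeff_mk, neg_mul, zpow_neg, inv_inv, hc]
  norm_cast

theorem kronecker_one_map {N : ℕ} {R R' : Type*} [Ring R] [Ring R'] (f : R →+* R')
    (X : Matrix (Fin N) (Fin N) R) :
    (X ⊗ₖ (1 : Matrix (Fin N) (Fin N) R)).map f = X.map f ⊗ₖ 1 := by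
  ext1 x y
  simp [Matrix.kroneckerMap_apply, Matrix.one_apply, apply_ite f]

theorem one_kronecker_map {N : ℕ} {R R' : Type*} [Ring R] [Ring R'] (f : R →+* R')
    (X : Matrix (Fin N) (Fin N) R) :
    ((1 : Matrix (Fin N) (Fin N) R) ⊗ₖ X).map f = 1 ⊗ₖ X.map f := by
  ext1 x y
  simp [Matrix.kroneckerMap_apply, Matrix.one_apply, apply_ite f]

/-- The reflection equation implies the fusion relations. -/
theorem fusion_of_reflection {q : ℂ} (hq : q ≠ 0) (hq2 : q ^ 2 ≠ 1) {N : ℕ}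
    {s : Fin N → Fin N → ℕ → A} (hs : reflLHS q s = reflRHS q s) (a : ℕ) :
    (spectralData hq).Fusion (2 * a + 1)
      (shifted q (Matrix.of fun i j => PowerSeries.mk (s i j)) a)
      (shifted q (Matrix.of fun i j => PowerSeries.mk (s i j)) (a + 1)) := by
  -- The substitution puts the two variables at `u_a⁻¹` and `u_{a+1}⁻¹`. Since `reflR` is `R(z₁,
  -- z₀)`, its arguments have ratio `q²`.
  obtain ⟨c, hc⟩ : ∃ c : Fin 2 → ℂ, c = ![q ^ (2 * a), q ^ (2 * (a + 1))] := ⟨_, rfl⟩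
  have hc0 : c 0 = q ^ (2 * a) := by rw [hc]; rfl
  have hc1 : c 1 = q ^ (2 * (a + 1)) := by rw [hc]; rfl
  obtain ⟨t, ht⟩ : ∃ t : PowerSeries ℂ, t = q ^ (2 * a) • PowerSeries.X := ⟨_, rfl⟩
  have hR : (reflR q N A).map (evalSeries c) = (((q ^ 2 - 1) • t) •
      ((1 : Matrix (Fin N × Fin N) (Fin N × Fin N) (PowerSeries ℂ))
        - (spectralData hq).swapMat)).map (algebraMap (PowerSeries ℂ) (PowerSeries A)) := by
    rw [← RMat_fusion hq]
    have : RMat q N (q ^ 2 • t) t = (RMat q N (MvPowerSeries.X 1) (MvPowerSeries.X 0)).map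
        (evalSeries c) := by
      rw [RMat_map, evalSeries_X, evalSeries_X, hc0, hc1, ht, smul_smul, ← pow_add]
      congr 3
      ring
    rw [this]
    ext1 x y
    exact evalSeries_map c _
  have hRt : (reflRt q N A).map (evalSeries c) = (((spectralData hq).y (2 * a + 1) - 1) •
      (spectralData hq).pairR (ι := Fin N) (2 * a + 1)).map
        (algebraMap (PowerSeries ℂ) (PowerSeries A)) := by
    rw [← transpose₁_RMat_eq hq]
    have : RMat q N ((spectralData hq).y (2 * a + 1)) 1
        = (RMat q N (MvPowerSeries.X 0 * MvPowerSeries.X 1) 1).map (evalSeries c) := by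
      have hy : (spectralData hq).y (2 * a + 1) = q ^ (2 * (2 * a + 1)) • PowerSeries.X ^ 2 := rfl
      rw [RMat_map, map_mul, map_one, evalSeries_X, evalSeries_X, hc0, hc1, hy,
        smul_mul_smul_comm, ← pow_add, ← pow_two]
      congr 3
      ring
    rw [this]
    ext1 x y
    exact evalSeries_map c _
  have h := congrArg (fun M => (evalSeries c).mapMatrix M) hs
  simp only [reflLHS, reflRHS, map_mul, RingHom.mapMatrix_apply, hR, hRt, kronecker_one_map,
    one_kronecker_map,
    evalSeries_genMatrix (q := q) s 0 a hc0, evalSeries_genMatrix (q := q) s 1 (a + 1) hc1] at h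
  generalize shifted q (Matrix.of fun i j => PowerSeries.mk (s i j)) a = M at h ⊢
  generalize shifted q (Matrix.of fun i j => PowerSeries.mk (s i j)) (a + 1) = M' at h ⊢
  have hsm : ∀ (k : PowerSeries ℂ) (X : Matrix (Fin N × Fin N) (Fin N × Fin N) (PowerSeries ℂ)),
      (k • X).map (algebraMap (PowerSeries ℂ) (PowerSeries A))
        = k • X.map (algebraMap (PowerSeries ℂ) (PowerSeries A)) := by
    intro k X
    ext1 x y
    rw [Matrix.map_apply, Matrix.smul_apply, Matrix.smul_apply, Matrix.map_apply, smul_eq_mul, map_mul,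
      ← Algebra.smul_def]
  simp only [hsm, smul_mul_assoc, mul_smul_comm, smul_smul] at h
  rw [mul_comm t] at h
  -- The witness is the right-hand side `S₂ R̄ᵗ S₁ R` of the reflection equation without its last
  -- factor.
  refine ⟨(1 ⊗ₖ M') * ((spectralData hq).pairR (2 * a + 1)).map
    (algebraMap (PowerSeries ℂ) (PowerSeries A)) * (M ⊗ₖ 1), ?_⟩
  -- The scalar common to both sides is a unit times `u⁻¹`: the unit is inverted here, and `u⁻¹`,
  -- which is only a nonzerodivisor, is removed by `X_smul_cancel`.
  have hk : (PowerSeries.C ((q ^ 2 - 1) * q ^ (2 * a))⁻¹ * (spectralData hq).d (2 * a + 1)) *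
      ((q ^ 2 - 1) • (((spectralData hq).y (2 * a + 1) - 1) * t)) = PowerSeries.X := by
    have hne : (q ^ 2 - 1) * q ^ (2 * a) ≠ 0 :=
      mul_ne_zero (sub_ne_zero.2 hq2) (pow_ne_zero _ hq)
    have e : PowerSeries.C ((q ^ 2 - 1) * q ^ (2 * a))⁻¹
        * (PowerSeries.C (q ^ 2 - 1) * PowerSeries.C (q ^ (2 * a))) = (1 : PowerSeries ℂ) := by
      rw [← map_mul, ← map_mul, inv_mul_cancel₀ hne, map_one]
    rw [ht, PowerSeries.smul_eq_C_mul, PowerSeries.smul_eq_C_mul]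
    linear_combination (PowerSeries.X : PowerSeries ℂ) * e + PowerSeries.X *
      (PowerSeries.C ((q ^ 2 - 1) * q ^ (2 * a))⁻¹ *
        (PowerSeries.C (q ^ 2 - 1) * PowerSeries.C (q ^ (2 * a)))) *
          (spectralData hq).hd (2 * a + 1)
  generalize (q ^ 2 - 1) • (((spectralData hq).y (2 * a + 1) - 1) * t) = k at h hk
  generalize PowerSeries.C ((q ^ 2 - 1) * q ^ (2 * a))⁻¹ * (spectralData hq).d (2 * a + 1) = k' at hk
  ext1 x y
  have h' := congrFun (congrFun h x) y
  rw [Matrix.smul_apply, Matrix.smul_apply] at h'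
  apply X_smul_cancel
  rw [← hk, mul_smul, mul_smul, SpectralData.sandwich, ← Matrix.mul_assoc, ← Matrix.mul_assoc]
  exact congrArg _ h'

/-! ### The twisted `q`-Yangians -/

section Map

variable {F : Type*} [Ring F] [Algebra ℂ F] (q : ℂ) {N : ℕ} (φ : F →ₐ[ℂ] A)

theorem genMatrix_map (s : Fin N → Fin N → ℕ → F) (k : Fin 2) :
    (genMatrix s k).map (MvPowerSeries.map (φ : F →+* A))
      = genMatrix (fun i j r => φ (s i j r)) k := by
  ext i j d
  rw [Matrix.map_apply, MvPowerSeries.coeff_map]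
  change φ (if d = Finsupp.single k (d k) then s i j (d k) else 0)
    = if d = Finsupp.single k (d k) then φ (s i j (d k)) else 0
  rw [apply_ite φ, map_zero]

theorem liftMv_map (X : Matrix (Fin N × Fin N) (Fin N × Fin N) (MvPowerSeries (Fin 2) ℂ)) :
    (liftMv F X).map (MvPowerSeries.map (φ : F →+* A)) = liftMv A X := by
  ext x y d
  simp [liftMv]

theorem reflLHS_map (s : Fin N → Fin N → ℕ → F) :
    (reflLHS q s).map (MvPowerSeries.map (φ : F →+* A)) = reflLHS q fun i j r => φ (s i j r) := by
  rw [← RingHom.mapMatrix_apply, reflLHS, reflLHS, map_mul, map_mul, map_mul]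
  simp only [RingHom.mapMatrix_apply, kronecker_one_map, one_kronecker_map, genMatrix_map, reflR,
    reflRt, liftMv_map]

theorem reflRHS_map (s : Fin N → Fin N → ℕ → F) :
    (reflRHS q s).map (MvPowerSeries.map (φ : F →+* A)) = reflRHS q fun i j r => φ (s i j r) := by
  rw [← RingHom.mapMatrix_apply, reflRHS, reflRHS, map_mul, map_mul, map_mul]
  simp only [RingHom.mapMatrix_apply, kronecker_one_map, one_kronecker_map, genMatrix_map, reflR,
    reflRt, liftMv_map]

/-- Turns the coefficientwise relations imposed on the free algebra into one matrix identity over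
the quotient. -/
theorem reflection_of_forall_coeff (s : Fin N → Fin N → ℕ → F)
    (h : ∀ x y d, φ (MvPowerSeries.coeff d (reflLHS q s x y))
      = φ (MvPowerSeries.coeff d (reflRHS q s x y))) :
    reflLHS q (fun i j r => φ (s i j r)) = reflRHS q fun i j r => φ (s i j r) := by
  rw [← reflLHS_map, ← reflRHS_map]
  ext x y d
  exact h x y d

end Map

theorem orthS_fusion {q : ℂ} (hq : q ≠ 0) (hq2 : q ^ 2 ≠ 1) (N a : ℕ) :
    (spectralData hq).Fusion (2 * a + 1) (shifted q (orthS q N) a)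
      (shifted q (orthS q N) (a + 1)) :=
  fusion_of_reflection hq hq2 (reflection_of_forall_coeff q (RingQuot.mkAlgHom ℂ (OrthRel q N)) orthGen
    fun x y d => RingQuot.mkAlgHom_rel ℂ (OrthRel.reflection x y d)) a

theorem sympS_fusion {q : ℂ} (hq : q ≠ 0) (hq2 : q ^ 2 ≠ 1) (n a : ℕ) :
    (spectralData hq).Fusion (2 * a + 1) (shifted q (sympS q n) a)
      (shifted q (sympS q n) (a + 1)) :=
  fusion_of_reflection hq hq2 (reflection_of_forall_coeff q (RingQuot.mkAlgHom ℂ (SympRel q n)) sympGen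
    fun x y d => RingQuot.mkAlgHom_rel ℂ (SympRel.reflection x y d)) a

end Sklyanin
end

theorem mainTheorem8 (q : ℂ) (hq0 : q ≠ 0) (hq : ∀ k : ℕ, 0 < k → q ^ k ≠ 1) :
    (∀ N : ℕ,
      Sklyanin.sdet q (Sklyanin.orthS q N) =
        ∑ p : Equiv.Perm (Fin N),
          (-q) ^ ((Sklyanin.invNum (Sklyanin.primePerm p) : ℤ) - (Sklyanin.invNum p : ℤ)) •
            (List.ofFn fun k : Fin N =>
              Sklyanin.rescaleArg (q ^ (-2 * ((k : ℕ) : ℤ)))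
                (if (k : ℕ) < N / 2 then
                  Sklyanin.sSharp q (Sklyanin.orthS q N) (p k) (Sklyanin.primePerm p k)
                else Sklyanin.orthS q N (p k) (Sklyanin.primePerm p k))).prod) ∧
    (∀ n : ℕ,
      Sklyanin.sdet q (Sklyanin.sympS q n) =
        ∑ p : Equiv.Perm (Fin (2 * n)),
          (-q) ^ ((Sklyanin.invNum (Sklyanin.primePerm p) : ℤ) - (Sklyanin.invNum p : ℤ)) •
            (List.ofFn fun k : Fin (2 * n) =>
              Sklyanin.rescaleArg (q ^ (-2 * ((k : ℕ) : ℤ)))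
                (if (k : ℕ) < n then
                  Sklyanin.sSharp q (Sklyanin.sympS q n) (p k) (Sklyanin.primePerm p k)
                else Sklyanin.sympS q n (p k) (Sklyanin.primePerm p k))).prod) := by
  -- `q² ≠ 1` makes the scalar in front of `1 - P` in `RMat_fusion` cancellable.
  have hq2 := hq 2 two_pos
  refine ⟨fun N => Sklyanin.sdet_eq_sum_of_fusion hq0 (Sklyanin.orthS_fusion hq0 hq2 N),
    fun n => ?_⟩
  have h := Sklyanin.sdet_eq_sum_of_fusion hq0 (Sklyanin.sympS_fusion hq0 hq2 n)
  rw [Nat.mul_div_cancel_left n two_pos] at h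
  exact h
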